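/- \textbf{Setting.} For $q^{1/2},t^{1/2}\in\mathbb C^*$ let $\mathcal H_{q^{1/2},t^{1/2}}$ be the double affine Hecke algebra of type $A_1$, generated by invertible $X,Y,T$ with the relations $$(T-t^{1/2})(T+t^{-1/2})=0,\quad TXT=X^{-1},\quad T^{-1}YT^{-1}=Y^{-1},\quad Y^{-1}X^{-1}YXT^2q^{1/2}=1 .$$ It acts in $\mathscr X=\mathbb C[X^{\pm1}]$ by: $X$ is multiplication by $X$, $T=t^{1/2}s+\frac{t^{1/2}-t^{-1/2}}{X^2-1}(s-1)$, $Y=\pi T$, where $s(X^n)=X^{-n}$ and $\pi(X^n)=q^{n/2}X^{-n}$. For an $\mathcal H$-module $V$, $Image(\mathcal B_q)\subset GL(V)$ is the group generated by $X,Y,T$ and the scalar $q^{1/2}$. All types of modules below are understood together with their images under the twists $\varsigma_x:X\mapsto -X$, $\varsigma_y:Y\mapsto -Y$ and $\varsigma_x\varsigma_y$. Let $N>1$, let $q^{1/2}$ be a primitive $(2N)$th root of unity, $2k\in\mathbb Z$, $t=(q^{1/2})^{2k}$, with any choice of the square root $t^{1/2}$. Consider the following modules. $(\alpha)$, $0<k<N/2$: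 the irreducible quotient $V_{2N-4k}$ of $\mathscr X/(X^{2N}+X^{-2N}-2)$ if $k\in\mathbb Z$, and of $\mathscr X/(X^{N}+X^{-N})$ if $k\in\frac12+\mathbb Z$. $(\beta)$, $-N/2<k<0$, $k\in\mathbb Z$: the irreducible quotient $V_{2N+4|k|}$ of $\mathscr X/(X^{2N}+X^{-2N}-2)$. $(\gamma)$, $-N/2<k<0$, $k\in\frac12+\mathbb Z$: the irreducible quotients $V^\pm_{2|k|}$ of $\mathscr X/(X^{N}+X^{-N})$. For odd $N$, let $\mathcal H^\checkmark$ and $\mathscr X^\checkmark$ be obtained by the substitution $q^{1/2}\mapsto q$, $t\mapsto t^2$ (with any square root of $t^2$ as the new $t^{1/2}$); the group generated by $X,Y,T$ and the scalar $q$ is considered. Consider: $(\alpha^\checkmark,\beta^\checkmark)$, $0<|k|<N/2$, $k\in\mathbb Z$, and $(\gamma^\checkmark)$, $-N/2<k<0$, $k\in\frac12+\mathbb Z$: the irreducible quotients of $\mathscr X^\checkmark/(X^N+X^{-N}-2)$; $(\alpha^\checkmark)$, $0<k<N/2$, $k\in\frac12+\mathbb Z$: any finite-dimensional irreducible quotient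 of $\mathscr X^\checkmark$. \textbf{Theorem.} (i) For $V$ of type $(\alpha)$, $Image(\mathcal B_q)$ is finite if and only if we are in one of the cases: $k=(N-1)/2$, and then $\dim V=2$; $N>2$, $k=(N-2)/2$, and then $\dim V=4$; $N=6$, $k=1$, and then $\dim V=8$; $N=10$, $k=3$, and then $\dim V=8$. (ii) For $V$ of type $(\beta)$, $Image(\mathcal B_q)$ is infinite. For $V$ of type $(\gamma)$ it is finite if and only if $\dim V=1$. (iii) Let $N$ be odd. For $V^\checkmark$ of types $(\alpha^\checkmark)$ with $k\in\mathbb Z$, $(\beta^\checkmark)$ and $(\gamma^\checkmark)$, $Image(\mathcal B_q)$ is finite if and only if $\dim V^\checkmark=1$. For $V^\checkmark$ of type $(\alpha^\checkmark)$ with $k\in\frac12+\mathbb Z$ it is infinite. (iv) For even $N>2$ and $k=(N-2)/2$, the polynomial representation with the parameters $q^{1/2}\mapsto q$, $t\mapsto t^2$ (any square root of $t^2$) has no irreducible quotient of dimension $2$ (also after the twists). (v) $Image(\mathcal B_q)$ is finite in the boundary cases $(\alpha^\bullet)$: $k=0$, $t=1$, $t^{1/2}=\pm1$, for the irreducible quotient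 $V_{2N}=\mathscr X/(X^N-X^{-N})$; and $(\gamma^\checkmark)$ with $N$ odd, $k=-N/2$, $t^\checkmark=1$, $(t^\checkmark)^{1/2}=\pm1$, for the irreducible quotient of $\mathscr X^\checkmark/(X^N+X^{-N}-2)$. -/

import Mathlib

open scoped LaurentPolynomial

noncomputable section

namespace DAHA

/-- The space `𝒳 = ℂ[X, X⁻¹]`; the monomial `Xⁿ` is `LaurentPolynomial.T n`. -/
abbrev PolySpace : Type := ℂ[T;T⁻¹]

/-- The monomial `Xⁿ`. -/
abbrev mono (n : ℤ) : PolySpace := LaurentPolynomial.T n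

/-- The linear operator on `𝒳` with prescribed values on the monomials `Xⁿ`. -/
def ofMono (g : ℤ → PolySpace) : Module.End ℂ PolySpace :=
  (AddMonoidAlgebra.basis ℤ ℂ).constr ℂ g

theorem ofMono_mono (g : ℤ → PolySpace) (n : ℤ) : ofMono g (mono n) = g n := by
  have h := (AddMonoidAlgebra.basis ℤ ℂ).constr_basis ℂ g n
  rwa [AddMonoidAlgebra.basis_apply] at h

theorem end_ext {A B : Module.End ℂ PolySpace} (h : ∀ n, A (mono n) = B (mono n)) : A = B := by
  refine (AddMonoidAlgebra.basis ℤ ℂ).ext fun n => ?_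
  rw [AddMonoidAlgebra.basis_apply]
  exact h n

/-- Multiplication by `Xᵐ`. -/
def mulX (m : ℤ) : Module.End ℂ PolySpace := LinearMap.mulLeft ℂ (mono m)

/-- The reflection `s(Xⁿ) = X⁻ⁿ`. -/
def refl : Module.End ℂ PolySpace := ofMono fun n => mono (-n)

/-- The operator `π(Xⁿ) = q^{n/2} X⁻ⁿ`, where `u = q^{1/2}`. -/
def piOp (u : ℂˣ) : Module.End ℂ PolySpace := ofMono fun n => ((u ^ n : ℂˣ) : ℂ) • mono (-n)

/-- The divided difference `(X² - 1)⁻¹ ∘ (s - 1)`, written out on monomials;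
`divDiff_spec` below is its defining property. -/
def divDiff : Module.End ℂ PolySpace := ofMono fun n =>
  if 0 ≤ n then -∑ i ∈ Finset.range n.toNat, mono (-n + 2 * i)
  else ∑ i ∈ Finset.range (-n).toNat, mono (n + 2 * i)

theorem mono_mul (m n : ℤ) : mono m * mono n = mono (m + n) := (LaurentPolynomial.T_add m n).symm

theorem geom (a : ℤ) (k : ℕ) :
    (mono 2 - 1) * ∑ i ∈ Finset.range k, mono (a + 2 * i) = mono (a + 2 * k) - mono a := by
  induction k with
  | zero => simp
  | succ k ih =>
    rw [Finset.sum_range_succ, mul_add, ih, sub_mul, one_mul, mono_mul]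
    have : (2 : ℤ) + (a + 2 * (k : ℤ)) = a + 2 * ((k + 1 : ℕ) : ℤ) := by push_cast; ring
    rw [this]; ring

theorem divDiff_spec (f : PolySpace) : (mono 2 - 1) * divDiff f = refl f - f := by
  have h : (LinearMap.mulLeft ℂ (mono 2 - 1)) * divDiff = refl - 1 := by
    refine end_ext fun n => ?_
    simp only [Module.End.mul_apply, LinearMap.mulLeft_apply, LinearMap.sub_apply,
      Module.End.one_apply, divDiff, refl, ofMono_mono]
    split_ifs with hn
    · rw [mul_neg, geom, Int.toNat_of_nonneg hn, show -n + 2 * n = n by ring]; ring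
    · rw [geom, Int.toNat_of_nonneg (by omega), show n + 2 * -n = -n by ring]
  exact congrArg (fun A => A f) h

theorem mono_two_sub_one_ne : (mono 2 - 1 : PolySpace) ≠ 0 := by
  intro h
  have := congrArg (fun p : PolySpace => p.coeff 2) h
  simp [← LaurentPolynomial.T_zero] at this

/-- Test equality in `𝒳` after multiplying by `X² - 1`. -/
theorem cancel {f g : PolySpace} (h : (mono 2 - 1) * f = (mono 2 - 1) * g) : f = g :=
  mul_left_cancel₀ mono_two_sub_one_ne h

theorem refl_mul (f g : PolySpace) : refl (f * g) = refl f * refl g := by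
  have h : refl = (LaurentPolynomial.invert (R := ℂ)).toLinearMap := by
    refine end_ext fun n => ?_
    simp [refl, ofMono_mono]
  simp [h]

theorem refl_mono (n : ℤ) : refl (mono n) = mono (-n) := ofMono_mono _ n

theorem refl_refl (f : PolySpace) : refl (refl f) = f := by
  have h : refl * refl = 1 := end_ext fun n => by simp [refl_mono]
  exact congrArg (fun A => A f) h

theorem refl_one : refl 1 = 1 := by simpa using refl_mono 0

theorem piOp_mono (u : ℂˣ) (n : ℤ) : piOp u (mono n) = ((u ^ n : ℂˣ) : ℂ) • mono (-n) :=
  ofMono_mono _ n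

theorem piOp_sq (u : ℂˣ) : piOp u * piOp u = 1 := by
  refine end_ext fun n => ?_
  rw [Module.End.mul_apply, piOp_mono, map_smul, piOp_mono, smul_smul, ← Units.val_mul,
    ← zpow_add, add_neg_cancel, neg_neg]
  simp

theorem piOp_mulX (u : ℂˣ) (m : ℤ) :
    piOp u * mulX m = ((u ^ m : ℂˣ) : ℂ) • (mulX (-m) * piOp u) := by
  refine end_ext fun n => ?_
  simp only [Module.End.mul_apply, LinearMap.smul_apply, mulX, LinearMap.mulLeft_apply, mono_mul,
    piOp_mono, mul_smul_comm, smul_smul, ← Units.val_mul, ← zpow_add, neg_add]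

/-- The Demazure-Lusztig operator `T = t^{1/2} s + (t^{1/2} - t^{-1/2}) (X² - 1)⁻¹ ∘ (s - 1)`,
where `τ = t^{1/2}`. -/
def heckeOp (τ : ℂˣ) : Module.End ℂ PolySpace :=
  (τ : ℂ) • refl + ((τ : ℂ) - ((τ⁻¹ : ℂˣ) : ℂ)) • divDiff

theorem smul_eq (a : ℂ) (f : PolySpace) : a • f = LaurentPolynomial.C a * f :=
  LaurentPolynomial.smul_eq_C_mul a f

theorem refl_C (a : ℂ) : refl (LaurentPolynomial.C a) = LaurentPolynomial.C a := by
  have : (LaurentPolynomial.C a : PolySpace) = a • 1 := by rw [smul_eq, mul_one]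
  rw [this, map_smul, refl_one]

theorem heckeOp_spec (τ : ℂˣ) (f : PolySpace) :
    (mono 2 - 1) * heckeOp τ f = LaurentPolynomial.C (τ : ℂ) * (mono 2 - 1) * refl f +
      (LaurentPolynomial.C (τ : ℂ) - LaurentPolynomial.C ((τ⁻¹ : ℂˣ) : ℂ)) * (refl f - f) := by
  rw [← divDiff_spec]
  simp only [heckeOp, LinearMap.add_apply, LinearMap.smul_apply, smul_eq, map_sub]
  ring

theorem C_mul_C_inv (τ : ℂˣ) :
    (LaurentPolynomial.C (τ : ℂ) : PolySpace) * LaurentPolynomial.C ((τ⁻¹ : ℂˣ) : ℂ) = 1 := by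
  rw [← map_mul]; simp

theorem mono_two_neg_two : mono 2 * mono (-2) = 1 := by rw [mono_mul]; simp

theorem refl_heckeOp_spec (τ : ℂˣ) (f : PolySpace) :
    (mono 2 - 1) * refl (heckeOp τ f) = LaurentPolynomial.C (τ : ℂ) * (mono 2 - 1) * f +
      (LaurentPolynomial.C (τ : ℂ) - LaurentPolynomial.C ((τ⁻¹ : ℂˣ) : ℂ)) *
        (mono 2 * (refl f - f)) := by
  have h := congrArg refl (heckeOp_spec τ f)
  simp only [refl_mul, map_add, map_sub, refl_mono, refl_C, refl_refl, refl_one] at h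
  have e := mono_two_neg_two
  linear_combination (-mono 2) * h + (refl (heckeOp τ f) - LaurentPolynomial.C (τ : ℂ) * f) * e

theorem heckeOp_quad (τ : ℂˣ) :
    (heckeOp τ - algebraMap ℂ _ (τ : ℂ)) * (heckeOp τ + algebraMap ℂ _ ((τ⁻¹ : ℂˣ) : ℂ)) = 0 := by
  refine LinearMap.ext fun f => cancel (cancel ?_)
  simp only [Module.End.mul_apply, LinearMap.sub_apply, LinearMap.add_apply, map_add,
    Module.algebraMap_end_apply, smul_eq, LinearMap.zero_apply]
  have h0 : heckeOp τ (LaurentPolynomial.C ((τ⁻¹ : ℂˣ) : ℂ) * f) =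
      LaurentPolynomial.C ((τ⁻¹ : ℂˣ) : ℂ) * heckeOp τ f := by
    rw [← smul_eq, map_smul, smul_eq]
  rw [h0]
  have h1 := heckeOp_spec τ f
  have h2 := refl_heckeOp_spec τ f
  have h3 := heckeOp_spec τ (heckeOp τ f)
  have h4 := C_mul_C_inv τ
  set a := (LaurentPolynomial.C (τ : ℂ) : PolySpace)
  set b := (LaurentPolynomial.C ((τ⁻¹ : ℂˣ) : ℂ) : PolySpace)
  set M := (mono 2 : PolySpace)
  set g := heckeOp τ f
  linear_combination (M - 1) * h3 + (a * (M - 1) + (a - b)) * h2 + (M - 1) * (b - a) * h1 -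
    (a - b) * h1

theorem heckeOp_braid (τ : ℂˣ) (f : PolySpace) :
    heckeOp τ (mono 1 * heckeOp τ f) = mono (-1) * f := by
  refine cancel (cancel ?_)
  have h1 := heckeOp_spec τ f
  have h2 := refl_heckeOp_spec τ f
  have h3 := heckeOp_spec τ (mono 1 * heckeOp τ f)
  rw [refl_mul, refl_mono] at h3
  have h4 := C_mul_C_inv τ
  have e : mono 2 * mono (-1) = mono 1 := by rw [mono_mul]; norm_num
  set a := (LaurentPolynomial.C (τ : ℂ) : PolySpace)
  set b := (LaurentPolynomial.C ((τ⁻¹ : ℂˣ) : ℂ) : PolySpace)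
  set M := (mono 2 : PolySpace)
  set x := (mono 1 : PolySpace)
  set y := (mono (-1) : PolySpace)
  linear_combination (M - 1) * h3 + (a * (M - 1) + (a - b)) * y * h2 - (a - b) * x * h1 +
    (M - 1) ^ 2 * y * f * h4 + (a * (M - 1) + (a - b)) * (a - b) * (refl f - f) * e +
    a * (a - b) * (M - 1) * f * e

theorem heckeOp_inv_right (τ : ℂˣ) :
    heckeOp τ * (heckeOp τ - algebraMap ℂ _ ((τ : ℂ) - ((τ⁻¹ : ℂˣ) : ℂ))) = 1 := by
  have h := heckeOp_quad τ
  have c : algebraMap ℂ (Module.End ℂ PolySpace) (τ : ℂ) *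
      algebraMap ℂ (Module.End ℂ PolySpace) ((τ⁻¹ : ℂˣ) : ℂ) = 1 := by
    rw [← map_mul]; simp
  have c' := Algebra.commutes (τ : ℂ) (heckeOp τ)
  rw [sub_mul, mul_add, mul_add, c, c'] at h
  rw [map_sub, mul_sub, mul_sub]
  rw [← sub_eq_zero, ← h]
  abel

theorem heckeOp_inv_left (τ : ℂˣ) :
    (heckeOp τ - algebraMap ℂ _ ((τ : ℂ) - ((τ⁻¹ : ℂˣ) : ℂ))) * heckeOp τ = 1 := by
  rw [← heckeOp_inv_right τ, sub_mul, mul_sub, Algebra.commutes]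

/-- The operators of `X`, `T`, `π` on `𝒳` as invertible operators. -/
def unitX : (Module.End ℂ PolySpace)ˣ where
  val := mulX 1
  inv := mulX (-1)
  val_inv := end_ext fun n => by simp [mulX, mono_mul, -LaurentPolynomial.T_mul]
  inv_val := end_ext fun n => by simp [mulX, mono_mul, -LaurentPolynomial.T_mul]

def unitT (τ : ℂˣ) : (Module.End ℂ PolySpace)ˣ where
  val := heckeOp τ
  inv := heckeOp τ - algebraMap ℂ _ ((τ : ℂ) - ((τ⁻¹ : ℂˣ) : ℂ))
  val_inv := heckeOp_inv_right τ
  inv_val := heckeOp_inv_left τ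

def unitPi (u : ℂˣ) : (Module.End ℂ PolySpace)ˣ where
  val := piOp u
  inv := piOp u
  val_inv := piOp_sq u
  inv_val := piOp_sq u

theorem unitTXT (τ : ℂˣ) : unitT τ * unitX * unitT τ = unitX⁻¹ :=
  Units.ext (LinearMap.ext fun f => heckeOp_braid τ f)

/-- The scalar `c ∈ ℂˣ` as an invertible operator. -/
def scalar (V : Type*) [AddCommGroup V] [Module ℂ V] (c : ℂˣ) : (Module.End ℂ V)ˣ :=
  Units.map (algebraMap ℂ (Module.End ℂ V)).toMonoidHom c

theorem unitPiX (u : ℂˣ) : unitPi u * unitX⁻¹ * unitPi u = scalar _ u⁻¹ * unitX := by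
  have h : piOp u * mulX (-1) * piOp u = algebraMap ℂ _ ((u⁻¹ : ℂˣ) : ℂ) * mulX 1 := by
    rw [piOp_mulX, smul_mul_assoc, mul_assoc, piOp_sq, mul_one, neg_neg, zpow_neg_one,
      ← Algebra.smul_def]
  exact Units.ext h

/-- A representation on the complex vector space `V` of the double affine Hecke algebra of type
`A₁` with parameters `q^{1/2} = u`, `t^{1/2} = τ`: invertible operators `X`, `Y`, `T` that satisfy
the defining relations of the algebra. -/
structure Rep (u τ : ℂˣ) (V : Type*) [AddCommGroup V] [Module ℂ V] where
  X : (Module.End ℂ V)ˣ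
  Y : (Module.End ℂ V)ˣ
  T : (Module.End ℂ V)ˣ
  quad : ((T : Module.End ℂ V) - algebraMap ℂ _ (τ : ℂ)) *
    ((T : Module.End ℂ V) + algebraMap ℂ _ ((τ⁻¹ : ℂˣ) : ℂ)) = 0
  rel_TX : T * X * T = X⁻¹
  rel_TY : T⁻¹ * Y * T⁻¹ = Y⁻¹
  rel_XY : Y⁻¹ * X⁻¹ * Y * X * T ^ 2 * scalar V u = 1

/-- The polynomial representation, in `𝒳`: here `Y = π T`. -/
def polyRep (u τ : ℂˣ) : Rep u τ PolySpace where
  X := unitX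
  Y := unitPi u * unitT τ
  T := unitT τ
  quad := heckeOp_quad τ
  rel_TX := unitTXT τ
  rel_TY := by
    have h : (unitPi u)⁻¹ = unitPi u := rfl
    rw [mul_inv_rev, h]; group
  rel_XY := by
    have h : (unitPi u)⁻¹ = unitPi u := rfl
    have hc : ∀ A, scalar PolySpace u * A = A * scalar PolySpace u := fun A =>
      Units.ext (Algebra.commutes (u : ℂ) (A : Module.End ℂ PolySpace))
    have hs : scalar PolySpace u⁻¹ = (scalar PolySpace u)⁻¹ := map_inv _ _
    calc (unitPi u * unitT τ)⁻¹ * unitX⁻¹ * (unitPi u * unitT τ) * unitX * unitT τ ^ 2 *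
          scalar PolySpace u
        = (unitT τ)⁻¹ * (unitPi u * unitX⁻¹ * unitPi u) * (unitT τ * unitX * unitT τ) *
          unitT τ * scalar PolySpace u := by
            rw [mul_inv_rev, h, pow_two]; simp only [mul_assoc]
      _ = 1 := by
            rw [unitPiX, unitTXT, hs, mul_assoc, ← hc]
            simp only [mul_assoc]
            rw [mul_inv_cancel_left, ← mul_assoc (scalar PolySpace u)⁻¹, ← hc]
            simp

variable {u τ : ℂˣ} {V : Type*} [AddCommGroup V] [Module ℂ V]

namespace Rep

/-- The image in `GL(V)` of the elliptic braid group `B_q = ⟨X, Y, T, q^{1/2}⟩`. -/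
def imageB (ρ : Rep u τ V) : Subgroup (Module.End ℂ V)ˣ :=
  Subgroup.closure {ρ.X, ρ.Y, ρ.T, scalar V u}

/-- Irreducibility: `V ≠ 0` and there are no invariant subspaces besides `0` and `V`. -/
def IsIrreducible (ρ : Rep u τ V) : Prop :=
  Nontrivial V ∧ ∀ W : Submodule ℂ V,
    (∀ g ∈ ρ.imageB, ∀ w ∈ W, (g : Module.End ℂ V) w ∈ W) → W = ⊥ ∨ W = ⊤

/-- `V` is a quotient module of `𝒳 / (f)`: an equivariant surjection `𝒳 → V` kills `f`
(and hence the ideal `(f)`, as it commutes with `X`). -/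
def IsQuotient (ρ : Rep u τ V) (f : PolySpace) : Prop :=
  ∃ φ : PolySpace →ₗ[ℂ] V, Function.Surjective φ ∧
    (∀ p, φ (((polyRep u τ).X : Module.End ℂ PolySpace) p) = (ρ.X : Module.End ℂ V) (φ p)) ∧
    (∀ p, φ (((polyRep u τ).Y : Module.End ℂ PolySpace) p) = (ρ.Y : Module.End ℂ V) (φ p)) ∧
    (∀ p, φ (((polyRep u τ).T : Module.End ℂ PolySpace) p) = (ρ.T : Module.End ℂ V) (φ p)) ∧
    φ f = 0

/-- The twist by the automorphism `ς_x : X ↦ -X, Y ↦ Y, T ↦ T`. -/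
def twistX (ρ : Rep u τ V) : Rep u τ V where
  X := -ρ.X
  Y := ρ.Y
  T := ρ.T
  quad := ρ.quad
  rel_TX := by rw [mul_neg, neg_mul, ρ.rel_TX, inv_neg]
  rel_TY := ρ.rel_TY
  rel_XY := by rw [inv_neg]; simpa using ρ.rel_XY

/-- The twist by the automorphism `ς_y : X ↦ X, Y ↦ -Y, T ↦ T`. -/
def twistY (ρ : Rep u τ V) : Rep u τ V where
  X := ρ.X
  Y := -ρ.Y
  T := ρ.T
  quad := ρ.quad
  rel_TX := ρ.rel_TX
  rel_TY := by rw [mul_neg, neg_mul, ρ.rel_TY, inv_neg]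
  rel_XY := by rw [inv_neg]; simpa using ρ.rel_XY

/-- `V` is an irreducible quotient of `𝒳 / (f)`, or one of the images of such a module under
`ς_x`, `ς_y`, `ς_x ς_y` (these automorphisms are involutive and commute). -/
def IsIrredQuotient (ρ : Rep u τ V) (f : PolySpace) : Prop :=
  ρ.IsIrreducible ∧
    (ρ.IsQuotient f ∨ ρ.twistX.IsQuotient f ∨ ρ.twistY.IsQuotient f ∨
      ρ.twistX.twistY.IsQuotient f)

/-!
The types of modules. Half-integral `k` is encoded by the integer `κ = 2k`, so that
`t = q^k = (q^{1/2})^κ`; `t^{1/2}` is any of the two square roots of `t`.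
The parameter `u = q^{1/2}` will be a primitive root of unity of order `2N`.
-/

/-- The symmetric Laurent polynomial `X^m + X^{-m} - c`. -/
def _root_.DAHA.symPoly (m : ℕ) (c : ℂ) : PolySpace := mono m + mono (-m) - LaurentPolynomial.C c

/-- Type `(α)`, `0 < k < N/2`: the irreducible quotient `V_{2N-4k}` of
`𝒳 / (X^{2N} + X^{-2N} - 2)` for integral `k`, of `𝒳 / (X^N + X^{-N})` for half-integral `k`. -/
def IsAlpha (N : ℕ) (κ : ℤ) (ρ : Rep u τ V) : Prop :=
  0 < κ ∧ κ < N ∧ τ ^ 2 = u ^ κ ∧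
    ((Even κ ∧ ρ.IsIrredQuotient (symPoly (2 * N) 2)) ∨ (Odd κ ∧ ρ.IsIrredQuotient (symPoly N 0)))

/-- Type `(β)`, `-N/2 < k < 0` integral: the irreducible quotient `V_{2N+4|k|}` of
`𝒳 / (X^{2N} + X^{-2N} - 2)`. -/
def IsBeta (N : ℕ) (κ : ℤ) (ρ : Rep u τ V) : Prop :=
  -N < κ ∧ κ < 0 ∧ Even κ ∧ τ ^ 2 = u ^ κ ∧ ρ.IsIrredQuotient (symPoly (2 * N) 2)

/-- Type `(γ)`, `-N/2 < k < 0` half-integral: the irreducible quotients `V^±_{2|k|}` of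
`𝒳 / (X^N + X^{-N})` and their `ς`-images. -/
def IsGamma (N : ℕ) (κ : ℤ) (ρ : Rep u τ V) : Prop :=
  -N < κ ∧ κ < 0 ∧ Odd κ ∧ τ ^ 2 = u ^ κ ∧ ρ.IsIrredQuotient (symPoly N 0)

/-- The boundary type `(α•)`, `k = 0`, `t = 1`: `V_{2N} = 𝒳 / (X^N - X^{-N})`. -/
def IsAlphaBoundary (N : ℕ) (ρ : Rep u τ V) : Prop :=
  τ ^ 2 = 1 ∧ ρ.IsIrredQuotient (mono N - mono (-N))

/-!
The modules `V^✓` for odd `N`: the parameters are `q^✓ = q²`, `(q^✓)^{1/2} = q = u²` and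
`t^✓ = t² = u^{2κ}`.
-/

/-- Types `(α^✓)` and `(β^✓)`, `0 < |k| < N/2` integral: `V^{±✓}_{N-2k}` for `k > 0` and
`V^{±✓}_{N+2|k|}` for `k < 0`, the irreducible quotients of `𝒳 / (X^N + X^{-N} ∓ 2)`, and their
`ς`-images; `ς_x` exchanges the two signs. -/
def IsAlphaBetaCheck (N : ℕ) (u : ℂˣ) {τ : ℂˣ} (κ : ℤ) (ρ : Rep (u ^ 2) τ V) : Prop :=
  0 < |κ| ∧ |κ| < N ∧ Even κ ∧ τ ^ 2 = u ^ (2 * κ) ∧ ρ.IsIrredQuotient (symPoly N 2)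

/-- Type `(γ^✓)`, `-N/2 < k < 0` half-integral: `V^{±✓}_{2|k|}`, and their `ς`-images.
As `(u²)^N = 1`, these are quotients of `𝒳 / (X^N + X^{-N} ∓ 2)`. -/
def IsGammaCheck (N : ℕ) (u : ℂˣ) {τ : ℂˣ} (κ : ℤ) (ρ : Rep (u ^ 2) τ V) : Prop :=
  -N < κ ∧ κ < 0 ∧ Odd κ ∧ τ ^ 2 = u ^ (2 * κ) ∧ ρ.IsIrredQuotient (symPoly N 2)

/-- The boundary case `k = -N/2`, `t^✓ = 1` of type `(γ^✓)`. -/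
def IsGammaCheckBoundary (N : ℕ) {u τ : ℂˣ} (ρ : Rep (u ^ 2) τ V) : Prop :=
  τ ^ 2 = 1 ∧ ρ.IsIrredQuotient (symPoly N 2)

/-- Any finite-dimensional irreducible quotient of the whole polynomial representation with the
parameters `q²`, `t²` (up to `ς_x`, `ς_y`). -/
def IsSphericalCheck (u : ℂˣ) {τ : ℂˣ} (κ : ℤ) (ρ : Rep (u ^ 2) τ V) : Prop :=
  FiniteDimensional ℂ V ∧ τ ^ 2 = u ^ (2 * κ) ∧ ρ.IsIrredQuotient 0

end Rep

end DAHA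

end

open scoped LaurentPolynomial

noncomputable section
namespace DAHA

/-! ### Evaluations -/

/-! Let `φ : 𝒳 → V` be the quotient map. Its support consists of the points `x` at which evaluation
factors through `φ`; in finite dimension these are the eigenvalues of `X`. Composition with `π`
turns `ev x` into `ev (u / x)`, and `T` mixes `ev x` with `ev x⁻¹` unless `τ² x² = 1` (a blocked
point) or `x = ±1`, where a derivative enters. Hence a blocked point of the support generates a
chain `x, x/u, x/u², …` (`supp_chain`). If the chain, together with its translate by `e = ±1`,
avoids `±1` and is closed under these moves, irreducibility identifies `V` with the functions on it
(`map_eq_zero_iff`), which yields the dimension.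

Infinite image has two sources. If the support meets `±1` and `t ≠ 1`, the derivative also descends
to `V`, so `X` is not semisimple (`sq_ne_one_of_finite`). Otherwise the commutator of `X` and `T`
acts on the values at `x, x⁻¹` with determinant `1` and trace `2 + x² + x⁻² - t - t⁻¹`
(`exists_trace_eq`). In a finite group this is `ζ + ζ⁻¹` for a root of unity `ζ`, and so are all its
Galois conjugates; thus `Re x² ≤ Re t` survives every conjugation. On the chain `x⁻² = u^(κ+2i)` and
`t = u^κ`. When `gcd(κ+2i, ord u)` divides `κ`, some conjugate of `u^(κ+2i)` is at least as close to
`1` as that of `u^κ`, and the inequality, strict inside the chain, breaks (`not_finite_of_gcd`).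
Arithmetic then leaves the listed cases; the family `N ≡ 2 mod 4`, `κ = N - 4` needs one explicit
conjugate, which fails to help only for `N = 6, 10`. If the support has no blocked point, rotating a
point by powers of `u²` already contradicts the inequality.

Finite image: in dimension one the relations force roots of unity. In dimensions two and four, and
for `t = 1`, the generators permute a finite spanning set up to roots of unity. In dimension eight
the orbit of `1` consists of functions with algebraic integer values, bounded in every complex
embedding by a Hermitian form that is positive definite for all conjugates; there are finitely many
such functions.

Two-dimensional quotients in (iv) are excluded by exhibiting three independent functionals that
descend to the quotient. -/

theorem poly_ext {M : Type*} [AddCommMonoid M] [Module ℂ M] {A B : PolySpace →ₗ[ℂ] M}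
    (h : ∀ n, A (mono n) = B (mono n)) : A = B := by
  refine (AddMonoidAlgebra.basis ℤ ℂ).ext fun n => ?_
  rw [AddMonoidAlgebra.basis_apply]
  exact h n

/-- Evaluation of Laurent polynomials at the point `x ∈ ℂˣ`. -/
def ev (x : ℂˣ) : PolySpace →ₐ[ℂ] ℂ :=
  { LaurentPolynomial.eval₂ (RingHom.id ℂ) x with
    commutes' := fun r => by
      change LaurentPolynomial.eval₂ (RingHom.id ℂ) x (algebraMap ℂ _ r) = _
      rw [← LaurentPolynomial.C_eq_algebraMap, LaurentPolynomial.eval₂_C]; rfl }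

@[simp] theorem ev_mono (x : ℂˣ) (n : ℤ) : ev x (mono n) = ((x ^ n : ℂˣ) : ℂ) :=
  LaurentPolynomial.eval₂_T _ _ _

@[simp] theorem ev_C (x : ℂˣ) (a : ℂ) : ev x (LaurentPolynomial.C a) = a :=
  LaurentPolynomial.eval₂_C _ _ _

/-- The logarithmic derivative functional `f ↦ (X f')(x)`. -/
def der (x : ℂˣ) : PolySpace →ₗ[ℂ] ℂ :=
  (AddMonoidAlgebra.basis ℤ ℂ).constr ℂ fun n => (n : ℂ) * ((x ^ n : ℂˣ) : ℂ)

@[simp] theorem der_mono (x : ℂˣ) (n : ℤ) : der x (mono n) = (n : ℂ) * ((x ^ n : ℂˣ) : ℂ) := by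
  have h := (AddMonoidAlgebra.basis ℤ ℂ).constr_basis ℂ
    (fun n : ℤ => (n : ℂ) * ((x ^ n : ℂˣ) : ℂ)) n
  rwa [AddMonoidAlgebra.basis_apply] at h

theorem ev_refl (x : ℂˣ) (f : PolySpace) : ev x (refl f) = ev x⁻¹ f := by
  have : (ev x).toLinearMap ∘ₗ refl = (ev x⁻¹).toLinearMap :=
    poly_ext fun n => by simp [refl_mono]
  exact LinearMap.congr_fun this f

theorem ev_piOp (u x : ℂˣ) (f : PolySpace) : ev x (piOp u f) = ev (u / x) f := by
  have : (ev x).toLinearMap ∘ₗ piOp u = (ev (u / x)).toLinearMap :=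
    poly_ext fun n => by simp [piOp_mono, div_eq_mul_inv, mul_zpow]
  exact LinearMap.congr_fun this f

theorem ev_mulX (x : ℂˣ) (m : ℤ) (f : PolySpace) :
    ev x (mulX m f) = ((x ^ m : ℂˣ) : ℂ) * ev x f := by
  simp only [mulX, LinearMap.mulLeft_apply, map_mul, ev_mono]

/-- The source of all support arguments: the coefficient of `ev x⁻¹` vanishes exactly at `τ² x² =
1`. The factor `x² - 1` stays on the left so that `x = ±1` needs no exception here. -/
theorem ev_heckeOp_mul (τ x : ℂˣ) (f : PolySpace) :
    ((x : ℂ) ^ 2 - 1) * ev x (heckeOp τ f) =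
      ((τ : ℂ) * x ^ 2 - ((τ⁻¹ : ℂˣ) : ℂ)) * ev x⁻¹ f - ((τ : ℂ) - ((τ⁻¹ : ℂˣ) : ℂ)) * ev x f := by
  have h := congrArg (ev x) (heckeOp_spec τ f)
  simp only [map_mul, map_add, map_sub, ev_C, ev_mono, ev_refl, map_one] at h
  have e : ((x ^ (2 : ℤ) : ℂˣ) : ℂ) = (x : ℂ) ^ 2 := by norm_cast
  rw [e] at h
  rw [h]; ring

/-- At `x = ±1` the quotient `(s - 1) / (X² - 1)` is of the form `0/0` and becomes a derivative: on
`Xⁿ` it is a sum of `|n|` monomials, all with the value `xⁿ`. -/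
theorem ev_divDiff_of_sq_eq_one {x : ℂˣ} (hx : x ^ 2 = 1) (f : PolySpace) :
    ev x (divDiff f) = -der x f := by
  have : (ev x).toLinearMap ∘ₗ divDiff = -der x := by
    have key : ∀ (a : ℤ) (i : ℕ), x ^ (a + 2 * (i : ℤ)) = x ^ a := fun a i => by
      rw [zpow_add, zpow_mul]
      have : x ^ (2 : ℤ) = 1 := by exact_mod_cast hx
      rw [this]; simp
    have neg : ∀ n : ℤ, x ^ (-n) = x ^ n := fun n => by
      have : x⁻¹ = x := by rw [inv_eq_iff_mul_eq_one, ← sq, hx]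
      rw [zpow_neg, ← inv_zpow, this]
    refine poly_ext fun n => ?_
    simp only [LinearMap.comp_apply, divDiff, ofMono_mono, LinearMap.neg_apply, der_mono,
      AlgHom.toLinearMap_apply]
    split_ifs with hn
    · rw [map_neg, map_sum]
      simp only [ev_mono, key, neg, Finset.sum_const, Finset.card_range, nsmul_eq_mul]
      have : ((n.toNat : ℕ) : ℂ) = (n : ℂ) := by exact_mod_cast Int.toNat_of_nonneg hn
      rw [this]
    · rw [map_sum]
      simp only [ev_mono, key, Finset.sum_const, Finset.card_range, nsmul_eq_mul]
      have : (((-n).toNat : ℕ) : ℂ) = ((-n : ℤ) : ℂ) := by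
        exact_mod_cast Int.toNat_of_nonneg (by omega)
      rw [this]; push_cast; ring
  exact LinearMap.congr_fun this f

theorem ev_heckeOp_of_sq_eq_one {x : ℂˣ} (hx : x ^ 2 = 1) (τ : ℂˣ) (f : PolySpace) :
    ev x (heckeOp τ f) = (τ : ℂ) * ev x f - ((τ : ℂ) - ((τ⁻¹ : ℂˣ) : ℂ)) * der x f := by
  have hi : x⁻¹ = x := by rw [inv_eq_iff_mul_eq_one, ← sq, hx]
  simp only [heckeOp, LinearMap.add_apply, LinearMap.smul_apply, map_add, map_smul, ev_refl,
    ev_divDiff_of_sq_eq_one hx, smul_eq_mul, hi]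
  ring

/-- Interpolation: arbitrary values at finitely many points. -/
theorem exists_ev_eq (s : Finset ℂˣ) (r : ℂˣ → ℂ) : ∃ f : PolySpace, ∀ x ∈ s, ev x f = r x := by
  classical
  refine ⟨Polynomial.toLaurent (Lagrange.interpolate s (fun x : ℂˣ => (x : ℂ)) r), fun x hx => ?_⟩
  have h := Lagrange.eval_interpolate_at_node (s := s) (v := fun x : ℂˣ => (x : ℂ)) r
    (Units.val_injective.injOn) hx
  rw [← h]
  change LaurentPolynomial.eval₂ (RingHom.id ℂ) x _ = _
  rw [LaurentPolynomial.eval₂_toLaurent]; rfl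

variable {u τ : ℂˣ} {V : Type*} [AddCommGroup V] [Module ℂ V]

/-! ### Quotient maps from the polynomial representation -/

namespace Rep

/-- `φ` is a surjection of modules from the polynomial representation onto `V`. -/
structure IsQuotMap (ρ : Rep u τ V) (φ : PolySpace →ₗ[ℂ] V) : Prop where
  surj : Function.Surjective φ
  mapX : ∀ p, φ (mulX 1 p) = (ρ.X : Module.End ℂ V) (φ p)
  mapY : ∀ p, φ (piOp u (heckeOp τ p)) = (ρ.Y : Module.End ℂ V) (φ p)
  mapT : ∀ p, φ (heckeOp τ p) = (ρ.T : Module.End ℂ V) (φ p)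

theorem isQuotient_iff (ρ : Rep u τ V) (f : PolySpace) :
    ρ.IsQuotient f ↔ ∃ φ, ρ.IsQuotMap φ ∧ φ f = 0 :=
  ⟨fun ⟨φ, h1, h2, h3, h4, h5⟩ => ⟨φ, ⟨h1, h2, h3, h4⟩, h5⟩,
    fun ⟨φ, ⟨h1, h2, h3, h4⟩, h5⟩ => ⟨φ, h1, h2, h3, h4, h5⟩⟩

theorem units_inv_apply_eq (A : (Module.End ℂ V)ˣ) {v w : V} (h : (A : Module.End ℂ V) v = w) :
    ((A⁻¹ : (Module.End ℂ V)ˣ) : Module.End ℂ V) w = v := by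
  rw [← h, ← Module.End.mul_apply, Units.inv_mul, Module.End.one_apply]

theorem units_apply_inv_apply (A : (Module.End ℂ V)ˣ) (v : V) :
    (A : Module.End ℂ V) (((A⁻¹ : (Module.End ℂ V)ˣ) : Module.End ℂ V) v) = v := by
  rw [← Module.End.mul_apply, Units.mul_inv, Module.End.one_apply]

namespace IsQuotMap
variable {ρ : Rep u τ V} {φ : PolySpace →ₗ[ℂ] V}

theorem map_mulX_neg (h : ρ.IsQuotMap φ) (p : PolySpace) :
    φ (mulX (-1) p) = ((ρ.X⁻¹ : (Module.End ℂ V)ˣ) : Module.End ℂ V) (φ p) := by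
  refine (units_inv_apply_eq _ ?_).symm
  rw [← h.mapX, ← Module.End.mul_apply]
  congr 1
  exact LinearMap.congr_fun unitX.val_inv p

theorem map_T_inv (h : ρ.IsQuotMap φ) (p : PolySpace) :
    φ ((heckeOp τ - algebraMap ℂ _ ((τ : ℂ) - ((τ⁻¹ : ℂˣ) : ℂ))) p) =
      ((ρ.T⁻¹ : (Module.End ℂ V)ˣ) : Module.End ℂ V) (φ p) := by
  refine (units_inv_apply_eq _ ?_).symm
  rw [← h.mapT, ← Module.End.mul_apply, heckeOp_inv_right]; rfl

theorem map_pi (h : ρ.IsQuotMap φ) (p : PolySpace) :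
    φ (piOp u p) = (ρ.Y : Module.End ℂ V)
      (((ρ.T⁻¹ : (Module.End ℂ V)ˣ) : Module.End ℂ V) (φ p)) := by
  rw [← h.map_T_inv, ← h.mapY, ← Module.End.mul_apply (heckeOp τ), heckeOp_inv_right]; rfl

theorem ker_T (h : ρ.IsQuotMap φ) {p : PolySpace} (hp : φ p = 0) : φ (heckeOp τ p) = 0 := by
  rw [h.mapT, hp, map_zero]

theorem ker_pi (h : ρ.IsQuotMap φ) {p : PolySpace} (hp : φ p = 0) : φ (piOp u p) = 0 := by
  rw [h.map_pi, hp, map_zero, map_zero]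

theorem map_Y_inv (h : ρ.IsQuotMap φ) (p : PolySpace) :
    φ ((heckeOp τ - algebraMap ℂ _ ((τ : ℂ) - ((τ⁻¹ : ℂˣ) : ℂ))) (piOp u p)) =
      ((ρ.Y⁻¹ : (Module.End ℂ V)ˣ) : Module.End ℂ V) (φ p) := by
  refine (units_inv_apply_eq _ ?_).symm
  rw [← h.mapY, ← Module.End.mul_apply (heckeOp τ), heckeOp_inv_right, Module.End.one_apply,
    ← Module.End.mul_apply, piOp_sq]; rfl

end IsQuotMap

/-! ### The support of a quotient -/

/-- The set of points `x` for which evaluation at `x` descends to the quotient. -/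
def supp (φ : PolySpace →ₗ[ℂ] V) : Set ℂˣ := {x | ∀ f, φ f = 0 → ev x f = 0}

namespace IsQuotMap
variable {ρ : Rep u τ V} {φ : PolySpace →ₗ[ℂ] V}

theorem supp_pi (h : ρ.IsQuotMap φ) {x : ℂˣ} (hx : x ∈ supp φ) : u / x ∈ supp φ := fun f hf => by
  rw [← ev_piOp]; exact hx _ (h.ker_pi hf)

theorem supp_inv (h : ρ.IsQuotMap φ) {x : ℂˣ} (hx : x ∈ supp φ) (hne : τ ^ 2 * x ^ 2 ≠ 1) :
    x⁻¹ ∈ supp φ := fun f hf => by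
  have h1 := ev_heckeOp_mul τ x f
  rw [hx _ (h.ker_T hf), hx _ hf, mul_zero, mul_zero, sub_zero, eq_comm, mul_eq_zero] at h1
  refine h1.resolve_left fun h2 => hne (Units.ext ?_)
  have : (τ : ℂ) * ((τ⁻¹ : ℂˣ) : ℂ) = 1 := by simp
  push_cast
  linear_combination (τ : ℂ) * h2 + this

/-- Applying `T` to the kernel at `x = ±1` leaves only the derivative term, with coefficient `τ -
τ⁻¹ ≠ 0`. Then `X` has a Jordan block at `x`. -/
theorem der_eq_zero (h : ρ.IsQuotMap φ) {x : ℂˣ} (hx : x ∈ supp φ) (h1 : x ^ 2 = 1)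
    (ht : τ ^ 2 ≠ 1) {f : PolySpace} (hf : φ f = 0) : der x f = 0 := by
  have e := ev_heckeOp_of_sq_eq_one h1 τ f
  rw [hx _ (h.ker_T hf), hx _ hf, mul_zero, zero_sub, eq_comm, neg_eq_zero, mul_eq_zero] at e
  refine e.resolve_left fun h2 => ht (Units.ext ?_)
  have : (τ : ℂ) * ((τ⁻¹ : ℂˣ) : ℂ) = 1 := by simp
  push_cast
  linear_combination (τ : ℂ) * h2 + this

/-- An eigenvector `l` of the transpose of `X` with eigenvalue `c` satisfies `l (φ Xⁿ) = cⁿ l (φ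
1)`, so `l ∘ φ` is a nonzero multiple of evaluation at `c`. -/
theorem supp_nonempty [FiniteDimensional ℂ V] [Nontrivial V] (h : ρ.IsQuotMap φ) :
    (supp φ).Nonempty := by
  obtain ⟨c, hc⟩ := Module.End.exists_eigenvalue
    (Module.Dual.transpose (R := ℂ) (ρ.X : Module.End ℂ V))
  obtain ⟨l, hl, hl0⟩ := hc.exists_hasEigenvector
  rw [Module.End.mem_eigenspace_iff] at hl
  have hX : ∀ v, l ((ρ.X : Module.End ℂ V) v) = c * l v := fun v => LinearMap.congr_fun hl v
  have hc0 : c ≠ 0 := by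
    rintro rfl
    refine hl0 (LinearMap.ext fun v => ?_)
    have := hX (((ρ.X⁻¹ : (Module.End ℂ V)ˣ) : Module.End ℂ V) v)
    rw [units_apply_inv_apply, zero_mul] at this
    exact this
  have step : ∀ n : ℤ, l (φ (mono (n + 1))) = c * l (φ (mono n)) := fun n => by
    rw [← hX, ← h.mapX, mulX, LinearMap.mulLeft_apply, mono_mul, add_comm]
  have hn : ∀ n : ℤ, l (φ (mono n)) = ((Units.mk0 c hc0 ^ n : ℂˣ) : ℂ) * l (φ 1) := fun n => by
    induction n using Int.induction_on with
    | zero => simp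
    | succ i ih => rw [step, ih, zpow_add_one]; push_cast; simp; ring
    | pred i ih =>
      have := step (-(i : ℤ) - 1)
      rw [sub_add_cancel, ih] at this
      rw [zpow_sub_one, Units.val_mul, Units.val_inv_eq_inv_val, Units.val_mk0, mul_right_comm,
        this, mul_comm c, mul_assoc, mul_inv_cancel₀ hc0, mul_one]
  have key : ∀ f, l (φ f) = l (φ 1) * ev (Units.mk0 c hc0) f := fun f => by
    have : l ∘ₗ φ = l (φ 1) • (ev (Units.mk0 c hc0)).toLinearMap :=
      poly_ext fun n => by simp [hn, mul_comm]
    exact LinearMap.congr_fun this f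
  have h1 : l (φ 1) ≠ 0 := fun h0 => hl0 (LinearMap.ext fun v => by
    obtain ⟨f, rfl⟩ := h.surj v
    rw [key, h0, zero_mul]; rfl)
  refine ⟨Units.mk0 c hc0, fun f hf => ?_⟩
  have := key f
  rw [hf, map_zero, eq_comm, mul_eq_zero] at this
  exact this.resolve_left h1

end IsQuotMap

end Rep
end DAHA

namespace DAHA
variable {u τ : ℂˣ} {V : Type*} [AddCommGroup V] [Module ℂ V]
namespace Rep

/-! ### Irreducibility and invariance -/

theorem mapsTo_of_mem_imageB {ρ : Rep u τ V} {F : Set V}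
    (hF : ∀ g ∈ ({ρ.X, ρ.Y, ρ.T, scalar V u} : Set (Module.End ℂ V)ˣ),
      ∀ v ∈ F, (g : Module.End ℂ V) v ∈ F)
    (hF' : ∀ g ∈ ({ρ.X, ρ.Y, ρ.T, scalar V u} : Set (Module.End ℂ V)ˣ),
      ∀ v ∈ F, ((g⁻¹ : (Module.End ℂ V)ˣ) : Module.End ℂ V) v ∈ F) :
    ∀ g ∈ ρ.imageB, ∀ v ∈ F, (g : Module.End ℂ V) v ∈ F := by
  intro g hg
  have : (∀ v ∈ F, (g : Module.End ℂ V) v ∈ F) ∧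
      ∀ v ∈ F, ((g⁻¹ : (Module.End ℂ V)ˣ) : Module.End ℂ V) v ∈ F := by
    induction hg using Subgroup.closure_induction with
    | mem x hx => exact ⟨hF x hx, hF' x hx⟩
    | one => simp
    | mul x y _ _ hx hy =>
      refine ⟨fun v hv => hx.1 _ (hy.1 v hv), fun v hv => ?_⟩
      rw [mul_inv_rev]; exact hy.2 _ (hx.2 v hv)
    | inv x _ hx => rw [inv_inv]; exact ⟨hx.2, hx.1⟩
  exact this.1

theorem scalar_apply (c : ℂˣ) (v : V) : (scalar V c : Module.End ℂ V) v = (c : ℂ) • v := rfl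

theorem scalar_inv_apply (c : ℂˣ) (v : V) :
    (((scalar V c)⁻¹ : (Module.End ℂ V)ˣ) : Module.End ℂ V) v = ((c⁻¹ : ℂˣ) : ℂ) • v := by
  have : (scalar V c)⁻¹ = scalar V c⁻¹ := (map_inv _ _).symm
  rw [this]; rfl

theorem IsIrreducible.eq_bot_or_eq_top {ρ : Rep u τ V} (h : ρ.IsIrreducible) (W : Submodule ℂ V)
    (hX : ∀ w ∈ W, (ρ.X : Module.End ℂ V) w ∈ W)
    (hX' : ∀ w ∈ W, ((ρ.X⁻¹ : (Module.End ℂ V)ˣ) : Module.End ℂ V) w ∈ W)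
    (hY : ∀ w ∈ W, (ρ.Y : Module.End ℂ V) w ∈ W)
    (hY' : ∀ w ∈ W, ((ρ.Y⁻¹ : (Module.End ℂ V)ˣ) : Module.End ℂ V) w ∈ W)
    (hT : ∀ w ∈ W, (ρ.T : Module.End ℂ V) w ∈ W)
    (hT' : ∀ w ∈ W, ((ρ.T⁻¹ : (Module.End ℂ V)ˣ) : Module.End ℂ V) w ∈ W) : W = ⊥ ∨ W = ⊤ := by
  refine h.2 W (mapsTo_of_mem_imageB ?_ ?_)
  · rintro g (rfl | rfl | rfl | rfl)
    exacts [hX, hY, hT, fun w hw => W.smul_mem _ hw]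
  · rintro g (rfl | rfl | rfl | rfl)
    exacts [hX', hY', hT', fun w hw => by rw [scalar_inv_apply]; exact W.smul_mem _ hw]

/-- A group that preserves a finite spanning set is finite; in an irreducible module every
nonzero invariant set spans. -/
theorem finite_imageB_of_mapsTo {ρ : Rep u τ V} (h : ρ.IsIrreducible) {F : Set V} (hF : F.Finite)
    {v₀ : V} (hv₀ : v₀ ∈ F) (hne : v₀ ≠ 0)
    (hX : ∀ v ∈ F, (ρ.X : Module.End ℂ V) v ∈ F) (hY : ∀ v ∈ F, (ρ.Y : Module.End ℂ V) v ∈ F)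
    (hT : ∀ v ∈ F, (ρ.T : Module.End ℂ V) v ∈ F) (hu : ∀ v ∈ F, (u : ℂ) • v ∈ F) :
    Finite ρ.imageB := by
  have hgen : ∀ g ∈ ({ρ.X, ρ.Y, ρ.T, scalar V u} : Set (Module.End ℂ V)ˣ),
      ∀ v ∈ F, (g : Module.End ℂ V) v ∈ F := by
    rintro g (rfl | rfl | rfl | rfl)
    exacts [hX, hY, hT, hu]
  have hinv : ∀ g : (Module.End ℂ V)ˣ, (∀ v ∈ F, (g : Module.End ℂ V) v ∈ F) →
      ∀ v ∈ F, ((g⁻¹ : (Module.End ℂ V)ˣ) : Module.End ℂ V) v ∈ F := by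
    intro g hg v hv
    have : Finite F := hF
    let m : F → F := fun x => ⟨(g : Module.End ℂ V) x, hg x x.2⟩
    have hm : Function.Injective m := fun x y hxy => by
      have : (g : Module.End ℂ V) x = (g : Module.End ℂ V) y := congrArg Subtype.val hxy
      apply Subtype.ext
      have e := congrArg ((g⁻¹ : (Module.End ℂ V)ˣ) : Module.End ℂ V) this
      rwa [units_inv_apply_eq g rfl, units_inv_apply_eq g rfl] at e
    obtain ⟨w, hw⟩ := (Finite.injective_iff_surjective.mp hm) ⟨v, hv⟩
    rw [units_inv_apply_eq g (congrArg Subtype.val hw)]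
    exact w.2
  have hall := mapsTo_of_mem_imageB hgen fun g hg => hinv g (hgen g hg)
  have hspan : Submodule.span ℂ F = ⊤ := by
    refine (h.2 (Submodule.span ℂ F) fun g hg w hw => ?_).resolve_left fun hb => hne ?_
    · induction hw using Submodule.span_induction with
      | mem x hx => exact Submodule.subset_span (hall g hg x hx)
      | zero => simp
      | add x y _ _ hx hy => rw [map_add]; exact add_mem hx hy
      | smul c x _ hx => rw [map_smul]; exact Submodule.smul_mem _ _ hx
    · rw [← Submodule.mem_bot (R := ℂ), ← hb]; exact Submodule.subset_span hv₀
  have : Finite F := hF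
  refine Finite.of_injective (β := F → F)
    (fun g x => ⟨((g : (Module.End ℂ V)ˣ) : Module.End ℂ V) x, hall g g.2 x x.2⟩) ?_
  intro g g' hgg
  refine Subtype.ext (Units.ext (LinearMap.ext_on hspan fun x hx => ?_))
  exact congrArg Subtype.val (congrFun hgg ⟨x, hx⟩)

/-! ### Twists -/

theorem neg_apply' (A : (Module.End ℂ V)ˣ) (v : V) :
    ((-A : (Module.End ℂ V)ˣ) : Module.End ℂ V) v = -((A : Module.End ℂ V) v) := rfl

/-- The union of a group `H` of operators with `-H` is again a group and is at most twice as large,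
so sign changes of generators, in particular the twists, do not affect finiteness. -/
theorem finite_closure_of_neg {s s' : Set (Module.End ℂ V)ˣ}
    (h : ∀ g ∈ s', g ∈ s ∨ -g ∈ s) (hfin : Finite (Subgroup.closure s)) :
    Finite (Subgroup.closure s') := by
  let H : Subgroup (Module.End ℂ V)ˣ :=
    { carrier := {g | g ∈ Subgroup.closure s ∨ -g ∈ Subgroup.closure s}
      mul_mem' := by
        rintro a b (ha | ha) (hb | hb)
        · exact Or.inl (mul_mem ha hb)
        · refine Or.inr ?_; rw [← mul_neg]; exact mul_mem ha hb
        · refine Or.inr ?_; rw [← neg_mul]; exact mul_mem ha hb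
        · refine Or.inl ?_; rw [← neg_mul_neg]; exact mul_mem ha hb
      one_mem' := Or.inl (one_mem _)
      inv_mem' := by
        rintro a (ha | ha)
        · exact Or.inl (inv_mem ha)
        · refine Or.inr ?_; rw [← inv_neg]; exact inv_mem ha }
  have hle : Subgroup.closure s' ≤ H := by
    rw [Subgroup.closure_le]
    intro g hg
    exact (h g hg).imp (fun h => Subgroup.subset_closure h) fun h => Subgroup.subset_closure h
  have hf : (Subgroup.closure s : Set (Module.End ℂ V)ˣ).Finite := hfin
  have : (H : Set (Module.End ℂ V)ˣ).Finite := by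
    refine (hf.union (hf.image fun g => -g)).subset ?_
    rintro g (hg | hg)
    · exact Or.inl hg
    · exact Or.inr ⟨-g, hg, neg_neg g⟩
  exact this.subset hle

theorem finite_twistX {ρ : Rep u τ V} : Finite ρ.twistX.imageB ↔ Finite ρ.imageB := by
  constructor <;> refine finite_closure_of_neg ?_ <;> rintro g (rfl | rfl | rfl | rfl) <;>
    simp [twistX]

theorem finite_twistY {ρ : Rep u τ V} : Finite ρ.twistY.imageB ↔ Finite ρ.imageB := by
  constructor <;> refine finite_closure_of_neg ?_ <;> rintro g (rfl | rfl | rfl | rfl) <;>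
    simp [twistY]

theorem isIrreducible_of_neg {u' τ' : ℂˣ} {ρ : Rep u τ V} {ρ' : Rep u' τ' V}
    (h : ∀ g ∈ ({ρ.X, ρ.Y, ρ.T, scalar V u} : Set (Module.End ℂ V)ˣ),
      g ∈ ρ'.imageB ∨ -g ∈ ρ'.imageB)
    (hirr : ρ.IsIrreducible) : ρ'.IsIrreducible := by
  refine ⟨hirr.1, fun W hW => hirr.2 W (mapsTo_of_mem_imageB (fun g hg w hw => ?_)
    fun g hg w hw => ?_)⟩
  · rcases h g hg with h | h
    · exact hW _ h w hw
    · have := W.neg_mem (hW _ h w hw)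
      rwa [neg_apply', neg_neg] at this
  · rcases h g hg with h | h
    · exact hW _ (inv_mem h) w hw
    · have := W.neg_mem (hW _ (inv_mem h) w hw)
      rwa [inv_neg, neg_apply', neg_neg] at this

theorem IsIrreducible.twistX {ρ : Rep u τ V} (h : ρ.IsIrreducible) : ρ.twistX.IsIrreducible := by
  refine isIrreducible_of_neg ?_ h
  rintro g (rfl | rfl | rfl | rfl)
  · exact Or.inr (Subgroup.subset_closure (by simp [Rep.twistX]))
  all_goals exact Or.inl (Subgroup.subset_closure (by simp [Rep.twistX]))

theorem IsIrreducible.twistY {ρ : Rep u τ V} (h : ρ.IsIrreducible) : ρ.twistY.IsIrreducible := by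
  refine isIrreducible_of_neg ?_ h
  rintro g (rfl | rfl | rfl | rfl)
  · exact Or.inl (Subgroup.subset_closure (by simp [Rep.twistY]))
  · exact Or.inr (Subgroup.subset_closure (by simp [Rep.twistY]))
  all_goals exact Or.inl (Subgroup.subset_closure (by simp [Rep.twistY]))

/-- Up to a twist, an irreducible quotient in the wide sense is one in the strict sense. -/
theorem IsIrredQuotient.exists_isQuotMap {ρ : Rep u τ V} {f : PolySpace}
    (h : ρ.IsIrredQuotient f) : ∃ (ρ' : Rep u τ V) (φ : PolySpace →ₗ[ℂ] V), ρ'.IsIrreducible ∧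
      ρ'.IsQuotMap φ ∧ φ f = 0 ∧ (Finite ρ'.imageB ↔ Finite ρ.imageB) := by
  obtain ⟨hirr, h | h | h | h⟩ := h <;> rw [isQuotient_iff] at h <;> obtain ⟨φ, hφ, hf⟩ := h
  · exact ⟨_, φ, hirr, hφ, hf, Iff.rfl⟩
  · exact ⟨_, φ, hirr.twistX, hφ, hf, finite_twistX⟩
  · exact ⟨_, φ, hirr.twistY, hφ, hf, finite_twistY⟩
  · exact ⟨_, φ, hirr.twistX.twistY, hφ, hf, finite_twistY.trans finite_twistX⟩

/-! ### Closed supports -/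

/-- A set of points stable under `x ↦ u / x` and, where `T` does not degenerate, `x ↦ x⁻¹`. -/
def IsClosedSet (u τ : ℂˣ) (S : Set ℂˣ) : Prop :=
  ∀ x ∈ S, u / x ∈ S ∧ x ^ 2 ≠ 1 ∧ (τ ^ 2 * x ^ 2 = 1 ∨ x⁻¹ ∈ S)

/-- Laurent polynomials vanishing on `S`. -/
def vanishing (S : Set ℂˣ) : Submodule ℂ PolySpace where
  carrier := {f | ∀ x ∈ S, ev x f = 0}
  add_mem' ha hb x hx := by rw [map_add, ha x hx, hb x hx, add_zero]
  zero_mem' x _ := map_zero _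
  smul_mem' c f hf x hx := by rw [map_smul, hf x hx, smul_zero]

/-- For `f` vanishing at `x`, the value of `T f` at `x` involves only `f (x⁻¹)`. Either `x⁻¹ ∈ S` or
its coefficient is zero. -/
theorem IsClosedSet.heckeOp_mem {S : Set ℂˣ} (hS : IsClosedSet u τ S) {f : PolySpace}
    (hf : f ∈ vanishing S) : heckeOp τ f ∈ vanishing S := fun x hx => by
  have h := ev_heckeOp_mul τ x f
  obtain ⟨-, h1, h2⟩ := hS x hx
  have hx1 : (x : ℂ) ^ 2 - 1 ≠ 0 := fun e => h1 (Units.ext (by push_cast; linear_combination e))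
  rw [hf x hx, mul_zero, sub_zero] at h
  refine (mul_eq_zero.mp (h.trans ?_)).resolve_left hx1
  rcases h2 with h2 | h2
  · have e : (τ : ℂ) ^ 2 * (x : ℂ) ^ 2 = 1 := by
      have := congrArg Units.val h2
      push_cast at this
      exact this
    have e2 : (τ : ℂ) * ((τ⁻¹ : ℂˣ) : ℂ) = 1 := by simp
    refine mul_eq_zero_of_left ?_ _
    linear_combination ((τ⁻¹ : ℂˣ) : ℂ) * e - (τ : ℂ) * x ^ 2 * e2
  · rw [hf _ h2, mul_zero]

theorem IsClosedSet.piOp_mem {S : Set ℂˣ} (hS : IsClosedSet u τ S) {f : PolySpace}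
    (hf : f ∈ vanishing S) : piOp u f ∈ vanishing S := fun x hx => by
  rw [ev_piOp]; exact hf _ (hS x hx).1

theorem mulX_mem_vanishing {S : Set ℂˣ} {f : PolySpace} (m : ℤ) (hf : f ∈ vanishing S) :
    mulX m f ∈ vanishing S := fun x hx => by rw [ev_mulX, hf x hx, mul_zero]

variable {ρ : Rep u τ V} {φ : PolySpace →ₗ[ℂ] V}

/-- Stability under `X^{±1}`, `π`, `T` is enough: `Y = π T`, `π² = 1`, and `T⁻¹` is `T` minus a
scalar. -/
theorem IsQuotMap.map_eq_bot_or_eq_top (h : ρ.IsQuotMap φ) (hirr : ρ.IsIrreducible)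
    (K : Submodule ℂ PolySpace) (hX : ∀ p ∈ K, mulX 1 p ∈ K) (hX' : ∀ p ∈ K, mulX (-1) p ∈ K)
    (hπ : ∀ p ∈ K, piOp u p ∈ K) (hT : ∀ p ∈ K, heckeOp τ p ∈ K) :
    K.map φ = ⊥ ∨ K.map φ = ⊤ := by
  have hT' : ∀ p ∈ K, ∀ c : ℂ, (heckeOp τ - algebraMap ℂ _ c) p ∈ K := fun p hp c => by
    rw [LinearMap.sub_apply, Module.algebraMap_end_apply]
    exact sub_mem (hT p hp) (K.smul_mem _ hp)
  apply hirr.eq_bot_or_eq_top <;> rintro _ ⟨g, hg, rfl⟩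
  · exact ⟨_, hX g hg, h.mapX g⟩
  · exact ⟨_, hX' g hg, h.map_mulX_neg g⟩
  · exact ⟨_, hπ _ (hT g hg), h.mapY g⟩
  · exact ⟨_, hT' _ (hπ g hg) _, h.map_Y_inv g⟩
  · exact ⟨_, hT g hg, h.mapT g⟩
  · exact ⟨_, hT' g hg _, h.map_T_inv g⟩

/-- The ideal of a closed set `S` is a submodule, so its image in `V` is `0` or `V`. It is not `V`:
otherwise `1` would agree modulo the kernel with a function vanishing at a point of `S`, where
evaluation is defined on `V`. -/
theorem IsQuotMap.map_eq_zero_iff (h : ρ.IsQuotMap φ) (hirr : ρ.IsIrreducible) {S : Set ℂˣ}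
    (hS : IsClosedSet u τ S) (hne : S.Nonempty) (hsub : S ⊆ supp φ) (f : PolySpace) :
    φ f = 0 ↔ ∀ x ∈ S, ev x f = 0 := by
  refine ⟨fun hf x hx => hsub hx f hf, fun hf => ?_⟩
  have hW := h.map_eq_bot_or_eq_top hirr (vanishing S) (fun _ => mulX_mem_vanishing 1)
    (fun _ => mulX_mem_vanishing (-1)) (fun _ => hS.piOp_mem) fun _ => hS.heckeOp_mem
  rcases hW with hW | hW
  · rw [← Submodule.mem_bot (R := ℂ), ← hW]
    exact Submodule.mem_map_of_mem hf
  · exfalso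
    obtain ⟨g, hg, hg1⟩ : φ 1 ∈ (vanishing S).map φ := hW ▸ Submodule.mem_top
    obtain ⟨x, hx⟩ := hne
    have h0 := hsub hx (1 - g) (by rw [map_sub, hg1, sub_self])
    rw [map_sub, hg x hx, map_one, sub_zero] at h0
    exact one_ne_zero h0

theorem finrank_eq_card (hφ : Function.Surjective φ) (S : Finset ℂˣ)
    (hS : ∀ f, φ f = 0 ↔ ∀ x ∈ S, ev x f = 0) : Module.finrank ℂ V = S.card := by
  let E : PolySpace →ₗ[ℂ] (S → ℂ) := LinearMap.pi fun x => (ev x.1).toLinearMap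
  have hE : Function.Surjective E := fun r => by
    classical
    obtain ⟨f, hf⟩ := exists_ev_eq S fun x => if hx : x ∈ S then r ⟨x, hx⟩ else 0
    refine ⟨f, funext fun x => ?_⟩
    have := hf x.1 x.2
    rw [dif_pos x.2] at this
    exact this
  have hker : LinearMap.ker E = LinearMap.ker φ := by
    ext f
    rw [LinearMap.mem_ker, LinearMap.mem_ker, hS]
    constructor
    · intro h x hx; exact congrFun h ⟨x, hx⟩
    · intro h; exact funext fun x => h x.1 x.2
  have e1 := (LinearMap.quotKerEquivOfSurjective E hE)
  have e2 := (LinearMap.quotKerEquivOfSurjective φ hφ)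
  have e := e2.symm.trans ((Submodule.quotEquivOfEq _ _ hker.symm).trans e1)
  rw [e.finrank_eq]; simp

theorem IsQuotMap.map_mul_eq_zero (h : ρ.IsQuotMap φ) {f : PolySpace} (hf : φ f = 0)
    (g : PolySpace) : φ (g * f) = 0 := by
  have hm : ∀ n : ℤ, φ (mono n * f) = 0 := fun n => by
    have e : ∀ (n : ℤ) (p : PolySpace), mono (n + 1) * p = mulX 1 (mono n * p) := fun n p => by
      rw [mulX, LinearMap.mulLeft_apply, ← mul_assoc, mono_mul, add_comm]
    have e' : ∀ (n : ℤ) (p : PolySpace), mono (n - 1) * p = mulX (-1) (mono n * p) := fun n p => by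
      rw [mulX, LinearMap.mulLeft_apply, ← mul_assoc, mono_mul, add_comm, sub_eq_add_neg]
    induction n using Int.induction_on with
    | zero => simpa using hf
    | succ i ih => rw [e, h.mapX, ih, map_zero]
    | pred i ih => rw [e', h.map_mulX_neg, ih, map_zero]
  have : φ ∘ₗ LinearMap.mulRight ℂ f = 0 := poly_ext fun n => by simpa using hm n
  exact LinearMap.congr_fun this g

/-- The relation `X^{n+m} = c Xⁿ - X^{n-m}` in `V` shifts any window of `2m` consecutive exponents
by one in either direction without leaving the span. -/
theorem IsQuotMap.finiteDimensional (h : ρ.IsQuotMap φ) {m : ℕ} (hm : 0 < m) {c : ℂ}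
    (hf : φ (symPoly m c) = 0) : FiniteDimensional ℂ V := by
  have rel : ∀ n : ℤ, φ (mono (n + m)) + φ (mono (n - m)) = c • φ (mono n) := fun n => by
    have := h.map_mul_eq_zero hf (mono n)
    rw [symPoly, mul_sub, mul_add, mono_mul, mono_mul, mul_comm (mono n), ← smul_eq, map_sub,
      map_add, map_smul, sub_eq_zero] at this
    exact this
  let W := Submodule.span ℂ ((fun n : ℤ => φ (mono n)) '' Set.Ico 0 (2 * m))
  have hW : ∀ a n : ℤ, a ≤ n → n < a + 2 * m → φ (mono n) ∈ W := by
    intro a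
    induction a using Int.induction_on with
    | zero => exact fun n h1 h2 => Submodule.subset_span ⟨n, ⟨h1, by omega⟩, rfl⟩
    | succ i ih =>
      intro n h1 h2
      by_cases hn : n < i + 2 * m
      · exact ih n (by omega) hn
      · have := rel (n - m)
        rw [sub_add_cancel] at this
        rw [eq_sub_of_add_eq this]
        exact sub_mem (W.smul_mem _ (ih _ (by omega) (by omega))) (ih _ (by omega) (by omega))
    | pred i ih =>
      intro n h1 h2
      by_cases hn : -(i : ℤ) ≤ n
      · exact ih n hn (by omega)
      · have := rel (n + m)
        rw [add_sub_cancel_right] at this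
        rw [eq_sub_of_add_eq' this]
        exact sub_mem (W.smul_mem _ (ih _ (by omega) (by omega))) (ih _ (by omega) (by omega))
  have htop : W = ⊤ := by
    rw [eq_top_iff]
    rintro v -
    obtain ⟨f, rfl⟩ := h.surj v
    have hb := (AddMonoidAlgebra.basis ℤ ℂ).mem_span f
    have : Submodule.span ℂ (Set.range (AddMonoidAlgebra.basis ℤ ℂ)) ≤ W.comap φ := by
      rw [Submodule.span_le]
      rintro _ ⟨n, rfl⟩
      rw [AddMonoidAlgebra.basis_apply]
      exact hW n n le_rfl (by omega)
    exact this hb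
  refine ⟨⟨((Set.finite_Ico (0 : ℤ) (2 * m)).image fun n : ℤ => φ (mono n)).toFinset, ?_⟩⟩
  rw [Set.Finite.coe_toFinset]
  exact htop

/-! ### One-dimensional modules -/

/-- If `X, Y, T` are the scalars `a, b, c`, the relations read `a² c² = 1`, `b² = c²`, `c² u = 1`.
So all three are roots of unity of order dividing `2M`. -/
theorem finite_imageB_of_finrank_eq_one (hirr : ρ.IsIrreducible) {M : ℕ} (hM : 0 < M)
    (hu : u ^ M = 1) (h1 : Module.finrank ℂ V = 1) : Finite ρ.imageB := by
  obtain ⟨v, hv, hsp⟩ := finrank_eq_one_iff'.mp h1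
  obtain ⟨a, ha⟩ := hsp ((ρ.X : Module.End ℂ V) v)
  obtain ⟨b, hb⟩ := hsp ((ρ.Y : Module.End ℂ V) v)
  obtain ⟨c, hc⟩ := hsp ((ρ.T : Module.End ℂ V) v)
  have inj : ∀ r s : ℂ, r • v = s • v → r = s := fun r s h => smul_left_injective ℂ hv h
  have r1 : c * a * c * a = 1 := by
    have : ρ.T * ρ.X * ρ.T * ρ.X = 1 := by rw [ρ.rel_TX]; group
    have := congrArg (fun g : (Module.End ℂ V)ˣ => (g : Module.End ℂ V) v) this
    simp only [Units.val_mul, Module.End.mul_apply, Units.val_one, Module.End.one_apply,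
      ← ha, ← hc, map_smul, smul_smul] at this
    apply inj; rw [one_smul, ← this]; congr 1; ring
  have r2 : b * b = c * c := by
    have : ρ.Y * ρ.T⁻¹ * ρ.Y = ρ.T := by
      have := ρ.rel_TY
      calc _ = ρ.T * (ρ.T⁻¹ * ρ.Y * ρ.T⁻¹) * ρ.Y := by group
        _ = _ := by rw [this]; group
    have ti : ((ρ.T⁻¹ : (Module.End ℂ V)ˣ) : Module.End ℂ V) v = c⁻¹ • v := by
      apply units_inv_apply_eq
      rw [map_smul, ← hc, smul_smul, inv_mul_cancel₀, one_smul]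
      rintro rfl; simp at r1
    have := congrArg (fun g : (Module.End ℂ V)ˣ => (g : Module.End ℂ V) v) this
    simp only [Units.val_mul, Module.End.mul_apply, ← hb, ← hc, map_smul, smul_smul, ti] at this
    have := inj _ _ this
    have c0 : c ≠ 0 := by rintro rfl; simp at r1
    field_simp at this
    linear_combination this
  have a0 : a ≠ 0 := by rintro rfl; simp at r1
  have c0 : c ≠ 0 := by rintro rfl; simp at r1
  have b0 : b ≠ 0 := by rintro rfl; simp [c0] at r2
  have r3 : c * c * (u : ℂ) = 1 := by
    have : ρ.Y * ρ.X * ρ.T ^ 2 * scalar V u = ρ.X * ρ.Y := by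
      calc _ = ρ.X * ρ.Y * (ρ.Y⁻¹ * ρ.X⁻¹ * ρ.Y * ρ.X * ρ.T ^ 2 * scalar V u) := by group
        _ = _ := by rw [ρ.rel_XY, mul_one]
    have := congrArg (fun g : (Module.End ℂ V)ˣ => (g : Module.End ℂ V) v) this
    simp only [Units.val_mul, pow_two, Module.End.mul_apply, ← ha, ← hb, ← hc, map_smul, smul_smul,
      scalar_apply] at this
    have := inj _ _ this
    refine mul_left_cancel₀ (mul_ne_zero a0 b0) ?_
    linear_combination this
  have uM : (u : ℂ) ^ M = 1 := by
    rw [← Units.val_pow_eq_pow_val, hu, Units.val_one]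
  have c2 : (c * c) ^ M = 1 := by
    have := congrArg (· ^ M) r3
    simpa [mul_pow, uM] using this
  have b2 : (b * b) ^ M = 1 := by rw [r2, c2]
  have a2 : (a * a) ^ M = 1 := by
    have : (c * c) * (a * a) = 1 := by rw [← r1]; ring
    have := congrArg (· ^ M) this
    simpa [mul_pow _ (a * a), c2] using this
  have hu2 : (u : ℂ) ^ (2 * M) = 1 := by rw [mul_comm, pow_mul, uM, one_pow]
  simp only [← sq, ← pow_mul] at a2 b2 c2
  have hst : ∀ d : ℂ, d ^ (2 * M) = 1 → ∀ w ∈ {w | ∃ ζ : ℂ, ζ ^ (2 * M) = 1 ∧ w = ζ • v},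
      d • w ∈ {w | ∃ ζ : ℂ, ζ ^ (2 * M) = 1 ∧ w = ζ • v} := by
    rintro d hd _ ⟨ζ, hζ, rfl⟩
    exact ⟨d * ζ, by rw [mul_pow, hd, hζ, one_mul], smul_smul _ _ _⟩
  refine finite_imageB_of_mapsTo hirr (F := {w | ∃ ζ : ℂ, ζ ^ (2 * M) = 1 ∧ w = ζ • v}) ?_
    (v₀ := v) ⟨1, by simp, by simp⟩ hv ?_ ?_ ?_ (hst _ hu2)
  · have hf : {ζ : ℂ | ζ ^ (2 * M) = 1}.Finite := by
      refine (Polynomial.nthRoots (2 * M) (1 : ℂ)).toFinset.finite_toSet.subset fun ζ hζ => ?_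
      simpa [Polynomial.mem_nthRoots (show 0 < 2 * M by omega)] using hζ
    refine (hf.image fun ζ => ζ • v).subset ?_
    rintro _ ⟨ζ, hζ, rfl⟩
    exact ⟨ζ, hζ, rfl⟩
  · intro w hw
    have : (ρ.X : Module.End ℂ V) w = a • w := by
      obtain ⟨ζ, -, rfl⟩ := hw; rw [map_smul, ← ha, smul_comm]
    rw [this]; exact hst a a2 w hw
  · intro w hw
    have : (ρ.Y : Module.End ℂ V) w = b • w := by
      obtain ⟨ζ, -, rfl⟩ := hw; rw [map_smul, ← hb, smul_comm]
    rw [this]; exact hst b b2 w hw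
  · intro w hw
    have : (ρ.T : Module.End ℂ V) w = c • w := by
      obtain ⟨ζ, -, rfl⟩ := hw; rw [map_smul, ← hc, smul_comm]
    rw [this]; exact hst c c2 w hw

end Rep
end DAHA

namespace DAHA
variable {u τ : ℂˣ} {V : Type*} [AddCommGroup V] [Module ℂ V]
namespace Rep

/-! ### Necessary conditions for finiteness -/

theorem exists_pow_eq_one_of_finite {ρ : Rep u τ V} (hfin : Finite ρ.imageB)
    {g : (Module.End ℂ V)ˣ} (hg : g ∈ ρ.imageB) : ∃ M : ℕ, 0 < M ∧ g ^ M = 1 := by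
  obtain ⟨M, hM, h⟩ := (isOfFinOrder_iff_pow_eq_one.mp (isOfFinOrder_of_finite (⟨g, hg⟩ : ρ.imageB)))
  exact ⟨M, hM, congrArg Subtype.val h⟩

variable {ρ : Rep u τ V} {φ : PolySpace →ₗ[ℂ] V}

theorem IsQuotMap.map_mono_natCast (h : ρ.IsQuotMap φ) (M : ℕ) :
    φ (mono M) = ((ρ.X ^ M : (Module.End ℂ V)ˣ) : Module.End ℂ V) (φ 1) := by
  induction M with
  | zero => simp
  | succ M ih =>
    rw [pow_succ', Units.val_mul, Module.End.mul_apply, ← ih, ← h.mapX, mulX,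
      LinearMap.mulLeft_apply, mono_mul]
    push_cast
    rw [add_comm]

theorem IsQuotMap.exists_mono_sub_one (h : ρ.IsQuotMap φ) (hfin : Finite ρ.imageB) :
    ∃ M : ℕ, 0 < M ∧ φ (mono M - 1) = 0 := by
  obtain ⟨M, hM, hX⟩ := exists_pow_eq_one_of_finite hfin
    (Subgroup.subset_closure (by simp : ρ.X ∈ ({ρ.X, ρ.Y, ρ.T, scalar V u} : Set _)))
  refine ⟨M, hM, ?_⟩
  rw [map_sub, h.map_mono_natCast, hX, Units.val_one, Module.End.one_apply, sub_self]

/-- If `X` is semisimple, the support does not contain `±1`. -/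
theorem IsQuotMap.sq_ne_one_of_finite (h : ρ.IsQuotMap φ) (hfin : Finite ρ.imageB)
    (ht : τ ^ 2 ≠ 1) {x : ℂˣ} (hx : x ∈ supp φ) : x ^ 2 ≠ 1 := fun h1 => by
  obtain ⟨M, hM, hX⟩ := h.exists_mono_sub_one hfin
  -- The derivative of `X^M - 1` at `x` is `M x^M ≠ 0`, although `X^M - 1` lies in the kernel.
  have := h.der_eq_zero hx h1 ht hX
  have d1 : der x 1 = 0 := by simpa using der_mono x 0
  rw [map_sub, der_mono, d1, sub_zero, mul_eq_zero] at this
  rcases this with h0 | h0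
  · have : (M : ℂ) = 0 := by exact_mod_cast h0
    exact hM.ne' (by exact_mod_cast this)
  · exact Units.ne_zero _ h0

theorem IsQuotMap.supp_pow_eq_one (h : ρ.IsQuotMap φ) (hfin : Finite ρ.imageB) {x : ℂˣ}
    (hx : x ∈ supp φ) : ∃ M : ℕ, 0 < M ∧ x ^ M = 1 := by
  obtain ⟨M, hM, hX⟩ := h.exists_mono_sub_one hfin
  have := hx _ hX
  rw [map_sub, ev_mono, map_one, sub_eq_zero] at this
  exact ⟨M, hM, Units.ext (by rw [zpow_natCast] at this; rw [this, Units.val_one])⟩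

/-- An eigenvalue `ζ` of `A` satisfies `ζ^M = 1`; as the determinant is `1`, the other one is `ζ⁻¹`.
-/
theorem exists_eigenvalue_of_pow_eq_one {A : Matrix (Fin 2) (Fin 2) ℂ} (hdet : A.det = 1) {M : ℕ}
    (hA : A ^ M = 1) : ∃ ζ : ℂ, ζ ^ M = 1 ∧ ζ + ζ⁻¹ = A.trace := by
  obtain ⟨ζ, hζ⟩ := IsAlgClosed.exists_root (Polynomial.X ^ 2 - Polynomial.C A.trace * Polynomial.X
    + 1 : Polynomial ℂ) (by
      have : (Polynomial.X ^ 2 - Polynomial.C A.trace * Polynomial.X + 1 : Polynomial ℂ).degree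
        = 2 := by compute_degree!
      rw [this]; norm_num)
  simp only [Polynomial.IsRoot, Polynomial.eval_add, Polynomial.eval_sub, Polynomial.eval_pow,
    Polynomial.eval_X, Polynomial.eval_mul, Polynomial.eval_C, Polynomial.eval_one] at hζ
  have h0 : ζ ≠ 0 := by rintro rfl; simp at hζ
  refine ⟨ζ, ?_, ?_⟩
  · have hd : (A - ζ • (1 : Matrix (Fin 2) (Fin 2) ℂ)).det = 0 := by
      rw [Matrix.det_fin_two] at hdet ⊢
      rw [Matrix.trace_fin_two] at hζ
      simp
      linear_combination hζ + hdet
    obtain ⟨v, hv, hAv⟩ := Matrix.exists_mulVec_eq_zero_iff.mpr hd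
    have e : A.mulVec v = ζ • v := by
      rw [Matrix.sub_mulVec, sub_eq_zero, Matrix.smul_mulVec, Matrix.one_mulVec] at hAv
      exact hAv
    have en : ∀ n : ℕ, (A ^ n).mulVec v = ζ ^ n • v := fun n => by
      induction n with
      | zero => simp
      | succ n ih => rw [pow_succ', ← Matrix.mulVec_mulVec, ih, Matrix.mulVec_smul, e, smul_smul,
          pow_succ]
    have := en M
    rw [hA, Matrix.one_mulVec] at this
    exact (smul_left_injective ℂ hv (by rw [one_smul, ← this] : (1 : ℂ) • v = ζ ^ M • v)).symm
  · field_simp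
    linear_combination hζ

/-- In a finite image, the commutator of `X` and `T` acts on the span of the evaluations at
`x` and `x⁻¹` by an element of finite order in `SL(2)`. -/
theorem IsQuotMap.exists_trace_eq (h : ρ.IsQuotMap φ) (hfin : Finite ρ.imageB) {x : ℂˣ}
    (hx : x ∈ supp φ) (hx' : x⁻¹ ∈ supp φ) (h1 : x ^ 2 ≠ 1) :
    ∃ (ζ : ℂ) (M : ℕ), 0 < M ∧ ζ ^ M = 1 ∧
      ζ + ζ⁻¹ = 2 + (x : ℂ) ^ 2 + ((x : ℂ) ^ 2)⁻¹ - (τ : ℂ) ^ 2 - ((τ : ℂ) ^ 2)⁻¹ := by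
  have gX : ρ.X ∈ ρ.imageB := Subgroup.subset_closure (by simp)
  have gT : ρ.T ∈ ρ.imageB := Subgroup.subset_closure (by simp)
  obtain ⟨M, hM, hg⟩ := exists_pow_eq_one_of_finite hfin
    (mul_mem (mul_mem (mul_mem gX gT) (inv_mem gX)) (inv_mem gT))
  set s : ℂ := (τ : ℂ) - ((τ⁻¹ : ℂˣ) : ℂ) with hs
  -- A lift of `X T X⁻¹ T⁻¹` to `𝒳`. Its effect on the pair of values at `x, x⁻¹` is a matrix, and
  -- `G^M - 1` takes values in the kernel, where both evaluations vanish.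
  let G : Module.End ℂ PolySpace := mulX 1 * heckeOp τ * mulX (-1) * (heckeOp τ - algebraMap ℂ _ s)
  have hG : ∀ p, φ (G p) = ((ρ.X * ρ.T * ρ.X⁻¹ * ρ.T⁻¹ : (Module.End ℂ V)ˣ) : Module.End ℂ V)
      (φ p) := fun p => by
    simp only [G, Units.val_mul, Module.End.mul_apply]
    rw [h.mapX, h.mapT, h.map_mulX_neg, h.map_T_inv]
  have hGn : ∀ (n : ℕ) p, φ ((G ^ n) p) =
      (((ρ.X * ρ.T * ρ.X⁻¹ * ρ.T⁻¹) ^ n : (Module.End ℂ V)ˣ) : Module.End ℂ V) (φ p) := by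
    intro n p
    induction n with
    | zero => simp
    | succ n ih => rw [pow_succ', pow_succ', Module.End.mul_apply, hG, ih]; rfl
  have hk : ∀ p, φ ((G ^ M) p - p) = 0 := fun p => by
    rw [map_sub, hGn, hg, Units.val_one, Module.End.one_apply, sub_self]
  let e : PolySpace → Fin 2 → ℂ := fun p => ![ev x p, ev x⁻¹ p]
  have hne : x ≠ x⁻¹ := fun hh => h1 (by
    rw [sq]; nth_rewrite 2 [hh]; rw [mul_inv_cancel])
  have esurj : Function.Surjective e := fun r => by
    classical
    obtain ⟨f, hf⟩ := exists_ev_eq {x, x⁻¹} fun y => if y = x then r 0 else r 1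
    refine ⟨f, funext fun i => ?_⟩
    fin_cases i
    · have := hf x (by simp)
      rw [if_pos rfl] at this
      exact this
    · have := hf x⁻¹ (by simp)
      rw [if_neg hne.symm] at this
      exact this
  have ematrix : ∀ A B : Matrix (Fin 2) (Fin 2) ℂ, (∀ p, A.mulVec (e p) = B.mulVec (e p)) →
      A = B := fun A B hAB => by
    apply Matrix.mulVec_injective
    funext v
    obtain ⟨p, rfl⟩ := esurj v
    exact hAB p
  set y : ℂ := (x : ℂ) with hy
  have y0 : y ≠ 0 := x.ne_zero
  have yi : ((x⁻¹ : ℂˣ) : ℂ) = y⁻¹ := Units.val_inv_eq_inv_val x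
  have t0 : (τ : ℂ) ≠ 0 := τ.ne_zero
  have ti : ((τ⁻¹ : ℂˣ) : ℂ) = (τ : ℂ)⁻¹ := Units.val_inv_eq_inv_val τ
  have y1 : y ^ 2 - 1 ≠ 0 := fun hh => h1 (Units.ext (by push_cast; linear_combination hh))
  have y1' : 1 - y ^ 2 ≠ 0 := fun hh => y1 (by linear_combination -hh)
  let D : Matrix (Fin 2) (Fin 2) ℂ := !![y, 0; 0, y⁻¹]
  let D' : Matrix (Fin 2) (Fin 2) ℂ := !![y⁻¹, 0; 0, y]
  let B : Matrix (Fin 2) (Fin 2) ℂ := !![-s / (y ^ 2 - 1), (τ * y ^ 2 - (τ : ℂ)⁻¹) / (y ^ 2 - 1);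
    (τ - (τ : ℂ)⁻¹ * y ^ 2) / (1 - y ^ 2), -(s * y ^ 2) / (1 - y ^ 2)]
  have eD : ∀ p, e (mulX 1 p) = D.mulVec (e p) := fun p => by
    ext i; fin_cases i <;> simp [e, D, ev_mulX, Matrix.mulVec, dotProduct, Fin.sum_univ_two, hy]
  have eD' : ∀ p, e (mulX (-1) p) = D'.mulVec (e p) := fun p => by
    ext i; fin_cases i <;> simp [e, D', ev_mulX, Matrix.mulVec, dotProduct, Fin.sum_univ_two, hy]
  have eB : ∀ p, e (heckeOp τ p) = B.mulVec (e p) := fun p => by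
    have k1 := ev_heckeOp_mul τ x p
    have k2 := ev_heckeOp_mul τ x⁻¹ p
    rw [← hs, ti, ← hy] at k1
    rw [← hs, ti, inv_inv, yi] at k2
    ext i; fin_cases i
    · simp only [e, B, Matrix.mulVec, dotProduct, Fin.sum_univ_two]
      simp
      field_simp
      field_simp at k1
      linear_combination k1
    · simp only [e, B, Matrix.mulVec, dotProduct, Fin.sum_univ_two]
      simp
      field_simp
      field_simp at k2
      linear_combination k2
  have eB' : ∀ p, e ((heckeOp τ - algebraMap ℂ _ s) p) = (B - s • 1).mulVec (e p) := fun p => by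
    rw [Matrix.sub_mulVec, ← eB, Matrix.smul_mulVec, Matrix.one_mulVec]
    ext i; fin_cases i <;> simp [e]
  have eG : ∀ p, e (G p) = (D * B * D' * (B - s • 1)).mulVec (e p) := fun p => by
    simp only [G, Module.End.mul_apply]
    rw [eD, eB, eD', eB']
    simp only [Matrix.mulVec_mulVec, mul_assoc]
  have eGn : ∀ (n : ℕ) p, e ((G ^ n) p) = ((D * B * D' * (B - s • 1)) ^ n).mulVec (e p) := by
    intro n p
    induction n with
    | zero => simp
    | succ n ih => rw [pow_succ', pow_succ', Module.End.mul_apply, eG, ih, Matrix.mulVec_mulVec]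
  have hAM : (D * B * D' * (B - s • 1)) ^ M = 1 := by
    refine ematrix _ _ fun p => ?_
    rw [← eGn, Matrix.one_mulVec]
    have e1 := hx _ (hk p)
    have e2 := hx' _ (hk p)
    rw [map_sub, sub_eq_zero] at e1 e2
    ext i; fin_cases i
    · exact e1
    · exact e2
  -- The matrix form of `T T⁻¹ = 1`. It gives determinant `1` for the commutator without expanding
  -- `B`.
  have hBB : B * (B - s • 1) = 1 := ematrix _ _ fun p => by
    rw [← Matrix.mulVec_mulVec, ← eB', ← eB, ← Module.End.mul_apply, heckeOp_inv_right,
      Matrix.one_mulVec]; rfl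
  have hdet : (D * B * D' * (B - s • 1)).det = 1 := by
    have hD : D.det * D'.det = 1 := by simp [D, D', Matrix.det_fin_two_of, y0]
    have := congrArg Matrix.det hBB
    rw [Matrix.det_mul, Matrix.det_one] at this
    rw [Matrix.det_mul, Matrix.det_mul, Matrix.det_mul]
    linear_combination D.det * D'.det * this + hD
  obtain ⟨ζ, hζ, hζt⟩ := exists_eigenvalue_of_pow_eq_one hdet hAM
  refine ⟨ζ, M, hM, hζ, hζt.trans ?_⟩
  have hsv : s = τ - (τ : ℂ)⁻¹ := by rw [hs, ti]
  rw [Matrix.trace_fin_two]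
  simp only [D, B, D', Matrix.mul_apply, Fin.sum_univ_two, Matrix.sub_apply, Matrix.smul_apply]
  simp
  rw [hsv]
  have : (1 - y ^ 2) = -(y ^ 2 - 1) := by ring
  rw [this]
  field_simp
  ring

end Rep

end DAHA

namespace DAHA

/-! ### Galois conjugates of trace inequalities -/

theorem cos_two_pi_mul_div_le {Q : ℕ} {k : ℤ} (h : ¬ (Q : ℤ) ∣ k) :
    Real.cos (2 * Real.pi * k / Q) ≤ Real.cos (2 * Real.pi / Q) := by
  have hQ : Q ≠ 0 ∨ Q = 0 := ne_or_eq Q 0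
  rcases hQ with hQ | rfl
  swap
  -- For `Q = 0` division by zero makes both angles `0`.
  · simp
  have hQ' : (0 : ℝ) < Q := by positivity
  have half : ∀ r : ℤ, 1 ≤ r → 2 * r ≤ Q →
      Real.cos (2 * Real.pi * r / Q) ≤ Real.cos (2 * Real.pi / Q) := fun r h1 h2 => by
    have h1' : (1 : ℝ) ≤ r := by exact_mod_cast h1
    have h2' : 2 * (r : ℝ) ≤ Q := by exact_mod_cast h2
    apply Real.cos_le_cos_of_nonneg_of_le_pi
    · positivity
    · rw [div_le_iff₀ hQ']; nlinarith [Real.pi_pos]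
    · exact div_le_div_of_nonneg_right (le_mul_of_one_le_right (by positivity) h1') hQ'.le
  have hr0 := Int.emod_nonneg k (show (Q : ℤ) ≠ 0 by exact_mod_cast hQ)
  have hr1 := Int.emod_lt_of_pos k (show (0 : ℤ) < Q by positivity)
  have hrne : k % Q ≠ 0 := fun h0 => h (Int.dvd_of_emod_eq_zero h0)
  have hk : (k : ℝ) = (k % Q : ℤ) + Q * (k / Q : ℤ) := by
    exact_mod_cast (Int.emod_add_mul_ediv k Q).symm
  have e : 2 * Real.pi * k / Q = 2 * Real.pi * (k % Q : ℤ) / Q + (k / Q : ℤ) * (2 * Real.pi) := by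
    rw [hk]; field_simp
  rw [e, Real.cos_add_int_mul_two_pi]
  by_cases h2 : 2 * (k % Q) ≤ Q
  · exact half _ (by omega) h2
  · have := half (Q - k % Q) (by omega) (by omega)
    refine le_trans (le_of_eq ?_) this
    rw [← Real.cos_neg, ← Real.cos_add_two_pi]
    congr 1
    push_cast
    field_simp
    ring

theorem exp_zpow_re (P : ℕ) (n : ℤ) :
    ((Complex.exp (2 * Real.pi * Complex.I / P)) ^ n).re = Real.cos (2 * Real.pi * n / P) := by
  rw [← Complex.exp_int_mul]
  have : (n : ℂ) * (2 * Real.pi * Complex.I / P) = ((2 * Real.pi * n / P : ℝ) : ℂ) * Complex.I := by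
    push_cast; ring
  rw [this, Complex.exp_ofReal_mul_I_re]

theorem eq_or_eq_inv_of_re_eq {a b : ℂ} (ha : ‖a‖ = 1) (hb : ‖b‖ = 1) (h : a.re = b.re) :
    a = b ∨ a = b⁻¹ := by
  have h1 : a.re ^ 2 + a.im ^ 2 = 1 := by
    have := Complex.sq_norm a
    rw [ha, Complex.normSq_apply] at this; linarith
  have h2 : b.re ^ 2 + b.im ^ 2 = 1 := by
    have := Complex.sq_norm b
    rw [hb, Complex.normSq_apply] at this; linarith
  have h3 : (a.im - b.im) * (a.im + b.im) = 0 := by rw [h] at h1; linear_combination h1 - h2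
  rcases mul_eq_zero.mp h3 with h4 | h4
  · exact Or.inl (Complex.ext h (by linarith))
  · refine Or.inr ?_
    rw [Complex.inv_eq_conj hb]
    exact Complex.ext (by simpa using h) (by simp; linarith)

/-- On the unit circle `z + z⁻¹ = 2 Re z`, so the relation says `Re ζ = 1 + Re a - Re t`, and `Re ζ
≤ 1`. -/
theorem re_le_of_trace_eq {a t ζ : ℂ} (ha : ‖a‖ = 1) (ht : ‖t‖ = 1) (hζ : ‖ζ‖ = 1)
    (h : ζ + ζ⁻¹ = 2 + a + a⁻¹ - t - t⁻¹) : a.re ≤ t.re := by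
  rw [Complex.inv_eq_conj hζ, Complex.inv_eq_conj ha, Complex.inv_eq_conj ht] at h
  have h1 := congrArg Complex.re h
  simp at h1
  have h2 := Complex.re_le_norm ζ
  linarith

/-- `y` and `y'` are roots of the same cyclotomic polynomial, the minimal polynomial of `y`.
Adjoining `ζ` as well lets the conjugation be applied to the whole trace relation. -/
theorem exists_algHom_adjoin_pair {y ζ y' : ℂ} {P M : ℕ} (hP : 0 < P) (hM : 0 < M)
    (hy : IsPrimitiveRoot y P) (hy' : IsPrimitiveRoot y' P) (hζ : ζ ^ M = 1) :
    ∃ σ : IntermediateField.adjoin ℚ ({y, ζ} : Set ℂ) →ₐ[ℚ] ℂ,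
      σ ⟨y, IntermediateField.subset_adjoin _ _ (by simp)⟩ = y' := by
  refine IntermediateField.exists_algHom_adjoin_of_splits_of_aeval
    (fun s hs => ⟨?_, IsAlgClosed.splits _⟩) ?_ ?_
  · rcases hs with rfl | rfl
    · exact IsIntegral.of_pow hP (by rw [hy.pow_eq_one]; exact isIntegral_one)
    · exact IsIntegral.of_pow hM (by rw [hζ]; exact isIntegral_one)
  · rw [← Polynomial.cyclotomic_eq_minpoly_rat hy hP, Polynomial.aeval_def,
      ← Polynomial.eval_map, Polynomial.map_cyclotomic]
    exact hy'.isRoot_cyclotomic hP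

theorem re_zpow_le_of_trace_eq {y ζ : ℂ} {P M : ℕ} (hP : 0 < P) (hM : 0 < M)
    (hy : IsPrimitiveRoot y P) (hζ : ζ ^ M = 1) {b κ : ℤ}
    (h : ζ + ζ⁻¹ = 2 + y ^ b + (y ^ b)⁻¹ - y ^ κ - (y ^ κ)⁻¹) {y' : ℂ}
    (hy' : IsPrimitiveRoot y' P) : (y' ^ b).re ≤ (y' ^ κ).re := by
  obtain ⟨σ, hσ⟩ := exists_algHom_adjoin_pair hP hM hy hy' hζ
  set Y : IntermediateField.adjoin ℚ ({y, ζ} : Set ℂ) :=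
    ⟨y, IntermediateField.subset_adjoin _ _ (by simp)⟩
  set Z : IntermediateField.adjoin ℚ ({y, ζ} : Set ℂ) :=
    ⟨ζ, IntermediateField.subset_adjoin _ _ (by simp)⟩
  have hrel : Z + Z⁻¹ = 2 + Y ^ b + (Y ^ b)⁻¹ - Y ^ κ - (Y ^ κ)⁻¹ := Subtype.ext (by
    push_cast; exact h)
  have hZ : Z ^ M = 1 := Subtype.ext (by push_cast; exact hζ)
  have hn : ‖y'‖ = 1 := hy'.norm'_eq_one hP.ne'
  have h1 := congrArg σ hrel
  simp only [map_add, map_sub, map_inv₀, map_zpow₀, hσ, map_ofNat] at h1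
  refine re_le_of_trace_eq (ζ := σ Z) (by rw [norm_zpow, hn, one_zpow])
    (by rw [norm_zpow, hn, one_zpow]) ?_ h1
  have := congrArg σ hZ
  rw [map_pow, map_one] at this
  exact Complex.norm_eq_one_of_pow_eq_one this hM.ne'

/-- Points of the unit circle with equal real parts are equal or inverse to each other; the two
divisibility hypotheses exclude both. -/
theorem re_zpow_lt_of_trace_eq {y ζ : ℂ} {P M : ℕ} (hP : 0 < P) (hM : 0 < M)
    (hy : IsPrimitiveRoot y P) (hζ : ζ ^ M = 1) {b κ : ℤ}
    (h : ζ + ζ⁻¹ = 2 + y ^ b + (y ^ b)⁻¹ - y ^ κ - (y ^ κ)⁻¹)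
    (h1 : ¬ (P : ℤ) ∣ b - κ) (h2 : ¬ (P : ℤ) ∣ b + κ) {y' : ℂ}
    (hy' : IsPrimitiveRoot y' P) : (y' ^ b).re < (y' ^ κ).re := by
  refine lt_of_le_of_ne (re_zpow_le_of_trace_eq hP hM hy hζ h hy') fun he => ?_
  have hn : ‖y'‖ = 1 := hy'.norm'_eq_one hP.ne'
  have h0 : y' ≠ 0 := hy'.ne_zero hP.ne'
  rcases eq_or_eq_inv_of_re_eq (by rw [norm_zpow, hn, one_zpow])
    (by rw [norm_zpow, hn, one_zpow]) he with h3 | h3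
  · refine h1 ((hy'.zpow_eq_one_iff_dvd _).mp ?_)
    rw [zpow_sub₀ h0, h3, div_self (zpow_ne_zero _ h0)]
  · refine h2 ((hy'.zpow_eq_one_iff_dvd _).mp ?_)
    rw [zpow_add₀ h0, h3, inv_mul_cancel₀ (zpow_ne_zero _ h0)]

/-- If `gcd(b, P)` divides `κ`, some conjugate of `y ^ b` is at least as close to `1` as that of
`y ^ κ`. -/
theorem exists_primitiveRoot_re_le {P : ℕ} (hP : 0 < P) {b κ : ℤ} (hd : (Int.gcd b P : ℤ) ∣ κ)
    (hκ : ¬ (P : ℤ) ∣ κ) : ∃ y : ℂ, IsPrimitiveRoot y P ∧ (y ^ κ).re ≤ (y ^ b).re := by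
  set d := Int.gcd b P with hdd
  have hdP : d ∣ P := by exact_mod_cast (Int.gcd_dvd_right b P)
  have hdb : (d : ℤ) ∣ b := Int.gcd_dvd_left b P
  have hd0 : 0 < d := Nat.pos_of_dvd_of_pos hdP hP
  obtain ⟨Q, hQ⟩ := hdP
  obtain ⟨b', hb'⟩ := hdb
  obtain ⟨k', hk'⟩ := hd
  have hQ0 : 0 < Q := Nat.pos_of_ne_zero (by rintro rfl; omega)
  have hcop : IsCoprime b' (Q : ℤ) := by
    rw [Int.isCoprime_iff_gcd_eq_one]
    have : Int.gcd ((d : ℤ) * b') ((d : ℤ) * Q) = d * Int.gcd b' Q := by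
      rw [Int.gcd_mul_left]; simp
    have h2 : Int.gcd ((d : ℤ) * b') ((d : ℤ) * Q) = d := by
      have hPd : (P : ℤ) = d * Q := by exact_mod_cast hQ
      rw [← hb', ← hPd]
    rw [h2] at this
    exact Nat.eq_of_mul_eq_mul_left hd0 (by omega)
  -- With `b = d b'`, `P = d Q` and `b'` invertible modulo `Q`, the inverse `r` of `b'` lifts to a
  -- unit `j` modulo `P`. For `y = exp(2πi j / P)` this gives `y^b = exp(2πi / Q)`.
  obtain ⟨r, s, hrs⟩ := hcop
  have : NeZero P := ⟨hP.ne'⟩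
  have hbu : (b' : ZMod Q) * (r : ZMod Q) = 1 := by
    have := congrArg (Int.cast : ℤ → ZMod Q) hrs
    push_cast at this
    rw [ZMod.natCast_self, mul_zero, add_zero, mul_comm] at this
    exact this
  let ru : (ZMod Q)ˣ := ⟨r, b', by rw [mul_comm]; exact hbu, hbu⟩
  obtain ⟨a, ha⟩ := ZMod.unitsMap_surjective (Dvd.intro_left d hQ.symm : Q ∣ P) ru
  have hac : Nat.Coprime (a : ZMod P).val P := ZMod.val_coe_unit_coprime a
  have hab : (Q : ℤ) ∣ (a : ZMod P).val * b' - 1 := by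
    rw [← ZMod.intCast_zmod_eq_zero_iff_dvd]
    have h1 : (((a : ZMod P).val : ℕ) : ZMod Q) = r := by
      have := congrArg Units.val ha
      rw [ZMod.unitsMap_val] at this
      rw [ZMod.natCast_val]; exact this
    push_cast
    rw [h1, mul_comm, hbu, sub_self]
  set j := (a : ZMod P).val
  have hPd : (P : ℤ) = d * Q := by exact_mod_cast hQ
  have hw := Complex.isPrimitiveRoot_exp P hP.ne'
  refine ⟨_, hw.pow_of_coprime j hac, ?_⟩
  rw [← zpow_natCast, ← zpow_mul, ← zpow_mul, exp_zpow_re, exp_zpow_re]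
  have e : ∀ k : ℤ, 2 * Real.pi * ((d * k : ℤ) : ℝ) / P = 2 * Real.pi * k / Q := fun k => by
    have : (P : ℝ) = d * Q := by exact_mod_cast hQ
    rw [this]; push_cast; field_simp
  rw [hk', hb', mul_left_comm, mul_left_comm (j : ℤ), e, e]
  obtain ⟨c, hc⟩ := hab
  have e1 : 2 * Real.pi * ((j * b' : ℤ) : ℝ) / Q = 2 * Real.pi / Q + c * (2 * Real.pi) := by
    have : (j : ℤ) * b' = 1 + Q * c := by linarith
    rw [this]; push_cast; field_simp
  rw [e1, Real.cos_add_int_mul_two_pi]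
  -- As `d ∣ κ`, the power `y^κ` is a `Q`-th root of unity, and it is not `1`; hence its real part
  -- is at most `cos(2π / Q)`.
  apply cos_two_pi_mul_div_le
  intro hdv
  apply hκ
  rw [hPd, hk']
  refine mul_dvd_mul_left _ ?_
  have hjQ : IsCoprime (Q : ℤ) (j : ℤ) := ⟨-c, b', by linarith⟩
  exact hjQ.dvd_of_dvd_mul_left hdv

end DAHA

namespace DAHA
variable {u τ : ℂˣ} {V : Type*} [AddCommGroup V] [Module ℂ V]
namespace Rep
variable {ρ : Rep u τ V} {φ : PolySpace →ₗ[ℂ] V}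

/-! ### Chains in the support -/

theorem IsQuotMap.supp_up (h : ρ.IsQuotMap φ) {x : ℂˣ} (hx : x ∈ supp φ)
    (hne : τ ^ 2 * x ^ 2 ≠ 1) : u * x ∈ supp φ := by
  have := h.supp_pi (h.supp_inv hx hne)
  rwa [div_inv_eq_mul] at this

theorem IsQuotMap.supp_down (h : ρ.IsQuotMap φ) {x : ℂˣ} (hx : x ∈ supp φ)
    (hne : τ ^ 2 * (u / x) ^ 2 ≠ 1) : x / u ∈ supp φ := by
  have := h.supp_inv (h.supp_pi hx) hne
  rwa [inv_div] at this

theorem IsQuotMap.exists_blocked_or (h : ρ.IsQuotMap φ) {x : ℂˣ} (hx : x ∈ supp φ) :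
    (∃ y ∈ supp φ, τ ^ 2 * y ^ 2 = 1) ∨ ∀ i : ℕ, u ^ i * x ∈ supp φ := by
  by_contra! hcon
  obtain ⟨h1, i, hi⟩ := hcon
  refine hi ?_
  clear hi
  induction i with
  | zero => simpa using hx
  | succ i ih => rw [pow_succ', mul_assoc]; exact h.supp_up ih (h1 _ ih)

/-- Moving up by `u` multiplies `τ² x²` by `u²`. Since `(τ² x²)⁻¹` is an `N`-th root of unity, it is
a power of `u²`, so the upward walk meets a blocked point. -/
theorem IsQuotMap.exists_blocked (h : ρ.IsQuotMap φ) {x : ℂˣ} (hx : x ∈ supp φ) {N : ℕ}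
    (hN0 : 0 < N) (hN : IsPrimitiveRoot (u ^ 2) N) (hxN : (τ ^ 2 * x ^ 2) ^ N = 1) :
    ∃ y ∈ supp φ, τ ^ 2 * y ^ 2 = 1 := by
  refine (h.exists_blocked_or hx).elim id fun hall => ?_
  have : NeZero N := ⟨hN0.ne'⟩
  have hc : IsPrimitiveRoot (((u ^ 2 : ℂˣ) : ℂ)) N := hN.map_of_injective (f := Units.coeHom ℂ)
    Units.val_injective
  obtain ⟨i, -, hi⟩ := hc.eq_pow_of_pow_eq_one
    (ξ := (((τ ^ 2 * x ^ 2)⁻¹ : ℂˣ) : ℂ)) (by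
      rw [← Units.val_pow_eq_pow_val, inv_pow, hxN, inv_one, Units.val_one])
  rw [← Units.val_pow_eq_pow_val] at hi
  have hi' := Units.ext hi
  refine ⟨_, hall i, ?_⟩
  rw [mul_pow, ← pow_mul, mul_comm i, pow_mul, hi', mul_left_comm, inv_mul_cancel]

theorem zpow_two_mul_eq_one_iff {N : ℕ} (hN : IsPrimitiveRoot (u ^ 2) N) (k : ℤ) :
    u ^ (2 * k) = 1 ↔ (N : ℤ) ∣ k := by
  rw [← hN.zpow_eq_one_iff_dvd, zpow_mul]; rfl

/-- From a point where `T` degenerates, the support continues downwards until `T` degenerates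
again. -/
theorem IsQuotMap.supp_chain (h : ρ.IsQuotMap φ) {x : ℂˣ} (hx : x ∈ supp φ)
    (hx1 : τ ^ 2 * x ^ 2 = 1) {N : ℕ} (hN : IsPrimitiveRoot (u ^ 2) N) {κ : ℤ}
    (hτ : τ ^ 2 = u ^ κ) {c : ℕ} (hc : (N : ℤ) ∣ κ + c) (hcN : c ≤ N) :
    ∀ i < c, x / u ^ i ∈ supp φ := by
  intro i hi
  induction i with
  | zero => simpa using hx
  | succ i ih =>
    rw [pow_succ, ← div_div]
    refine h.supp_down (ih (by omega)) fun he => ?_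
    have hx2 : x ^ 2 = (τ ^ 2)⁻¹ := (inv_eq_of_mul_eq_one_right hx1).symm
    -- The step down fails only if `N ∣ κ + i + 1`. Together with `N ∣ κ + c` this would give `N ∣ c
    -- - i - 1`, a number strictly between `0` and `N`.
    have e : u ^ (2 * (κ + i + 1)) = 1 := by
      rw [← he, div_pow, div_pow, hx2, hτ]
      simp only [div_eq_mul_inv, ← zpow_natCast, ← zpow_mul, ← zpow_neg, ← zpow_add]
      congr 1; push_cast; ring
    rw [zpow_two_mul_eq_one_iff hN] at e
    have h2 := dvd_sub hc e
    have h3 := Int.le_of_dvd (by omega) h2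
    omega

/-- The points of a perfect quotient: a chain, together with its translate by `e = ±1`. -/
def chain (u x e : ℂˣ) (c : ℕ) : Finset ℂˣ :=
  open Classical in
  (Finset.range c).image (fun i => x / u ^ i) ∪ (Finset.range c).image fun i => e * (x / u ^ i)

theorem mem_chain {x e y : ℂˣ} {c : ℕ} : y ∈ chain u x e c ↔
    ∃ i < c, y = x / u ^ i ∨ y = e * (x / u ^ i) := by
  classical
  simp only [chain, Finset.mem_union, Finset.mem_image, Finset.mem_range]
  constructor
  · rintro (⟨i, hi, rfl⟩ | ⟨i, hi, rfl⟩)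
    exacts [⟨i, hi, Or.inl rfl⟩, ⟨i, hi, Or.inr rfl⟩]
  · rintro ⟨i, hi, rfl | rfl⟩
    exacts [Or.inl ⟨i, hi, rfl⟩, Or.inr ⟨i, hi, rfl⟩]

section
variable {x e : ℂˣ} {κ : ℤ} {c : ℕ}

/-- Because `x⁻¹ = x u^κ`, inversion reverses the chain by `i ↦ c - i`, up to the factor `e`. -/
theorem div_pow_reflect (hx1 : τ ^ 2 * x ^ 2 = 1) (hτ : τ ^ 2 = u ^ κ)
    (he : e = u ^ (κ + c)) {i : ℕ} (hi : i ≤ c) : (x / u ^ i)⁻¹ = e * (x / u ^ (c - i)) := by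
  have hx2 : x * x = u ^ (-κ) := by
    rw [← sq, (inv_eq_of_mul_eq_one_right hx1).symm, hτ, zpow_neg]
  have hxi : x⁻¹ = x * u ^ κ := by
    rw [inv_eq_iff_mul_eq_one, ← mul_assoc, hx2, ← zpow_add, neg_add_cancel, zpow_zero]
  rw [inv_div, div_eq_mul_inv, hxi, he, ← zpow_natCast, ← zpow_natCast, Nat.cast_sub hi,
    div_eq_mul_inv, ← zpow_neg, mul_left_comm, mul_left_comm (u ^ (κ + (c : ℤ))), ← zpow_add,
    ← zpow_add]
  congr 2; ring

theorem div_pow_sq (hx1 : τ ^ 2 * x ^ 2 = 1) (hτ : τ ^ 2 = u ^ κ) (i : ℕ) :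
    (x / u ^ i) ^ 2 = (u ^ (κ + 2 * i))⁻¹ := by
  have hx2 : x ^ 2 = u ^ (-κ) := by
    rw [(inv_eq_of_mul_eq_one_right hx1).symm, hτ, zpow_neg]
  rw [div_pow, hx2, ← pow_mul, ← zpow_natCast, div_eq_mul_inv, ← zpow_neg, ← zpow_neg, ← zpow_add]
  congr 1; push_cast; ring

theorem div_pow_pi (hx1 : τ ^ 2 * x ^ 2 = 1) (hτ : τ ^ 2 = u ^ κ)
    (he : e = u ^ (κ + c)) {i : ℕ} (hi : i < c) :
    u / (x / u ^ i) = e * (x / u ^ (c - 1 - i)) := by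
  rw [div_eq_mul_inv, div_pow_reflect hx1 hτ he hi.le]
  have : c - i = (c - 1 - i) + 1 := by omega
  rw [this, pow_succ, ← div_div, mul_div_assoc' e, mul_div_cancel]

/-- `y ↦ u / y` reflects the indices by `i ↦ c - 1 - i`, inversion by `i ↦ c - i`. The latter leaves
the range only at `i = 0`, and precisely these points are blocked. -/
theorem isClosedSet_chain (hx1 : τ ^ 2 * x ^ 2 = 1) (hτ : τ ^ 2 = u ^ κ)
    (he : e = u ^ (κ + c)) (he2 : e ^ 2 = 1) (hsing : ∀ i < c, u ^ (κ + 2 * i) ≠ 1) :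
    IsClosedSet u τ (chain u x e c) := by
  have hei : e⁻¹ = e := by rw [inv_eq_iff_mul_eq_one, ← sq, he2]
  have hee : e * e = 1 := by rw [← sq, he2]
  intro y hy
  rw [Finset.mem_coe, mem_chain] at hy
  simp only [Finset.mem_coe, mem_chain]
  obtain ⟨i, hi, hy⟩ := hy
  have hy2 : y ^ 2 = (u ^ (κ + 2 * i))⁻¹ := by
    rcases hy with rfl | rfl
    · exact div_pow_sq hx1 hτ i
    · rw [mul_pow, he2, one_mul]; exact div_pow_sq hx1 hτ i
  refine ⟨⟨c - 1 - i, by omega, ?_⟩, ?_, ?_⟩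
  · rcases hy with rfl | rfl
    · exact Or.inr (div_pow_pi hx1 hτ he hi)
    · refine Or.inl ?_
      rw [mul_comm e, ← div_div, div_pow_pi hx1 hτ he hi, mul_comm e, mul_div_assoc, div_self',
        mul_one]
  · rw [hy2]; exact inv_ne_one.mpr (hsing i hi)
  · rcases Nat.eq_zero_or_pos i with rfl | hi0
    · left; rw [hy2, hτ]; simp
    · right
      refine ⟨c - i, by omega, ?_⟩
      rcases hy with rfl | rfl
      · exact Or.inr (div_pow_reflect hx1 hτ he hi.le)
      · refine Or.inl ?_
        rw [mul_inv, div_pow_reflect hx1 hτ he hi.le, hei, ← mul_assoc, hee, one_mul]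

theorem IsQuotMap.chain_subset (h : ρ.IsQuotMap φ) (hx1 : τ ^ 2 * x ^ 2 = 1) (hτ : τ ^ 2 = u ^ κ)
    (he : e = u ^ (κ + c)) (hs : ∀ i < c, x / u ^ i ∈ supp φ) :
    (chain u x e c : Set ℂˣ) ⊆ supp φ := by
  intro y hy
  rw [Finset.mem_coe, mem_chain] at hy
  obtain ⟨i, hi, rfl | rfl⟩ := hy
  · exact hs i hi
  · have := h.supp_pi (hs (c - 1 - i) (by omega))
    rwa [div_pow_pi hx1 hτ he (by omega), show c - 1 - (c - 1 - i) = i by omega] at this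

theorem card_chain_one (hu : ∀ i j : ℕ, i < c → j < c → u ^ i = u ^ j → i = j)
    (x : ℂˣ) : (chain u x 1 c).card = c := by
  classical
  have : chain u x 1 c = (Finset.range c).image fun i => x / u ^ i := by simp [chain]
  rw [this, Finset.card_image_of_injOn, Finset.card_range]
  intro i hi j hj hij
  exact hu i j (by simpa using hi) (by simpa using hj) (div_right_injective hij)

theorem card_chain_neg_one (hu : ∀ i j : ℕ, i < c → j < c → u ^ i = u ^ j → i = j)
    (hu' : ∀ i j : ℕ, i < c → j < c → u ^ i ≠ -u ^ j)
    (x : ℂˣ) : (chain u x (-1) c).card = 2 * c := by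
  classical
  rw [chain, Finset.card_union_of_disjoint, Finset.card_image_of_injOn,
    Finset.card_image_of_injOn, Finset.card_range, two_mul]
  · intro i hi j hj hij
    exact hu i j (by simpa using hi) (by simpa using hj)
      (div_right_injective (mul_right_injective _ hij))
  · intro i hi j hj hij
    exact hu i j (by simpa using hi) (by simpa using hj) (div_right_injective hij)
  · rw [Finset.disjoint_left]
    intro y hy hy'
    simp only [Finset.mem_image, Finset.mem_range] at hy hy'
    obtain ⟨i, hi, rfl⟩ := hy
    obtain ⟨j, hj, hij⟩ := hy'
    refine hu' i j hi hj ?_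
    rw [← mul_div_assoc, mul_comm, mul_div_assoc, div_eq_mul_inv x] at hij
    have := mul_left_cancel hij
    rw [eq_inv_iff_mul_eq_one, div_mul_eq_mul_div, div_eq_one] at this
    rw [← this, neg_one_mul, neg_neg]

/-- The trace relation along the chain. -/
theorem IsQuotMap.exists_trace_eq_chain (h : ρ.IsQuotMap φ) (hfin : Finite ρ.imageB)
    (hx1 : τ ^ 2 * x ^ 2 = 1) (hτ : τ ^ 2 = u ^ κ) (he : e = u ^ (κ + c))
    (hs : (chain u x e c : Set ℂˣ) ⊆ supp φ) (ht : τ ^ 2 ≠ 1) {i : ℕ} (hi0 : 0 < i) (hi : i < c) :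
    ∃ (ζ : ℂ) (M : ℕ), 0 < M ∧ ζ ^ M = 1 ∧
      ζ + ζ⁻¹ = 2 + (u : ℂ) ^ (κ + 2 * i) + ((u : ℂ) ^ (κ + 2 * i))⁻¹ -
        (u : ℂ) ^ κ - ((u : ℂ) ^ κ)⁻¹ := by
  have m1 : x / u ^ i ∈ supp φ := hs (Finset.mem_coe.mpr (mem_chain.mpr ⟨i, hi, Or.inl rfl⟩))
  have m2 : (x / u ^ i)⁻¹ ∈ supp φ := by
    rw [div_pow_reflect hx1 hτ he hi.le]
    exact hs (Finset.mem_coe.mpr (mem_chain.mpr ⟨c - i, by omega, Or.inr rfl⟩))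
  obtain ⟨ζ, M, hM, hζ, hrel⟩ := h.exists_trace_eq hfin m1 m2 (h.sq_ne_one_of_finite hfin ht m1)
  refine ⟨ζ, M, hM, hζ, ?_⟩
  have e1 : (((x / u ^ i : ℂˣ)) : ℂ) ^ 2 = ((u : ℂ) ^ (κ + 2 * i))⁻¹ := by
    rw [← Units.val_pow_eq_pow_val, div_pow_sq hx1 hτ]; push_cast; rfl
  have e2 : (τ : ℂ) ^ 2 = (u : ℂ) ^ κ := by
    rw [← Units.val_pow_eq_pow_val, hτ]; push_cast; rfl
  rw [hrel, e1, e2, inv_inv]; ring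

/-- The main criterion for infinite image. -/
theorem IsQuotMap.re_lt_of_finite (h : ρ.IsQuotMap φ) (hfin : Finite ρ.imageB)
    (hx1 : τ ^ 2 * x ^ 2 = 1) (hτ : τ ^ 2 = u ^ κ) (he : e = u ^ (κ + c))
    (hs : (chain u x e c : Set ℂˣ) ⊆ supp φ) {N P : ℕ} (hN : IsPrimitiveRoot (u ^ 2) N)
    (hP0 : 0 < P) (hP : IsPrimitiveRoot u P) (hc : (N : ℤ) ∣ κ + c) (hcN : c ≤ N)
    (ht : ¬ (P : ℤ) ∣ κ) {i : ℕ} (hi0 : 0 < i) (hi : i < c) {y : ℂ} (hy : IsPrimitiveRoot y P) :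
    (y ^ (κ + 2 * i)).re < (y ^ κ).re := by
  obtain ⟨ζ, M, hM, hζ, hrel⟩ := h.exists_trace_eq_chain hfin hx1 hτ he hs
    (by rwa [hτ, Ne, hP.zpow_eq_one_iff_dvd]) hi0 hi
  have hPc : IsPrimitiveRoot (u : ℂ) P := hP.map_of_injective (f := Units.coeHom ℂ)
    Units.val_injective
  have key : ∀ k : ℤ, (P : ℤ) ∣ 2 * k → (N : ℤ) ∣ k := fun k hk => by
    rwa [← zpow_two_mul_eq_one_iff hN, hP.zpow_eq_one_iff_dvd]
  -- Equality would mean `u^(2i) = 1` or `u^(2κ+2i) = 1`, hence `N ∣ i` or `N ∣ c - i`, impossible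
  -- for `0 < i < c ≤ N`.
  refine re_zpow_lt_of_trace_eq hP0 hM hPc hζ hrel ?_ ?_ hy
  · intro hd
    have := key i (by rwa [add_sub_cancel_left] at hd)
    have := Int.le_of_dvd (by omega) this
    omega
  · intro hd
    have h1 := key (κ + i) (by convert hd using 1; ring)
    have h2 := dvd_sub hc h1
    have := Int.le_of_dvd (by omega) h2
    omega

theorem IsQuotMap.not_finite_of_gcd (h : ρ.IsQuotMap φ)
    (hx1 : τ ^ 2 * x ^ 2 = 1) (hτ : τ ^ 2 = u ^ κ) (he : e = u ^ (κ + c))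
    (hs : (chain u x e c : Set ℂˣ) ⊆ supp φ) {N P : ℕ} (hN : IsPrimitiveRoot (u ^ 2) N)
    (hP0 : 0 < P) (hP : IsPrimitiveRoot u P) (hc : (N : ℤ) ∣ κ + c) (hcN : c ≤ N)
    (ht : ¬ (P : ℤ) ∣ κ) {i : ℕ} (hi0 : 0 < i) (hi : i < c)
    (hd : (Int.gcd (κ + 2 * i) P : ℤ) ∣ κ) : ¬ Finite ρ.imageB := fun hfin => by
  obtain ⟨y, hy, hle⟩ := exists_primitiveRoot_re_le hP0 hd ht
  exact absurd (h.re_lt_of_finite hfin hx1 hτ he hs hN hP0 hP hc hcN ht hi0 hi hy) hle.not_gt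

/-- The case when the chain passes through `±1`. -/
theorem IsQuotMap.not_finite_of_singular (h : ρ.IsQuotMap φ)
    (hx1 : τ ^ 2 * x ^ 2 = 1) (hτ : τ ^ 2 = u ^ κ) (ht : τ ^ 2 ≠ 1) (hs : ∀ i < c, x / u ^ i ∈ supp φ)
    {i : ℕ} (hi : i < c) (hi2 : κ + 2 * i = 0) : ¬ Finite ρ.imageB := fun hfin => by
  refine h.sq_ne_one_of_finite hfin ht (hs i hi) ?_
  rw [div_pow_sq hx1 hτ, hi2]; simp

end

end Rep
end DAHA

namespace DAHA

/-! ### Chains from the defining Laurent polynomials -/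

theorem ev_symPoly (x : ℂˣ) (m : ℕ) (c : ℂ) :
    ev x (symPoly m c) = (x : ℂ) ^ m + ((x : ℂ) ^ m)⁻¹ - c := by
  simp only [symPoly, map_add, map_sub, ev_mono, ev_C]
  push_cast; simp

theorem pow_eq_one_of_ev_symPoly {x : ℂˣ} {m : ℕ} (h : ev x (symPoly m 2) = 0) : x ^ m = 1 := by
  rw [ev_symPoly] at h
  have h0 : (x : ℂ) ^ m ≠ 0 := pow_ne_zero _ x.ne_zero
  have : ((x : ℂ) ^ m - 1) ^ 2 = 0 := by
    field_simp at h
    linear_combination h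
  refine Units.ext ?_
  push_cast
  linear_combination pow_eq_zero_iff (two_ne_zero) |>.mp this

theorem pow_eq_neg_one_of_ev_symPoly {x : ℂˣ} {m : ℕ} (h : ev x (symPoly m 0) = 0) :
    (x ^ 2) ^ m = -1 := by
  rw [ev_symPoly] at h
  have h0 : (x : ℂ) ^ m ≠ 0 := pow_ne_zero _ x.ne_zero
  field_simp at h
  refine Units.ext ?_
  push_cast
  rw [← pow_mul, mul_comm, pow_mul]
  linear_combination h

theorem pow_eq_neg_one {N : ℕ} {u : ℂˣ} (hN : 0 < N) (hu : IsPrimitiveRoot u (2 * N)) :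
    u ^ N = -1 := by
  have h1 : ((u ^ N : ℂˣ) : ℂ) * ((u ^ N : ℂˣ) : ℂ) = 1 := by
    rw [← Units.val_mul, ← pow_add, ← two_mul, hu.pow_eq_one, Units.val_one]
  rcases mul_self_eq_one_iff.mp h1 with h | h
  · have := Nat.le_of_dvd hN (hu.dvd_of_pow_eq_one N (Units.ext h))
    omega
  · exact Units.ext h

variable {u τ : ℂˣ} {V : Type*} [AddCommGroup V] [Module ℂ V]
namespace Rep
variable {ρ : Rep u τ V} {φ : PolySpace →ₗ[ℂ] V} {N c : ℕ} {κ : ℤ}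

theorem IsQuotMap.exists_chain [FiniteDimensional ℂ V] (h : ρ.IsQuotMap φ)
    (hirr : ρ.IsIrreducible) (hN0 : 0 < N) (hN : IsPrimitiveRoot (u ^ 2) N) (hτ : τ ^ 2 = u ^ κ)
    (hc : (N : ℤ) ∣ κ + c) (hcN : c ≤ N) (hroot : ∀ x ∈ supp φ, (u ^ κ * x ^ 2) ^ N = 1) :
    ∃ x, τ ^ 2 * x ^ 2 = 1 ∧ ∀ i < c, x / u ^ i ∈ supp φ := by
  have := hirr.1
  obtain ⟨y, hy⟩ := h.supp_nonempty
  obtain ⟨x, hx, hx1⟩ := h.exists_blocked hy hN0 hN (by rw [hτ]; exact hroot y hy)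
  exact ⟨x, hx1, h.supp_chain hx hx1 hN hτ hc hcN⟩

/-- The chain in the support of a quotient of `𝒳 / (X^{2N} + X^{-2N} - 2)` or
`𝒳 / (X^N + X^{-N})`. -/
theorem IsQuotMap.exists_chain_of_isPrimitiveRoot (h : ρ.IsQuotMap φ) (hirr : ρ.IsIrreducible)
    (hN0 : 0 < N) (hu : IsPrimitiveRoot u (2 * N)) (hτ : τ ^ 2 = u ^ κ)
    (hc : (N : ℤ) ∣ κ + c) (hcN : c ≤ N)
    (hf : (Even κ ∧ φ (symPoly (2 * N) 2) = 0) ∨ (Odd κ ∧ φ (symPoly N 0) = 0)) :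
    ∃ x, τ ^ 2 * x ^ 2 = 1 ∧ ∀ i < c, x / u ^ i ∈ supp φ := by
  have hN : IsPrimitiveRoot (u ^ 2) N := hu.pow (by omega) rfl
  have hneg := pow_eq_neg_one hN0 hu
  -- This sign matches `x^(2N) = 1` for even `κ` and `x^(2N) = -1` for odd `κ`, the conditions
  -- imposed by the two polynomials, so that `(τ² x²)^N = 1` in both cases.
  have hpow : (u ^ κ) ^ N = (-1) ^ κ := by
    rw [← zpow_natCast, zpow_comm, zpow_natCast, hneg]
  rcases hf with ⟨hκ, hf⟩ | ⟨hκ, hf⟩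
  · have := h.finiteDimensional (by omega) hf
    refine h.exists_chain hirr hN0 hN hτ hc hcN fun x hx => ?_
    have := pow_eq_one_of_ev_symPoly (hx _ hf)
    rw [mul_pow, hpow, hκ.neg_one_zpow, ← pow_mul, this, one_mul]
  · have := h.finiteDimensional hN0 hf
    refine h.exists_chain hirr hN0 hN hτ hc hcN fun x hx => ?_
    have := pow_eq_neg_one_of_ev_symPoly (hx _ hf)
    rw [mul_pow, hpow, hκ.neg_one_zpow, this, neg_one_mul, neg_neg]

theorem isPrimitiveRoot_sq_of_odd (hodd : Odd N) (hu : IsPrimitiveRoot u N) :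
    IsPrimitiveRoot (u ^ 2) N :=
  hu.pow_of_coprime 2 (Nat.coprime_two_left.mpr hodd)

/-- The chain in the support of a quotient of `𝒳 / (X^N + X^{-N} - 2)` when `q^{1/2}` has odd
order `N`. -/
theorem IsQuotMap.exists_chain_of_odd (h : ρ.IsQuotMap φ) (hirr : ρ.IsIrreducible)
    (hodd : Odd N) (hu : IsPrimitiveRoot u N) (hτ : τ ^ 2 = u ^ κ)
    (hc : (N : ℤ) ∣ κ + c) (hcN : c ≤ N) (hf : φ (symPoly N 2) = 0) :
    ∃ x, τ ^ 2 * x ^ 2 = 1 ∧ ∀ i < c, x / u ^ i ∈ supp φ := by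
  have := h.finiteDimensional hodd.pos hf
  refine h.exists_chain hirr hodd.pos (isPrimitiveRoot_sq_of_odd hodd hu) hτ hc hcN fun x hx => ?_
  have := pow_eq_one_of_ev_symPoly (hx _ hf)
  rw [mul_pow, ← pow_mul, mul_comm 2, pow_mul, this, one_pow, mul_one, ← zpow_natCast, zpow_comm,
    zpow_natCast, hu.pow_eq_one, one_zpow]

/-! ### Perfect modules for `0 < k < N / 2` -/

section alpha
variable {x : ℂˣ}

theorem pow_inj_of_isPrimitiveRoot (hu : IsPrimitiveRoot u (2 * N)) (hcN : c ≤ N) (i j : ℕ)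
    (hi : i < c) (hj : j < c) (h : u ^ i = u ^ j) : i = j :=
  hu.pow_inj (by omega) (by omega) h

theorem pow_ne_neg_of_isPrimitiveRoot (hN0 : 0 < N) (hu : IsPrimitiveRoot u (2 * N)) (hcN : c ≤ N)
    (i j : ℕ) (hi : i < c) (hj : j < c) : u ^ i ≠ -u ^ j := fun h => by
  rw [← neg_one_mul, ← pow_eq_neg_one hN0 hu, ← pow_add] at h
  have := hu.pow_inj (by omega) (by omega) h
  omega

theorem zpow_eq_neg_one (hN0 : 0 < N) (hu : IsPrimitiveRoot u (2 * N))
    (hc : κ + c = N) : (-1 : ℂˣ) = u ^ (κ + c) := by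
  rw [hc, zpow_natCast, pow_eq_neg_one hN0 hu]

/-- Type `(α)`: the kernel of the quotient map. -/
theorem IsQuotMap.alpha_ker (h : ρ.IsQuotMap φ) (hirr : ρ.IsIrreducible)
    (hN0 : 0 < N) (hu : IsPrimitiveRoot u (2 * N)) (hτ : τ ^ 2 = u ^ κ) (hκ : 0 < κ)
    (hc0 : 0 < c) (hc : κ + c = N) (hx1 : τ ^ 2 * x ^ 2 = 1) (hs : ∀ i < c, x / u ^ i ∈ supp φ)
    (f : PolySpace) : φ f = 0 ↔ ∀ y ∈ chain u x (-1) c, ev y f = 0 := by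
  have he := zpow_eq_neg_one hN0 hu hc
  refine h.map_eq_zero_iff hirr (isClosedSet_chain hx1 hτ he (by simp) fun i hi => ?_) ?_
    (h.chain_subset hx1 hτ he hs) f
  · rw [Ne, hu.zpow_eq_one_iff_dvd]
    intro hd
    have := Int.le_of_dvd (by omega) hd
    push_cast at this
    omega
  · exact ⟨x, Finset.mem_coe.mpr (mem_chain.mpr ⟨0, hc0, Or.inl (by simp)⟩)⟩

theorem IsQuotMap.alpha_finrank (h : ρ.IsQuotMap φ) (hirr : ρ.IsIrreducible)
    (hN0 : 0 < N) (hu : IsPrimitiveRoot u (2 * N)) (hτ : τ ^ 2 = u ^ κ) (hκ : 0 < κ)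
    (hc0 : 0 < c) (hc : κ + c = N) (hx1 : τ ^ 2 * x ^ 2 = 1) (hs : ∀ i < c, x / u ^ i ∈ supp φ) :
    Module.finrank ℂ V = 2 * c := by
  rw [finrank_eq_card h.surj _ (h.alpha_ker hirr hN0 hu hτ hκ hc0 hc hx1 hs)]
  exact card_chain_neg_one (pow_inj_of_isPrimitiveRoot hu (by omega))
    (pow_ne_neg_of_isPrimitiveRoot hN0 hu (by omega)) x

theorem IsQuotMap.alpha_not_finite_of_gcd (h : ρ.IsQuotMap φ)
    (hN0 : 0 < N) (hu : IsPrimitiveRoot u (2 * N)) (hτ : τ ^ 2 = u ^ κ) (hκ : 0 < κ)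
    (hc0 : 0 < c) (hc : κ + c = N) (hx1 : τ ^ 2 * x ^ 2 = 1) (hs : ∀ i < c, x / u ^ i ∈ supp φ)
    {i : ℕ} (hi0 : 0 < i) (hi : i < c) (hd : (Int.gcd (κ + 2 * i) (2 * N : ℕ) : ℤ) ∣ κ) :
    ¬ Finite ρ.imageB := by
  have he := zpow_eq_neg_one hN0 hu hc
  refine h.not_finite_of_gcd hx1 hτ he (h.chain_subset hx1 hτ he hs)
    (hu.pow (by omega) rfl) (by omega) hu (by rw [hc]) (by omega) ?_ hi0 hi hd
  intro hd
  have := Int.le_of_dvd (by omega) hd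
  push_cast at this
  omega

theorem dvd_two_of_dvd_four {g : ℕ} {b : ℤ} (h4 : g ∣ 8) (hb : (g : ℤ) ∣ b) (hb4 : ¬ 4 ∣ b) :
    g ∣ 2 := by
  have := Nat.le_of_dvd (by norm_num) h4
  interval_cases g <;> revert h4 hb <;> norm_num <;> omega

/-- With `θ = 2π / (2r + 1)` the difference of the two sides is `(2 cos θ - 1)(cos θ + 1)`,
nonnegative once `θ ≤ π/3`. The inequality fails for `r = 1, 2`, which correspond to the exceptional
`N = 6, 10`. -/
theorem cos_special {r : ℕ} (hr : 3 ≤ r) :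
    -Real.cos (2 * (2 * Real.pi / (2 * r + 1))) ≤ Real.cos (2 * Real.pi / (2 * r + 1)) := by
  have hr' : (3 : ℝ) ≤ r := by exact_mod_cast hr
  have : 1 / 2 ≤ Real.cos (2 * Real.pi / (2 * r + 1)) := by
    rw [← Real.cos_pi_div_three]
    apply Real.cos_le_cos_of_nonneg_of_le_pi
    · positivity
    · linarith [Real.pi_pos]
    · rw [div_le_div_iff₀ (by positivity) (by norm_num)]
      nlinarith [Real.pi_pos]
  rw [Real.cos_two_mul]
  nlinarith

/-- For `N = 4r + 2`, `κ = N - 4` and `i = 1` the exponents are `κ = 4r - 2` and `κ + 2i = 4r`. The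
conjugate `w^(2r-1)` of `w = exp(2πi / 2N)` brings their angles to `2θ + π` and `θ`, where `θ = 2π /
(2r + 1)`. -/
theorem exists_primitiveRoot_special {r : ℕ} (hr : 3 ≤ r) :
    ∃ y : ℂ, IsPrimitiveRoot y (2 * (4 * r + 2)) ∧
      (y ^ (4 * r - 2 : ℤ)).re ≤ (y ^ (4 * r : ℤ)).re := by
  have hP : 2 * (4 * r + 2) ≠ 0 := by omega
  have hw := Complex.isPrimitiveRoot_exp _ hP
  have hcop : Nat.Coprime (2 * r - 1) (2 * (4 * r + 2)) := by
    have h1 : Nat.Coprime (2 * r - 1) (2 * r + 1) := by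
      have : 2 * r + 1 = (2 * r - 1) + 2 := by omega
      rw [this, Nat.coprime_self_add_right, Nat.coprime_two_right]
      exact ⟨r - 1, by omega⟩
    have h2 : Nat.Coprime (2 * r - 1) 2 := by
      rw [Nat.coprime_two_right]; exact ⟨r - 1, by omega⟩
    rw [show 2 * (4 * r + 2) = 2 * (2 * (2 * r + 1)) by ring]
    exact h2.mul_right (h2.mul_right h1)
  refine ⟨_, hw.pow_of_coprime _ hcop, ?_⟩
  rw [← zpow_natCast, ← zpow_mul, ← zpow_mul, exp_zpow_re, exp_zpow_re]
  have hj : ((2 * r - 1 : ℕ) : ℤ) = 2 * r - 1 := by omega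
  rw [hj]
  have e1 : 2 * Real.pi * (((2 * r - 1) * (4 * r - 2) : ℤ) : ℝ) / ((2 * (4 * r + 2) : ℕ) : ℝ) =
      2 * (2 * Real.pi / (2 * r + 1)) + Real.pi + ((r - 2 : ℤ) : ℝ) * (2 * Real.pi) := by
    push_cast; field_simp; ring
  have e2 : 2 * Real.pi * (((2 * r - 1) * (4 * r) : ℤ) : ℝ) / ((2 * (4 * r + 2) : ℕ) : ℝ) =
      2 * Real.pi / (2 * r + 1) + ((r - 1 : ℤ) : ℝ) * (2 * Real.pi) := by
    push_cast; field_simp; ring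
  rw [e1, e2, Real.cos_add_int_mul_two_pi, Real.cos_add_int_mul_two_pi, Real.cos_add_pi]
  exact cos_special hr

/-- An index `i` near `c / 2` makes `κ + 2i` equal to `N - 1`, `N - 2` or `N - 4`, whose gcd with
`2N` is small enough to divide `κ`. This fails to provide an index only for `c = 4`, `N ≡ 2 mod 4`.
-/
theorem IsQuotMap.alpha_not_finite (h : ρ.IsQuotMap φ)
    (hN0 : 0 < N) (hu : IsPrimitiveRoot u (2 * N)) (hτ : τ ^ 2 = u ^ κ) (hκ : 0 < κ)
    (hc0 : 2 < c) (hc : κ + c = N) (hx1 : τ ^ 2 * x ^ 2 = 1) (hs : ∀ i < c, x / u ^ i ∈ supp φ)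
    (hexc : ¬ (c = 4 ∧ (N = 6 ∨ N = 10))) : ¬ Finite ρ.imageB := by
  have main : ∀ i : ℕ, 0 < i → i < c → (Int.gcd (κ + 2 * i) (2 * N : ℕ) : ℤ) ∣ κ →
      ¬ Finite ρ.imageB := fun i h1 h2 h3 =>
    h.alpha_not_finite_of_gcd hN0 hu hτ hκ (by omega) hc hx1 hs h1 h2 h3
  -- the gcd divides `2` and, for odd `κ`, is `1`
  have crit : ∀ i : ℕ, 0 < i → i < c → (Int.gcd (κ + 2 * i) (2 * N : ℕ)) ∣ 8 →
      ¬ (4 ∣ κ + 2 * i) → ¬ Finite ρ.imageB := fun i h1 h2 h3 h4 => by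
    refine main i h1 h2 ?_
    have hb : (Int.gcd (κ + 2 * i) (2 * N : ℕ) : ℤ) ∣ κ + 2 * i := Int.gcd_dvd_left _ _
    have h5 := dvd_two_of_dvd_four h3 hb h4
    rcases (Nat.dvd_prime Nat.prime_two).mp h5 with h6 | h6 <;> rw [h6] at hb ⊢
    · simp
    · push_cast at hb ⊢; omega
  -- The gcd divides `2N - 2(κ + 2i) = 2(c - 2i)`, which is `2`, `4` or `8` for the indices used
  -- below.
  have g8 : ∀ i : ℕ, ∀ k : ℤ, k ∣ 8 → 2 * (N : ℤ) - 2 * (κ + 2 * i) = k →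
      (Int.gcd (κ + 2 * i) (2 * N : ℕ)) ∣ 8 := fun i k hk he => by
    have h1 : (Int.gcd (κ + 2 * i) (2 * N : ℕ) : ℤ) ∣ κ + 2 * i := Int.gcd_dvd_left _ _
    have h2 : (Int.gcd (κ + 2 * i) (2 * N : ℕ) : ℤ) ∣ (2 * N : ℕ) := Int.gcd_dvd_right _ _
    have h3 : (Int.gcd (κ + 2 * i) (2 * N : ℕ) : ℤ) ∣ 8 := by
      refine dvd_trans ?_ hk
      rw [← he]
      push_cast at h2
      exact dvd_sub h2 (dvd_mul_of_dvd_right h1 2)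
    exact_mod_cast h3
  rcases Nat.even_or_odd' c with ⟨n, hn | hn⟩
  · by_cases h4 : (4 : ℤ) ∣ N - 2
    · by_cases hn2 : n = 2
      · -- `N ≡ 2 mod 4`, `κ = N - 4`
        obtain ⟨r, hr⟩ : ∃ r : ℕ, N = 4 * r + 2 := ⟨(N - 2) / 4, by omega⟩
        intro hfin
        obtain ⟨y, hy, hle⟩ := exists_primitiveRoot_special (r := r) (by omega)
        have he := zpow_eq_neg_one hN0 hu hc
        have := h.re_lt_of_finite hfin hx1 hτ he (h.chain_subset hx1 hτ he hs)
          (hu.pow (by omega) rfl) (by omega) hu (by rw [hc]) (by omega)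
          (fun hd => by
            have := Int.le_of_dvd (by omega) hd
            push_cast at this
            omega) one_pos (by omega) (hr ▸ hy)
        rw [show κ = 4 * r - 2 by omega] at this
        rw [show (4 * r - 2 + 2 * ((1 : ℕ) : ℤ) : ℤ) = 4 * r by push_cast; ring] at this
        exact absurd this hle.not_gt
      -- Here `κ + 2i = N - 4`, which is `2` modulo `4`.
      · exact crit (n - 2) (by omega) (by omega) (g8 _ 8 (by norm_num) (by omega)) (by omega)
    · exact crit (n - 1) (by omega) (by omega) (g8 _ 4 (by norm_num) (by omega)) (by omega)
  · by_cases h4 : (4 : ℤ) ∣ N - 1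
    -- `κ + 2i = N - 1` may be divisible by `4`, but its gcd with `2N` divides `2`, and `κ = N - c`
    -- is even.
    · refine main n (by omega) (by omega) ?_
      have h1 : (Int.gcd (κ + 2 * n) (2 * N : ℕ) : ℤ) ∣ κ + 2 * n := Int.gcd_dvd_left _ _
      have h2 : (Int.gcd (κ + 2 * n) (2 * N : ℕ) : ℤ) ∣ (2 * N : ℕ) := Int.gcd_dvd_right _ _
      have h3 : (Int.gcd (κ + 2 * n) (2 * N : ℕ) : ℤ) ∣ 2 := by
        push_cast at h2
        have h5 := dvd_sub h2 (dvd_mul_of_dvd_right h1 2)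
        rwa [show 2 * (N : ℤ) - 2 * (κ + 2 * n) = 2 by omega] at h5
      exact h3.trans (by omega)
    · exact crit n (by omega) (by omega) (g8 _ 2 (by norm_num) (by omega)) (by omega)

end alpha
end Rep
end DAHA

namespace DAHA
variable {u τ : ℂˣ} {V : Type*} [AddCommGroup V] [Module ℂ V]
namespace Rep
variable {ρ : Rep u τ V} {φ : PolySpace →ₗ[ℂ] V} {N P c : ℕ} {κ : ℤ} {x : ℂˣ}

/-! ### Perfect modules supported on a single chain -/

theorem IsQuotMap.single_finrank (h : ρ.IsQuotMap φ) (hirr : ρ.IsIrreducible)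
    (hu : IsPrimitiveRoot u P) (hτ : τ ^ 2 = u ^ κ)
    (hc0 : 0 < c) (hcP : c ≤ P) (he : 1 = u ^ (κ + c)) (hx1 : τ ^ 2 * x ^ 2 = 1)
    (hs : ∀ i < c, x / u ^ i ∈ supp φ) (hsing : ∀ i < c, ¬ (P : ℤ) ∣ κ + 2 * i) :
    Module.finrank ℂ V = c := by
  rw [finrank_eq_card h.surj (chain u x 1 c) (h.map_eq_zero_iff hirr
    (isClosedSet_chain hx1 hτ he (by simp) fun i hi => ?_) ?_ (h.chain_subset hx1 hτ he hs))]
  · exact card_chain_one (fun i j hi hj hij => hu.pow_inj (by omega) (by omega) hij) x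
  · exact ⟨x, Finset.mem_coe.mpr (mem_chain.mpr ⟨0, hc0, Or.inl (by simp)⟩)⟩
  · rw [Ne, hu.zpow_eq_one_iff_dvd]; exact hsing i hi

/-- Type `(γ)`. -/
theorem IsQuotMap.gamma (h : ρ.IsQuotMap φ) (hirr : ρ.IsIrreducible) (hN0 : 0 < N)
    (hu : IsPrimitiveRoot u (2 * N)) (hτ : τ ^ 2 = u ^ κ) (hκ0 : κ < 0) (hκN : -N < κ)
    (hκ : Odd κ) (hf : φ (symPoly N 0) = 0) :
    Finite ρ.imageB ↔ Module.finrank ℂ V = 1 := by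
  obtain ⟨c, hc⟩ : ∃ c : ℕ, κ + c = 0 := ⟨(-κ).toNat, by omega⟩
  have hN : IsPrimitiveRoot (u ^ 2) N := hu.pow (by omega) rfl
  obtain ⟨x, hx1, hs⟩ := h.exists_chain_of_isPrimitiveRoot hirr hN0 hu hτ (c := c) (by simp [hc])
    (by omega) (Or.inr ⟨hκ, hf⟩)
  have he : 1 = u ^ (κ + c) := by rw [hc, zpow_zero]
  have hodd : ∀ k : ℤ, ¬ ((2 * N : ℕ) : ℤ) ∣ κ + 2 * k := fun k hd => by
    have h2 : (2 : ℤ) ∣ κ + 2 * k := dvd_trans ⟨N, by push_cast; ring⟩ hd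
    obtain ⟨l, hl⟩ := hκ
    omega
  have hrank : Module.finrank ℂ V = c :=
    h.single_finrank hirr hu hτ (by omega) (by omega) he hx1 hs fun i _ => hodd i
  refine ⟨fun hfin => ?_, finite_imageB_of_finrank_eq_one hirr (by omega) hu.pow_eq_one⟩
  by_contra hne
  obtain ⟨l, hl⟩ := hκ
  -- `c = -κ` is odd and greater than `1`, so the middle index gives `κ + 2i = 1`, with trivial gcd.
  refine h.not_finite_of_gcd hx1 hτ he (h.chain_subset hx1 hτ he hs) hN (by omega) hu
    (by simp [hc]) (by omega) (by simpa using hodd 0) (i := (c + 1) / 2) (by omega) (by omega) ?_ hfin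
  rw [show κ + 2 * (((c + 1) / 2 : ℕ) : ℤ) = 1 by omega]
  simp

/-- Type `(β)`. -/
theorem IsQuotMap.beta (h : ρ.IsQuotMap φ) (hirr : ρ.IsIrreducible) (hN0 : 0 < N)
    (hu : IsPrimitiveRoot u (2 * N)) (hτ : τ ^ 2 = u ^ κ) (hκ0 : κ < 0) (hκN : -N < κ)
    (hκ : Even κ) (hf : φ (symPoly (2 * N) 2) = 0) : ¬ Finite ρ.imageB := by
  obtain ⟨n, hn⟩ := hκ
  obtain ⟨x, hx1, hs⟩ := h.exists_chain_of_isPrimitiveRoot hirr hN0 hu hτ (c := (-κ).toNat)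
    (by rw [Int.toNat_of_nonneg (by omega)]; simp) (by omega) (Or.inl ⟨⟨n, hn⟩, hf⟩)
  -- With `κ = 2n`, the index `i = -n` is the middle of the chain, where `κ + 2i = 0` and the point
  -- is `±1`.
  refine h.not_finite_of_singular hx1 hτ ?_ hs (i := (-n).toNat) (by omega) (by omega)
  rw [hτ, Ne, hu.zpow_eq_one_iff_dvd, ← dvd_neg]
  intro hd
  have := Int.le_of_dvd (by omega) hd
  push_cast at this
  omega

/-! ### Odd order of `q^{1/2}` -/

/-- Types `(α^✓)` with integral `k` and `(γ^✓)`. -/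
theorem IsQuotMap.check_pos (h : ρ.IsQuotMap φ) (hirr : ρ.IsIrreducible) (hodd : Odd N)
    (hu : IsPrimitiveRoot u N) (hτ : τ ^ 2 = u ^ κ) (hκ0 : 0 < κ) (hκN : κ < N)
    (hκ : Even κ) (hf : φ (symPoly N 2) = 0) :
    Finite ρ.imageB ↔ Module.finrank ℂ V = 1 := by
  obtain ⟨c, hc⟩ : ∃ c : ℕ, κ + c = N := ⟨(N - κ).toNat, by omega⟩
  have hN := isPrimitiveRoot_sq_of_odd hodd hu
  obtain ⟨x, hx1, hs⟩ := h.exists_chain_of_odd hirr hodd hu hτ (c := c) (by simp [hc])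
    (by omega) hf
  have he : 1 = u ^ (κ + c) := by rw [hc, zpow_natCast, hu.pow_eq_one]
  obtain ⟨n, hn⟩ := hκ
  obtain ⟨l, hl⟩ := hodd
  have hcop : IsCoprime (N : ℤ) 2 := ⟨1, -l, by rw [hl]; push_cast; ring⟩
  have hrank : Module.finrank ℂ V = c := by
    refine h.single_finrank hirr hu hτ (by omega) (by omega) he hx1 hs fun i hi hd => ?_
    rw [show κ + 2 * (i : ℤ) = 2 * (n + i) by omega] at hd
    have := Int.le_of_dvd (by omega) (hcop.dvd_of_dvd_mul_left hd)
    omega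
  refine ⟨fun hfin => ?_, finite_imageB_of_finrank_eq_one hirr (by omega) hu.pow_eq_one⟩
  by_contra hne
  -- `c = N - κ` is odd, so this index gives `κ + 2i = N + 1`, coprime to `N`.
  refine h.not_finite_of_gcd hx1 hτ he (h.chain_subset hx1 hτ he hs) hN (by omega) hu
    (by simp [hc]) (by omega) (fun hd => by have := Int.le_of_dvd (by omega) hd; omega)
    (i := (c + 1) / 2) (by omega) (by omega) ?_ hfin
  rw [show κ + 2 * (((c + 1) / 2 : ℕ) : ℤ) = N + 1 by omega]
  simp

/-- The chain of a module of type `(β^✓)` passes through `±1`. -/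
theorem IsQuotMap.not_finite_of_blocked (h : ρ.IsQuotMap φ) (hodd : Odd N)
    (hu : IsPrimitiveRoot u N) (hτ : τ ^ 2 = u ^ κ) (hκ0 : κ < 0) (hκN : -N < κ)
    (hκ : Even κ) (hx : x ∈ supp φ) (hx1 : τ ^ 2 * x ^ 2 = 1) : ¬ Finite ρ.imageB := by
  obtain ⟨n, hn⟩ := hκ
  have hs := h.supp_chain hx hx1 (isPrimitiveRoot_sq_of_odd hodd hu) hτ (c := (-κ).toNat)
    (by rw [Int.toNat_of_nonneg (by omega)]; simp) (by omega)
  refine h.not_finite_of_singular hx1 hτ ?_ hs (i := (-n).toNat) (by omega) (by omega)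
  rw [hτ, Ne, hu.zpow_eq_one_iff_dvd, ← dvd_neg]
  intro hd
  have := Int.le_of_dvd (by omega) hd
  omega

/-- Type `(β^✓)`. -/
theorem IsQuotMap.check_neg (h : ρ.IsQuotMap φ) (hirr : ρ.IsIrreducible) (hodd : Odd N)
    (hu : IsPrimitiveRoot u N) (hτ : τ ^ 2 = u ^ κ) (hκ0 : κ < 0) (hκN : -N < κ)
    (hκ : Even κ) (hf : φ (symPoly N 2) = 0) : ¬ Finite ρ.imageB := by
  obtain ⟨x, hx1, hs⟩ := h.exists_chain_of_odd hirr hodd hu hτ (c := (-κ).toNat)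
    (by rw [Int.toNat_of_nonneg (by omega)]; simp) (by omega) hf
  refine h.not_finite_of_blocked hodd hu hτ hκ0 hκN hκ (x := x) ?_ hx1
  simpa using hs 0 (by omega)

/-- Any point of the circle can be rotated by an `N`-th root of unity into the sector of angle
`π / N` around `1`. -/
theorem exists_zpow_mul_re_ge {N : ℕ} (hN : 0 < N) {a : ℂ} (ha : ‖a‖ = 1) :
    ∃ m : ℤ, Real.cos (Real.pi / N) ≤
      (Complex.exp (2 * Real.pi * Complex.I / N) ^ m * a).re := by
  have hN' : (0 : ℝ) < N := by exact_mod_cast hN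
  set θ := Complex.arg a
  set m := round (-(θ * N / (2 * Real.pi)))
  have hm : |-(θ * N / (2 * Real.pi)) - m| ≤ 1 / 2 := abs_sub_round _
  refine ⟨m, ?_⟩
  have e : (Complex.exp (2 * Real.pi * Complex.I / N) ^ m * a) =
      Complex.exp (((2 * Real.pi * m / N + θ : ℝ) : ℂ) * Complex.I) := by
    rw [← Complex.exp_int_mul]
    have : a = Complex.exp (θ * Complex.I) := by
      have := Complex.norm_mul_exp_arg_mul_I a
      rw [ha] at this; simpa using this.symm
    nth_rewrite 1 [this]
    rw [← Complex.exp_add]; congr 1; push_cast; ring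
  rw [e, Complex.exp_ofReal_mul_I_re, ← Real.cos_abs (2 * Real.pi * m / N + θ)]
  apply Real.cos_le_cos_of_nonneg_of_le_pi (abs_nonneg _)
  · exact div_le_self Real.pi_pos.le (by exact_mod_cast hN)
  · have : 2 * Real.pi * m / N + θ = -((2 * Real.pi) / N * (-(θ * N / (2 * Real.pi)) - m)) := by
      have := Real.pi_pos; field_simp; ring
    rw [this, abs_neg, abs_mul, abs_of_pos (by positivity)]
    calc _ ≤ 2 * Real.pi / N * (1 / 2) := by gcongr
      _ = _ := by ring

/-- Finite-dimensional quotients of `𝒳` when `q^{1/2}` has odd order and `t = q^{κ/2}` with `κ`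
negative and even. -/
theorem IsQuotMap.not_finite_of_neg_even [FiniteDimensional ℂ V] (h : ρ.IsQuotMap φ)
    (hirr : ρ.IsIrreducible) (hodd : Odd N)
    (hu : IsPrimitiveRoot u N) (hτ : τ ^ 2 = u ^ κ) (hκ0 : κ < 0) (hκN : -N < κ)
    (hκ : Even κ) : ¬ Finite ρ.imageB := by
  have := hirr.1
  obtain ⟨z, hz⟩ := h.supp_nonempty
  by_cases hb : ∃ y ∈ supp φ, τ ^ 2 * y ^ 2 = 1
  · obtain ⟨y, hy, hy1⟩ := hb
    exact h.not_finite_of_blocked hodd hu hτ hκ0 hκN hκ hy hy1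
  have hall := (h.exists_blocked_or hz).resolve_left hb
  push Not at hb
  intro hfin
  have hN0 := hodd.pos
  have hκd : ¬ (N : ℤ) ∣ κ := fun hd => by
    have := Int.le_of_dvd (by omega) ((dvd_neg).mpr hd)
    omega
  have ht : τ ^ 2 ≠ 1 := by rwa [hτ, Ne, hu.zpow_eq_one_iff_dvd]
  obtain ⟨M, hM, hzM⟩ := h.supp_pow_eq_one hfin hz
  have hzn : ‖((z : ℂ)) ^ 2‖ = 1 := by
    have : (z : ℂ) ^ M = 1 := by rw [← Units.val_pow_eq_pow_val, hzM, Units.val_one]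
    rw [norm_pow, Complex.norm_eq_one_of_pow_eq_one this hM.ne', one_pow]
  -- The squares of the points `uⁱ z` run through a full coset of the `N`-th roots of unity, so one
  -- of them lies within the angle `π / N` of `1`. But `τ²` is a nontrivial `N`-th root of unity, at
  -- angle at least `2π / N`, against `Re y² ≤ Re τ²`.
  obtain ⟨m, hm⟩ := exists_zpow_mul_re_ge hN0 hzn
  have hw := Complex.isPrimitiveRoot_exp N hN0.ne'
  set w := Complex.exp (2 * Real.pi * Complex.I / N)
  have : NeZero N := ⟨hN0.ne'⟩
  have hu2 : IsPrimitiveRoot (((u ^ 2 : ℂˣ) : ℂ)) N :=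
    (isPrimitiveRoot_sq_of_odd hodd hu).map_of_injective (f := Units.coeHom ℂ) Units.val_injective
  have hroot : ∀ k : ℤ, (w ^ k) ^ N = 1 := fun k => by
    rw [← zpow_natCast, zpow_comm, zpow_natCast, hw.pow_eq_one, one_zpow]
  obtain ⟨i, -, hi⟩ := hu2.eq_pow_of_pow_eq_one (hroot m)
  have hx := hall i
  set y := u ^ i * z with hy
  have hy2 : (y : ℂ) ^ 2 = w ^ m * (z : ℂ) ^ 2 := by
    rw [← hi, hy]; push_cast; ring
  obtain ⟨ζ, M', hM', hζ, hrel⟩ := h.exists_trace_eq hfin hx (h.supp_inv hx (hb _ hx))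
    (h.sq_ne_one_of_finite hfin ht hx)
  have hwn : ‖w‖ = 1 := hw.norm'_eq_one hN0.ne'
  have huc : IsPrimitiveRoot (u : ℂ) N :=
    hu.map_of_injective (f := Units.coeHom ℂ) Units.val_injective
  obtain ⟨j, -, hj⟩ := hw.eq_pow_of_pow_eq_one (ξ := (u : ℂ) ^ κ) (by
    rw [← zpow_natCast, zpow_comm, zpow_natCast, huc.pow_eq_one, one_zpow])
  have hτc : (τ : ℂ) ^ 2 = w ^ (j : ℤ) := by
    rw [zpow_natCast, hj, ← Units.val_pow_eq_pow_val, hτ]; push_cast; rfl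
  have hle := re_le_of_trace_eq (a := (y : ℂ) ^ 2) (t := (τ : ℂ) ^ 2) (ζ := ζ)
    (by rw [hy2, norm_mul, norm_zpow, hwn, one_zpow, hzn, one_mul])
    (by rw [hτc, norm_zpow, hwn, one_zpow])
    (Complex.norm_eq_one_of_pow_eq_one hζ hM'.ne') hrel
  rw [hy2, hτc, exp_zpow_re] at hle
  have h1 := cos_two_pi_mul_div_le (Q := N) (k := j) (fun hd => by
    refine hκd ((huc.zpow_eq_one_iff_dvd _).mp ?_)
    rw [← hj, ← zpow_natCast, (hw.zpow_eq_one_iff_dvd _).mpr hd])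
  have hN1 : 1 < N := by omega
  have h2 : Real.cos (2 * Real.pi / N) < Real.cos (Real.pi / N) := by
    have hN' : (2 : ℝ) ≤ N := by exact_mod_cast hN1
    apply Real.cos_lt_cos_of_nonneg_of_le_pi
    · positivity
    · rw [div_le_iff₀ (by positivity)]; nlinarith [Real.pi_pos]
    · gcongr; linarith [Real.pi_pos]
  linarith

/-! ### No two-dimensional quotients -/

theorem finrank_le_of_ker_le [FiniteDimensional ℂ V] (hφ : Function.Surjective φ) {W : Type*}
    [AddCommGroup W] [Module ℂ W] {E : PolySpace →ₗ[ℂ] W} (hE : Function.Surjective E)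
    (hker : ∀ f, φ f = 0 → E f = 0) : Module.finrank ℂ W ≤ Module.finrank ℂ V := by
  have hker' : LinearMap.ker φ ≤ LinearMap.ker E := hker
  let g : V →ₗ[ℂ] W :=
    ((LinearMap.ker φ).liftQ E hker') ∘ₗ (φ.quotKerEquivOfSurjective hφ).symm.toLinearMap
  have hg : Function.Surjective g := by
    intro r
    obtain ⟨f, rfl⟩ := hE r
    refine ⟨φ f, ?_⟩
    have : (φ.quotKerEquivOfSurjective hφ).symm (φ f) = Submodule.Quotient.mk f := by
      rw [LinearEquiv.symm_apply_eq]; rfl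
    simp [g, this]
  exact LinearMap.finrank_le_finrank_of_surjective hg

theorem card_le_finrank [FiniteDimensional ℂ V] (hφ : Function.Surjective φ) {s : Finset ℂˣ}
    (hs : ∀ x ∈ s, x ∈ supp φ) : s.card ≤ Module.finrank ℂ V := by
  have := finrank_le_of_ker_le hφ (E := LinearMap.pi fun x : s => (ev x.1).toLinearMap)
    (fun r => by
      classical
      obtain ⟨f, hf⟩ := exists_ev_eq s fun x => if hx : x ∈ s then r ⟨x, hx⟩ else 0
      refine ⟨f, funext fun x => ?_⟩
      have := hf x.1 x.2
      rw [dif_pos x.2] at this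
      exact this) fun f hf => funext fun x => hs x.1 x.2 f hf
  simpa using this

theorem three_le_finrank [FiniteDimensional ℂ V] (hφ : Function.Surjective φ) {x y : ℂˣ}
    (hx : x ∈ supp φ) (hy : y ∈ supp φ) (hxy : x ≠ y) (hd : ∀ f, φ f = 0 → der x f = 0) :
    3 ≤ Module.finrank ℂ V := by
  have hE : Function.Surjective (LinearMap.pi ![(ev x).toLinearMap, (ev y).toLinearMap, der x] :
      PolySpace →ₗ[ℂ] (Fin 3 → ℂ)) := fun r => by
    have h1 : (x : ℂ) - y ≠ 0 := sub_ne_zero.mpr fun h => hxy (Units.ext h)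
    have h1' : (y : ℂ) - x ≠ 0 := sub_ne_zero.mpr fun h => hxy (Units.ext h.symm)
    have h0 : (x : ℂ) ≠ 0 := x.ne_zero
    -- Hermite interpolation in Newton form: the polynomial is `r 0 + b (X - x) + c (X - x)(X - y)`.
    set b := (r 1 - r 0) / (y - x)
    have hb : b * (y - x) = r 1 - r 0 := div_mul_cancel₀ _ h1'
    set c := (r 2 - b * x) / (x * (x - y))
    have hc : c * (x * (x - y)) = r 2 - b * x := div_mul_cancel₀ _ (mul_ne_zero h0 h1)
    have hm : ∀ z : ℂˣ, ((z ^ (2 : ℤ) : ℂˣ) : ℂ) = (z : ℂ) ^ 2 := fun z => by norm_cast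
    refine ⟨(r 0 - b * x + c * (x * y)) • mono 0 + (b - c * (x + y)) • mono 1 + c • mono 2, ?_⟩
    ext i
    fin_cases i
    · simp only [LinearMap.pi_apply]
      change ev x _ = r 0
      simp only [map_add, map_smul, ev_mono, hm, zpow_zero, zpow_one, smul_eq_mul, Units.val_one]
      ring
    · simp only [LinearMap.pi_apply]
      change ev y _ = r 1
      simp only [map_add, map_smul, ev_mono, hm, zpow_zero, zpow_one, smul_eq_mul, Units.val_one]
      linear_combination hb
    · simp only [LinearMap.pi_apply]
      change der x _ = r 2
      simp only [map_add, map_smul, der_mono, hm, zpow_zero, zpow_one, smul_eq_mul]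
      push_cast
      linear_combination hc
  have := finrank_le_of_ker_le hφ hE fun f hf => by
    ext i
    fin_cases i
    exacts [hx f hf, hy f hf, hd f hf]
  simpa using this

/-- There is no two-dimensional irreducible quotient when `t q = q⁻¹`, `q ≠ ±1`. -/
theorem IsQuotMap.finrank_ne_two (h : ρ.IsQuotMap φ)
    (hu : u ^ 2 ≠ 1) (hτ : τ ^ 2 * u ^ 2 = 1) : Module.finrank ℂ V ≠ 2 := fun hrank => by
  have : FiniteDimensional ℂ V := Module.finite_of_finrank_pos (by omega)
  have : Nontrivial V := Module.nontrivial_of_finrank_pos (R := ℂ) (by omega)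
  have hu1 : u ≠ 1 := by rintro rfl; simp at hu
  have ht : τ ^ 2 ≠ 1 := fun h1 => hu (by rwa [h1, one_mul] at hτ)
  obtain ⟨x, hx⟩ := h.supp_nonempty
  -- no point of the support has square `1`
  have hsq : ∀ y ∈ supp φ, y ^ 2 ≠ 1 := fun y hy hy1 => by
    have := three_le_finrank h.surj hy (h.supp_pi hy) (fun he => hu1 (by
      rw [eq_div_iff_mul_eq', ← sq, hy1] at he; exact he.symm)) fun f hf => h.der_eq_zero hy hy1 ht hf
    omega
  -- As `τ² u² = 1`, a blocked `y` has `y² = u²`, so its partner `u / y` would have square `1`.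
  have hbl : ∀ y ∈ supp φ, τ ^ 2 * y ^ 2 ≠ 1 := fun y hy hy1 => by
    refine hsq _ (h.supp_pi hy) ?_
    rw [div_pow, mul_left_cancel (hτ.trans hy1.symm), div_self']
  have hthree : ∀ a b c : ℂˣ, a ∈ supp φ → b ∈ supp φ → c ∈ supp φ → a ≠ b → a ≠ c → b ≠ c →
      False := fun a b c ha hb hc hab hac hbc => by
    classical
    have := card_le_finrank h.surj (s := {a, b, c}) (by
      intro y hy
      simp only [Finset.mem_insert, Finset.mem_singleton] at hy
      rcases hy with rfl | rfl | rfl <;> assumption)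
    rw [Finset.card_eq_three.mpr ⟨a, b, c, hab, hac, hbc, rfl⟩] at this
    omega
  have hinv := h.supp_inv hx (hbl x hx)
  have hup := h.supp_up hx (hbl x hx)
  have hdown := h.supp_down hx (hbl _ (h.supp_pi hx))
  have hne : x ≠ x⁻¹ := fun he => hsq x hx (by
    rw [sq]; nth_rewrite 2 [he]; rw [mul_inv_cancel])
  -- With nothing blocked, `x`, `x⁻¹`, `u x` and `x / u` all lie in the support, and at least three
  -- of them are distinct.
  by_cases he : x⁻¹ = u * x
  · refine hthree x x⁻¹ (x / u) hx hinv hdown hne (fun h1 => hu1 ?_) fun h1 => hu ?_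
    · rw [eq_comm, div_eq_self] at h1; exact h1
    · rw [he, eq_div_iff_mul_eq', mul_right_comm, mul_eq_right, ← sq] at h1
      exact h1
  · refine hthree x x⁻¹ (u * x) hx hinv hup hne (fun h1 => hu1 ?_) he
    rw [eq_comm, mul_eq_right] at h1; exact h1

end Rep
end DAHA

namespace DAHA
variable {u τ : ℂˣ} {V : Type*} [AddCommGroup V] [Module ℂ V]
namespace Rep
variable {ρ : Rep u τ V} {φ : PolySpace →ₗ[ℂ] V} {N : ℕ} {κ : ℤ} {x : ℂˣ}

/-! ### Monomial modules -/

/-- The multiples of the images of the elements of `G` by `M`-th roots of unity. -/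
def rootMultiples (φ : PolySpace →ₗ[ℂ] V) (M : ℕ) (G : Set PolySpace) : Set V :=
  {v | ∃ ζ : ℂ, ζ ^ M = 1 ∧ ∃ g ∈ G, v = ζ • φ g}

theorem smul_mem_rootMultiples {M : ℕ} {G : Set PolySpace} {ζ : ℂ} (hζ : ζ ^ M = 1) {v : V}
    (hv : v ∈ rootMultiples φ M G) : ζ • v ∈ rootMultiples φ M G := by
  obtain ⟨ξ, hξ, g, hg, rfl⟩ := hv
  exact ⟨ζ * ξ, by rw [mul_pow, hζ, hξ, one_mul], g, hg, smul_smul _ _ _⟩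

/-- The images of `G` need not be independent: irreducibility makes the finite invariant set of
their root-of-unity multiples span `V`. -/
theorem IsQuotMap.finite_of_rootMultiples (h : ρ.IsQuotMap φ) (hirr : ρ.IsIrreducible) {M : ℕ}
    (hM : 0 < M) (huM : (u : ℂ) ^ M = 1) {G : Set PolySpace} (hG : G.Finite)
    {g₀ : PolySpace} (hg₀ : g₀ ∈ G) (hne : φ g₀ ≠ 0)
    (hX : ∀ g ∈ G, φ (mono 1 * g) ∈ rootMultiples φ M G)
    (hπ : ∀ g ∈ G, φ (piOp u g) ∈ rootMultiples φ M G)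
    (hT : ∀ g ∈ G, φ (heckeOp τ g) ∈ rootMultiples φ M G) : Finite ρ.imageB := by
  have hT' : ∀ v ∈ rootMultiples φ M G, (ρ.T : Module.End ℂ V) v ∈ rootMultiples φ M G := by
    rintro _ ⟨ζ, hζ, g, hg, rfl⟩
    rw [map_smul, ← h.mapT]
    exact smul_mem_rootMultiples hζ (hT g hg)
  refine finite_imageB_of_mapsTo hirr (F := rootMultiples φ M G) ?_
    ⟨1, one_pow _, g₀, hg₀, (one_smul _ _).symm⟩ hne ?_ ?_ hT' fun v =>
      smul_mem_rootMultiples huM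
  · have hf : {ζ : ℂ | ζ ^ M = 1}.Finite := by
      refine (Polynomial.nthRoots M (1 : ℂ)).toFinset.finite_toSet.subset fun ζ hζ => ?_
      simpa [Polynomial.mem_nthRoots hM] using hζ
    refine ((hf.prod hG).image fun p => p.1 • φ p.2).subset ?_
    rintro _ ⟨ζ, hζ, g, hg, rfl⟩
    exact ⟨(ζ, g), ⟨hζ, hg⟩, rfl⟩
  · rintro _ ⟨ζ, hζ, g, hg, rfl⟩
    rw [map_smul, ← h.mapX]
    exact smul_mem_rootMultiples hζ (hX g hg)
  · intro v hv
    obtain ⟨ζ, hζ, g, hg, hv'⟩ := hT' v hv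
    have hY : (ρ.Y : Module.End ℂ V) v = ζ • φ (piOp u g) := by
      obtain ⟨p, rfl⟩ := h.surj v
      rw [← h.mapT] at hv'
      rw [← h.mapY, ← map_smul, ← map_smul]
      rw [← map_smul, ← sub_eq_zero, ← map_sub] at hv'
      have := h.ker_pi hv'
      rwa [map_sub, map_sub, sub_eq_zero] at this
    rw [hY]
    exact smul_mem_rootMultiples hζ (hπ g hg)

theorem IsQuotMap.map_one_ne_zero (h : ρ.IsQuotMap φ) (hirr : ρ.IsIrreducible) : φ 1 ≠ 0 :=
  fun h0 => by
    have := hirr.1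
    obtain ⟨v, hv⟩ := exists_ne (0 : V)
    obtain ⟨p, rfl⟩ := h.surj v
    refine hv ?_
    rw [← mul_one p]; exact h.map_mul_eq_zero h0 p

theorem heckeOp_eq_smul_refl (hτ : τ ^ 2 = 1) : heckeOp τ = (τ : ℂ) • refl := by
  have : τ⁻¹ = τ := by rw [inv_eq_iff_mul_eq_one, ← sq, hτ]
  rw [heckeOp, this, sub_self, zero_smul, add_zero]

theorem IsQuotMap.finite_of_mono_periodic (h : ρ.IsQuotMap φ) (hirr : ρ.IsIrreducible) {L M : ℕ}
    (hL : 0 < L) (hM : 0 < M) (hu : u ^ M = 1) (hτ : τ ^ 2 = 1) (hf : φ (mono L - 1) = 0) :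
    Finite ρ.imageB := by
  have huM : (u : ℂ) ^ (2 * M) = 1 := by
    rw [← Units.val_pow_eq_pow_val, mul_comm, pow_mul, hu, one_pow, Units.val_one]
  have hper : ∀ n : ℤ, φ (mono (n + L)) = φ (mono n) := fun n => by
    have := h.map_mul_eq_zero hf (mono n)
    rwa [mul_sub, mono_mul, mul_one, map_sub, sub_eq_zero] at this
  have hper' : ∀ (n k : ℤ), φ (mono (n + k * L)) = φ (mono n) := fun n k => by
    induction k using Int.induction_on with
    | zero => simp
    | succ i ih => rw [← ih, ← hper (n + i * L)]; congr 2; ring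
    | pred i ih => rw [← ih, ← hper]; congr 2; ring
  let G : Set PolySpace := (fun n : ℤ => mono n) '' Set.Ico 0 L
  have hmem : ∀ n : ℤ, φ (mono n) ∈ rootMultiples φ (2 * M) G := fun n => by
    refine ⟨1, one_pow _, mono (n % L), ⟨n % L, ⟨Int.emod_nonneg _ (by omega),
      Int.emod_lt_of_pos _ (by omega)⟩, rfl⟩, ?_⟩
    rw [one_smul, ← hper' (n % L) (n / L), mul_comm, Int.emod_add_mul_ediv]
  -- The order `2M` accommodates both `u^M = 1` and `τ² = 1`.
  refine h.finite_of_rootMultiples hirr (M := 2 * M) (by omega) huM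
    ((Set.finite_Ico 0 (L : ℤ)).image _) (g₀ := 1)
    ⟨0, ⟨le_rfl, by omega⟩, LaurentPolynomial.T_zero⟩ (h.map_one_ne_zero hirr) ?_ ?_ ?_
  · rintro _ ⟨n, -, rfl⟩
    rw [mono_mul]; exact hmem _
  · rintro _ ⟨n, -, rfl⟩
    rw [piOp_mono, map_smul]
    refine smul_mem_rootMultiples ?_ (hmem _)
    push_cast
    rw [← zpow_natCast, zpow_comm, zpow_natCast, huM, one_zpow]
  · rintro _ ⟨n, -, rfl⟩
    rw [heckeOp_eq_smul_refl hτ, LinearMap.smul_apply, refl_mono, map_smul]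
    refine smul_mem_rootMultiples ?_ (hmem _)
    rw [← Units.val_pow_eq_pow_val, pow_mul, hτ, one_pow, Units.val_one]

/-- Type `(α•)`. -/
theorem IsQuotMap.finite_alpha_boundary (h : ρ.IsQuotMap φ) (hirr : ρ.IsIrreducible) (hN : 0 < N)
    {M : ℕ} (hM : 0 < M) (hu : u ^ M = 1) (hτ : τ ^ 2 = 1) (hf : φ (mono N - mono (-N)) = 0) :
    Finite ρ.imageB := by
  refine h.finite_of_mono_periodic hirr (L := 2 * N) (by omega) hM hu hτ ?_
  have := h.map_mul_eq_zero hf (mono N)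
  rw [mul_sub, mono_mul, mono_mul, add_neg_cancel] at this
  rw [← this]; congr 2
  congr 1; push_cast; ring

/-- `X^N + X^{-N} - 2 = X^{-N} (X^N - 1)²`, so `X^N - 1` acts nilpotently on `V`. Since `T = τ s`
and `u^N = 1`, both `T` and `π` carry `X^N - 1` to `X^{-N} - 1`, an associate; hence its kernel is a
submodule and irreducibility removes the square. -/
theorem IsQuotMap.mono_sub_one_eq_zero (h : ρ.IsQuotMap φ) (hirr : ρ.IsIrreducible)
    (hu : u ^ N = 1) (hτ : τ ^ 2 = 1) (hf : φ (symPoly N 2) = 0) : φ (mono N - 1) = 0 := by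
  by_contra hne
  let K : Submodule ℂ PolySpace :=
    LinearMap.ker (φ ∘ₗ LinearMap.mulLeft ℂ (mono N - 1))
  have memK : ∀ p, p ∈ K ↔ φ ((mono N - 1) * p) = 0 := fun p => Iff.rfl
  have key : ∀ p ∈ K, φ ((mono (-N) - 1) * p) = 0 := fun p hp => by
    have := h.map_mul_eq_zero ((memK p).mp hp) (-mono (-N))
    rw [← this]; congr 1
    have e : mono (-N) * mono N = 1 := by rw [mono_mul]; simp
    linear_combination p * e
  have hX : ∀ (m : ℤ), ∀ p ∈ K, mulX m p ∈ K := fun m p hp => by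
    rw [memK, mulX, LinearMap.mulLeft_apply, mul_left_comm]
    exact h.map_mul_eq_zero hp _
  have hπ : ∀ p ∈ K, piOp u p ∈ K := fun p hp => by
    have e : (mono N - 1) * piOp u p = piOp u ((mono (-N) - 1) * p) := by
      have := LinearMap.congr_fun (piOp_mulX u (-N)) p
      simp only [Module.End.mul_apply, LinearMap.smul_apply, mulX, LinearMap.mulLeft_apply,
        neg_neg] at this
      rw [sub_mul, sub_mul, map_sub, this, zpow_neg, zpow_natCast, hu]; simp
    rw [memK, e]
    exact h.ker_pi (key p hp)
  have hT : ∀ p ∈ K, heckeOp τ p ∈ K := fun p hp => by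
    have e : (mono N - 1) * heckeOp τ p = heckeOp τ ((mono (-N) - 1) * p) := by
      rw [heckeOp_eq_smul_refl hτ, LinearMap.smul_apply, LinearMap.smul_apply, refl_mul, map_sub,
        refl_mono, neg_neg, refl_one, mul_smul_comm]
    rw [memK, e]
    exact h.ker_T (key p hp)
  rcases h.map_eq_bot_or_eq_top hirr K (hX 1) (hX (-1)) hπ hT with hW | hW
  · refine hne ?_
    rw [← Submodule.mem_bot (R := ℂ), ← hW]
    refine Submodule.mem_map_of_mem ((memK _).mpr ?_)
    have := h.map_mul_eq_zero hf (mono N)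
    rw [← this]; congr 1
    have e : mono N * mono (-N) = 1 := by rw [mono_mul]; simp
    have e2 : (LaurentPolynomial.C (2 : ℂ) : PolySpace) = 2 := map_ofNat _ 2
    rw [symPoly, e2]
    linear_combination -e
  · obtain ⟨p, hp, hp1⟩ : φ 1 ∈ K.map φ := hW ▸ Submodule.mem_top
    refine hne ?_
    have h1 := h.map_mul_eq_zero (f := 1 - p) (by rw [map_sub, hp1, sub_self]) (mono N - 1)
    rwa [mul_sub, mul_one, map_sub, (memK p).mp hp, sub_zero] at h1

/-! ### Modules of type `(α)` and dimension `2`, `4` -/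

section alpha

theorem ev_heckeOp_of_blocked {y : ℂˣ} (hy : τ ^ 2 * y ^ 2 = 1) (hy1 : y ^ 2 ≠ 1)
    (f : PolySpace) : ev y (heckeOp τ f) = τ * ev y f := by
  have h1 := ev_heckeOp_mul τ y f
  have e1 : (τ : ℂ) ^ 2 * (y : ℂ) ^ 2 = 1 := by
    have := congrArg Units.val hy; push_cast at this; exact this
  have e2 : (τ : ℂ) * ((τ⁻¹ : ℂˣ) : ℂ) = 1 := by simp
  refine mul_left_cancel₀ (sub_ne_zero.mpr fun e => hy1 (Units.ext (by push_cast; exact e)) :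
    (y : ℂ) ^ 2 - 1 ≠ 0) ?_
  have r : (τ : ℂ) * (y : ℂ) ^ 2 = ((τ⁻¹ : ℂˣ) : ℂ) := by
    linear_combination ((τ⁻¹ : ℂˣ) : ℂ) * e1 - (τ : ℂ) * y ^ 2 * e2
  linear_combination h1 + (ev y⁻¹ f - ev y f) * r

theorem ev_heckeOp_of_sq_eq_neg_one {y : ℂˣ} (hy : y ^ 2 = -1) (f : PolySpace) :
    2 * ev y (heckeOp τ f) = ((τ : ℂ) + ((τ⁻¹ : ℂˣ) : ℂ)) * ev (-y) f +
      ((τ : ℂ) - ((τ⁻¹ : ℂˣ) : ℂ)) * ev y f := by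
  have h1 := ev_heckeOp_mul τ y f
  have hi : y⁻¹ = -y := by rw [inv_eq_iff_mul_eq_one, mul_neg, ← sq, hy, neg_neg]
  have e1 : (y : ℂ) ^ 2 = -1 := by
    have := congrArg Units.val hy; push_cast at this; exact this
  rw [hi, e1] at h1
  linear_combination -h1

/-- The support is `{x, -x}`, both points blocked, so `T` is the scalar `τ`. In the spanning set `1,
X`, with `X² = -u`, the operators `X` and `π` are monomial. -/
theorem IsQuotMap.alpha_finite_two (h : ρ.IsQuotMap φ) (hirr : ρ.IsIrreducible) (hN0 : 0 < N)
    (hu : IsPrimitiveRoot u (2 * N)) (hτ : τ ^ 2 = u ^ κ) (hκ : 0 < κ) (hc : κ + 1 = N)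
    (hx1 : τ ^ 2 * x ^ 2 = 1) (hs : ∀ i < 1, x / u ^ i ∈ supp φ) : Finite ρ.imageB := by
  have hker := h.alpha_ker hirr hN0 hu hτ hκ one_pos hc hx1 hs
  have hneg := pow_eq_neg_one hN0 hu
  have hut : τ ^ 2 * u = -1 := by
    rw [hτ, ← zpow_add_one, hc, zpow_natCast, hneg]
  have hch : ∀ y ∈ chain u x (-1) 1, τ ^ 2 * y ^ 2 = 1 ∧ y ^ 2 ≠ 1 ∧ (y : ℂ) ^ 2 = -u := by
    intro y hy
    have hy1 : τ ^ 2 * y ^ 2 = 1 := by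
      obtain ⟨i, hi, rfl | rfl⟩ := mem_chain.mp hy <;> obtain rfl : i = 0 := by omega
      · simpa using hx1
      · simpa using hx1
    have hy2 : y ^ 2 = -u := mul_left_cancel (hy1.trans (by rw [mul_neg, hut, neg_neg]))
    refine ⟨hy1, fun h1 => ?_, ?_⟩
    · rw [h1, mul_one, hτ, hu.zpow_eq_one_iff_dvd] at hy1
      have := Int.le_of_dvd hκ hy1
      push_cast at this; omega
    · have := congrArg Units.val hy2; push_cast at this; exact this
  have heq : ∀ f g, (∀ y ∈ chain u x (-1) 1, ev y f = ev y g) → φ f = φ g := fun f g hfg => by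
    rw [← sub_eq_zero, ← map_sub, hker]
    intro y hy
    rw [map_sub, hfg y hy, sub_self]
  have huM : (u : ℂ) ^ (4 * N) = 1 := by
    rw [← Units.val_pow_eq_pow_val, show 4 * N = 2 * N * 2 by ring, pow_mul, hu.pow_eq_one,
      one_pow, Units.val_one]
  have hτM : (τ : ℂ) ^ (4 * N) = 1 := by
    rw [← Units.val_pow_eq_pow_val, show 4 * N = 2 * (2 * N) by ring, pow_mul, hτ, ← zpow_natCast,
      zpow_comm, zpow_natCast, hu.pow_eq_one, one_zpow, Units.val_one]
  have hnM : (-1 : ℂ) ^ (4 * N) = 1 := by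
    rw [show 4 * N = 2 * (2 * N) by ring, pow_mul]; simp
  refine h.finite_of_rootMultiples hirr (M := 4 * N) (by omega) huM (G := {1, mono 1})
    (by simp) (g₀ := 1) (by simp) (h.map_one_ne_zero hirr) ?_ ?_ ?_
  · rintro g (rfl | rfl)
    · exact ⟨1, one_pow _, mono 1, by simp, by simp⟩
    · refine ⟨-u, by rw [neg_pow, hnM, huM, one_mul], 1, by simp, ?_⟩
      rw [← map_smul]
      refine heq _ _ fun y hy => ?_
      rw [map_mul, map_smul, map_one, ev_mono, zpow_one, ← sq, (hch y hy).2.2, smul_eq_mul, mul_one]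
  · rintro g (rfl | rfl)
    · refine ⟨1, one_pow _, 1, by simp, ?_⟩
      rw [one_smul]
      exact heq _ _ fun y hy => by rw [ev_piOp, map_one, map_one]
    · refine ⟨-1, hnM, mono 1, by simp, ?_⟩
      rw [← map_smul]
      refine heq _ _ fun y hy => ?_
      have h2 := (hch y hy).2.2
      rw [ev_piOp, map_smul, ev_mono, ev_mono, zpow_one, zpow_one, Units.val_div_eq_div_val,
        div_eq_iff y.ne_zero, smul_eq_mul]
      linear_combination h2
  · intro g hg
    refine ⟨τ, hτM, g, hg, ?_⟩
    rw [← map_smul]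
    refine heq _ _ fun y hy => ?_
    rw [ev_heckeOp_of_blocked (hch y hy).1 (hch y hy).2.1, map_smul, smul_eq_mul]

theorem IsQuotMap.alpha_finite_four (h : ρ.IsQuotMap φ) (hirr : ρ.IsIrreducible) (hN0 : 0 < N)
    (hu : IsPrimitiveRoot u (2 * N)) (hτ : τ ^ 2 = u ^ κ) (hκ : 0 < κ) (hc : κ + 2 = N)
    (hx1 : τ ^ 2 * x ^ 2 = 1) (hs : ∀ i < 2, x / u ^ i ∈ supp φ) : Finite ρ.imageB := by
  have hker := h.alpha_ker hirr hN0 hu hτ hκ two_pos hc hx1 hs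
  have hneg := pow_eq_neg_one hN0 hu
  have hut : τ ^ 2 * u ^ 2 = -1 := by
    rw [hτ, ← zpow_natCast, ← zpow_add]
    push_cast
    rw [hc, zpow_natCast, hneg]
  have hu1 : (1 : ℂ) - (u : ℂ) ^ 2 ≠ 0 := fun e => by
    have h1 : u ^ 2 = 1 := Units.ext (by push_cast; linear_combination -e)
    have := Nat.le_of_dvd two_pos (hu.dvd_of_pow_eq_one 2 h1)
    omega
  -- the two values of `y ^ 2` on the support
  have hch : ∀ y ∈ chain u x (-1) 2, (τ ^ 2 * y ^ 2 = 1 ∧ y ^ 2 ≠ 1 ∧ (y : ℂ) ^ 2 = -u ^ 2) ∨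
      (y ^ 2 = -1 ∧ (y : ℂ) ^ 2 = -1) := by
    intro y hy
    have hx2 : x ^ 2 = -u ^ 2 := mul_left_cancel (hx1.trans (by rw [mul_neg, hut, neg_neg]))
    have hcase : y ^ 2 = x ^ 2 ∨ y ^ 2 = -1 := by
      obtain ⟨i, hi, rfl | rfl⟩ := mem_chain.mp hy <;>
        rcases (by omega : i = 0 ∨ i = 1) with rfl | rfl
      · left; simp
      · right; rw [div_pow, hx2, pow_one, neg_div, div_self']
      · left; simp
      · right; rw [neg_one_mul, neg_sq, div_pow, hx2, pow_one, neg_div, div_self']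
    rcases hcase with hy2 | hy2
    · refine Or.inl ⟨by rw [hy2, hx1], fun h1 => ?_, ?_⟩
      · rw [← hy2, h1, mul_one, hτ, hu.zpow_eq_one_iff_dvd] at hx1
        have := Int.le_of_dvd hκ hx1
        push_cast at this; omega
      · have := congrArg Units.val (hy2.trans hx2); push_cast at this; exact this
    · refine Or.inr ⟨hy2, ?_⟩
      have := congrArg Units.val hy2; push_cast at this; exact this
  have heq : ∀ f g, (∀ y ∈ chain u x (-1) 2, ev y f = ev y g) → φ f = φ g := fun f g hfg => by
    rw [← sub_eq_zero, ← map_sub, hker]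
    intro y hy
    rw [map_sub, hfg y hy, sub_self]
  have huM : (u : ℂ) ^ (4 * N) = 1 := by
    rw [← Units.val_pow_eq_pow_val, show 4 * N = 2 * N * 2 by ring, pow_mul, hu.pow_eq_one,
      one_pow, Units.val_one]
  have hτM : (τ : ℂ) ^ (4 * N) = 1 := by
    rw [← Units.val_pow_eq_pow_val, show 4 * N = 2 * (2 * N) by ring, pow_mul, hτ, ← zpow_natCast,
      zpow_comm, zpow_natCast, hu.pow_eq_one, one_zpow, Units.val_one]
  have hnM : (-1 : ℂ) ^ (4 * N) = 1 := by
    rw [show 4 * N = 2 * (2 * N) by ring, pow_mul]; simp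
  have hτi : (((τ⁻¹ : ℂˣ) : ℂ)) ^ (4 * N) = 1 := by
    rw [Units.val_inv_eq_inv_val, inv_pow, hτM, inv_one]
  -- The squares of support points are `-u²` and `-1`. `g₁` vanishes where `y² = -1`, `g₂` where `y²
  -- = -u²`; `π` exchanges the two classes up to sign, and `T` is diagonal on `g₁, X g₁, g₂, X g₂`,
  -- with eigenvalue `-τ⁻¹` on the last.
  set g₁ : PolySpace := mono 2 + 1 with hg₁
  set g₂ : PolySpace := mono 2 + LaurentPolynomial.C ((u : ℂ) ^ 2) with hg₂
  have hm : ∀ z : ℂˣ, ev z (mono 2) = (z : ℂ) ^ 2 := fun z => by rw [ev_mono]; norm_cast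
  have hm1 : ∀ z : ℂˣ, ev z (mono 1) = (z : ℂ) := fun z => by rw [ev_mono, zpow_one]
  have e₁ : ∀ z : ℂˣ, ev z g₁ = (z : ℂ) ^ 2 + 1 := fun z => by rw [hg₁, map_add, hm, map_one]
  have e₂ : ∀ z : ℂˣ, ev z g₂ = (z : ℂ) ^ 2 + (u : ℂ) ^ 2 := fun z => by
    rw [hg₂, map_add, hm, ev_C]
  have u0 : (u : ℂ) ≠ 0 := u.ne_zero
  have hyi : ∀ y : ℂˣ, (y : ℂ) ≠ 0 := fun y => y.ne_zero
  have hz : ∀ y ∈ chain u x (-1) 2, ((y : ℂ) ^ 2 + 1) * ((y : ℂ) ^ 2 + (u : ℂ) ^ 2) = 0 := by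
    intro y hy
    rcases hch y hy with ⟨-, -, h2⟩ | ⟨-, h2⟩ <;> rw [h2] <;> ring
  refine h.finite_of_rootMultiples hirr (M := 4 * N) (by omega) huM
    (G := {g₁, mono 1 * g₁, g₂, mono 1 * g₂})
    (by simp) (g₀ := g₁) (by simp) (fun h0 => ?_) ?_ ?_ ?_
  · have h1 := (hker g₁).mp h0 x (mem_chain.mpr ⟨0, two_pos, Or.inl (by simp)⟩)
    rw [e₁] at h1
    have hx2 : x ^ 2 = -u ^ 2 := mul_left_cancel (hx1.trans (by rw [mul_neg, hut, neg_neg]))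
    have hx2' := congrArg Units.val hx2
    push_cast at hx2'
    exact hu1 (by linear_combination h1 - hx2')
  · rintro g (rfl | rfl | rfl | rfl)
    · exact ⟨1, one_pow _, mono 1 * g₁, by simp, by simp⟩
    · refine ⟨-u ^ 2, by rw [neg_pow, hnM, ← pow_mul, mul_comm 2, pow_mul, huM, one_pow, one_mul],
        g₁, by simp, ?_⟩
      rw [← map_smul]
      refine heq _ _ fun y hy => ?_
      simp only [map_mul, map_smul, e₁, hm1, smul_eq_mul]
      linear_combination hz y hy
    · exact ⟨1, one_pow _, mono 1 * g₂, by simp, by simp⟩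
    · refine ⟨-1, hnM, g₂, by simp, ?_⟩
      rw [← map_smul]
      refine heq _ _ fun y hy => ?_
      simp only [map_mul, map_smul, e₂, hm1, smul_eq_mul]
      linear_combination hz y hy
  · have hd : ∀ y : ℂˣ, ((u / y : ℂˣ) : ℂ) = (u : ℂ) / y := fun y => Units.val_div_eq_div_val _ _
    rintro g (rfl | rfl | rfl | rfl)
    · refine ⟨-1, hnM, g₂, by simp, ?_⟩
      rw [← map_smul]
      refine heq _ _ fun y hy => ?_
      have := hyi y
      rw [ev_piOp, map_smul, e₁, e₂, hd, smul_eq_mul]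
      field_simp
      linear_combination hz y hy
    · refine ⟨u, huM, mono 1 * g₂, by simp, ?_⟩
      rw [← map_smul]
      refine heq _ _ fun y hy => ?_
      have := hyi y
      rw [ev_piOp, map_smul, map_mul, map_mul, e₁, e₂, hm1, hm1, hd, smul_eq_mul]
      field_simp
      linear_combination (1 - (y : ℂ) ^ 2) * hz y hy
    · refine ⟨-1, hnM, g₁, by simp, ?_⟩
      rw [← map_smul]
      refine heq _ _ fun y hy => ?_
      have := hyi y
      rw [ev_piOp, map_smul, e₁, e₂, hd, smul_eq_mul]
      field_simp
      linear_combination hz y hy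
    · refine ⟨(u : ℂ)⁻¹, by rw [inv_pow, huM, inv_one], mono 1 * g₁, by simp, ?_⟩
      rw [← map_smul]
      refine heq _ _ fun y hy => ?_
      have := hyi y
      rw [ev_piOp, map_smul, map_mul, map_mul, e₁, e₂, hm1, hm1, hd, smul_eq_mul]
      field_simp
      linear_combination ((u : ℂ) ^ 2 - (y : ℂ) ^ 2) * hz y hy
  · have hn : ∀ y : ℂˣ, ((-y : ℂˣ) : ℂ) = -(y : ℂ) := fun y => Units.val_neg _
    rintro g (rfl | rfl | rfl | rfl)
    · refine ⟨τ, hτM, g₁, by simp, ?_⟩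
      rw [← map_smul]
      refine heq _ _ fun y hy => ?_
      rw [map_smul, smul_eq_mul]
      rcases hch y hy with ⟨h1, h2, -⟩ | ⟨h1, -⟩
      · exact ev_heckeOp_of_blocked h1 h2 _
      · have h3 := ev_heckeOp_of_sq_eq_neg_one (τ := τ) h1 g₁
        rw [e₁, e₁, hn] at h3
        rw [e₁]
        linear_combination h3 / 2
    · refine ⟨τ, hτM, mono 1 * g₁, by simp, ?_⟩
      rw [← map_smul]
      refine heq _ _ fun y hy => ?_
      rw [map_smul, smul_eq_mul]
      rcases hch y hy with ⟨h1, h2, -⟩ | ⟨h1, h2⟩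
      · exact ev_heckeOp_of_blocked h1 h2 _
      · have h3 := ev_heckeOp_of_sq_eq_neg_one (τ := τ) h1 (mono 1 * g₁)
        rw [map_mul (ev y), map_mul (ev (-y)), e₁, e₁, hm1, hm1, hn] at h3
        rw [map_mul (ev y), e₁, hm1]
        linear_combination h3 / 2 - ((τ : ℂ) + ((τ⁻¹ : ℂˣ) : ℂ)) * y * h2
    · refine ⟨τ, hτM, g₂, by simp, ?_⟩
      rw [← map_smul]
      refine heq _ _ fun y hy => ?_
      rw [map_smul, smul_eq_mul]
      rcases hch y hy with ⟨h1, h2, -⟩ | ⟨h1, -⟩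
      · exact ev_heckeOp_of_blocked h1 h2 _
      · have h3 := ev_heckeOp_of_sq_eq_neg_one (τ := τ) h1 g₂
        rw [e₂, e₂, hn] at h3
        rw [e₂]
        linear_combination h3 / 2
    · refine ⟨-((τ⁻¹ : ℂˣ) : ℂ), by rw [neg_pow, hnM, hτi, one_mul], mono 1 * g₂, by simp, ?_⟩
      rw [← map_smul]
      refine heq _ _ fun y hy => ?_
      rw [map_smul, smul_eq_mul]
      rcases hch y hy with ⟨h1, h2, h4⟩ | ⟨h1, h2⟩
      · rw [ev_heckeOp_of_blocked h1 h2, map_mul, e₂, hm1, h4]; ring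
      · have h3 := ev_heckeOp_of_sq_eq_neg_one (τ := τ) h1 (mono 1 * g₂)
        rw [map_mul (ev y), map_mul (ev (-y)), e₂, e₂, hm1, hm1, hn] at h3
        rw [map_mul (ev y), e₂, hm1]
        linear_combination h3 / 2

end alpha
end Rep
end DAHA

namespace DAHA
variable {u τ : ℂˣ} {V : Type*} [AddCommGroup V] [Module ℂ V]
namespace Rep
variable {ρ : Rep u τ V} {φ : PolySpace →ₗ[ℂ] V} {N : ℕ} {κ : ℤ} {x : ℂˣ}

/-! ### Integral Laurent polynomials -/

/-- Laurent polynomials whose coefficients are algebraic integers. -/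
def intPoly : Submodule (integralClosure ℤ ℂ) PolySpace :=
  Submodule.span (integralClosure ℤ ℂ) (Set.range mono)

theorem smul_mem_intPoly {a : ℂ} (ha : IsIntegral ℤ a) {f : PolySpace} (hf : f ∈ intPoly) :
    a • f ∈ intPoly :=
  intPoly.smul_mem (⟨a, ha⟩ : integralClosure ℤ ℂ) hf

theorem mono_mem_intPoly (n : ℤ) : mono n ∈ intPoly := Submodule.subset_span ⟨n, rfl⟩

theorem map_mem_intPoly (A : Module.End ℂ PolySpace) (hA : ∀ n, A (mono n) ∈ intPoly)
    {f : PolySpace} (hf : f ∈ intPoly) : A f ∈ intPoly := by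
  have : intPoly ≤ intPoly.comap (A.restrictScalars (integralClosure ℤ ℂ)) := by
    conv_lhs => rw [intPoly]
    rw [Submodule.span_le]
    rintro _ ⟨n, rfl⟩
    exact hA n
  exact this hf

theorem isIntegral_of_pow_eq_one {a : ℂ} {M : ℕ} (hM : 0 < M) (ha : a ^ M = 1) : IsIntegral ℤ a :=
  IsIntegral.of_pow hM (by rw [ha]; exact isIntegral_one)

theorem isIntegral_unit_zpow {a : ℂˣ} {M : ℕ} (hM : 0 < M) (ha : a ^ M = 1) (n : ℤ) :
    IsIntegral ℤ ((a ^ n : ℂˣ) : ℂ) :=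
  isIntegral_of_pow_eq_one hM (by
    rw [← Units.val_pow_eq_pow_val, ← zpow_natCast, zpow_comm, zpow_natCast, ha, one_zpow,
      Units.val_one])

theorem ev_isIntegral {y : ℂˣ} {M : ℕ} (hM : 0 < M) (hy : y ^ M = 1) {f : PolySpace}
    (hf : f ∈ intPoly) : IsIntegral ℤ (ev y f) := by
  induction hf using Submodule.span_induction with
  | mem f hf =>
    obtain ⟨n, rfl⟩ := hf
    rw [ev_mono]; exact isIntegral_unit_zpow hM hy n
  | zero => rw [map_zero]; exact isIntegral_zero
  | add f g _ _ hf hg => rw [map_add]; exact hf.add hg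
  | smul a f _ hf =>
    have : a • f = (a : ℂ) • f := rfl
    rw [this, map_smul, smul_eq_mul]
    exact a.2.mul hf

/-- The divided difference of a monomial has coefficients `±1`, so `T` introduces no denominators on
Laurent polynomials, unlike its matrix in the evaluations. -/
theorem heckeOp_mem_intPoly {M : ℕ} (hM : 0 < M) (hτ : τ ^ M = 1) {f : PolySpace}
    (hf : f ∈ intPoly) : heckeOp τ f ∈ intPoly := by
  refine map_mem_intPoly _ (fun n => ?_) hf
  have h1 : IsIntegral ℤ (τ : ℂ) := by simpa using isIntegral_unit_zpow hM hτ 1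
  have h2 : IsIntegral ℤ ((τ⁻¹ : ℂˣ) : ℂ) := by
    have := isIntegral_unit_zpow hM hτ (-1)
    rwa [zpow_neg_one] at this
  rw [heckeOp, LinearMap.add_apply, LinearMap.smul_apply, LinearMap.smul_apply, refl_mono]
  refine add_mem (smul_mem_intPoly h1 (mono_mem_intPoly _)) (smul_mem_intPoly (h1.sub h2) ?_)
  rw [divDiff, ofMono_mono]
  split_ifs
  · exact neg_mem (sum_mem fun i _ => mono_mem_intPoly _)
  · exact sum_mem fun i _ => mono_mem_intPoly _

theorem piOp_mem_intPoly {M : ℕ} (hM : 0 < M) (hu : u ^ M = 1) {f : PolySpace}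
    (hf : f ∈ intPoly) : piOp u f ∈ intPoly :=
  map_mem_intPoly _ (fun n => by
    rw [piOp_mono]
    exact smul_mem_intPoly (isIntegral_unit_zpow hM hu n) (mono_mem_intPoly _)) hf

theorem mulX_mem_intPoly (m : ℤ) {f : PolySpace} (hf : f ∈ intPoly) : mulX m f ∈ intPoly :=
  map_mem_intPoly _ (fun n => by
    rw [mulX, LinearMap.mulLeft_apply, mono_mul]; exact mono_mem_intPoly _) hf

/-! ### Unitarity of the two-dimensional blocks of `T` -/

/-- With `s = u²` and `t = τ` these are the entries of `T` on the values at a point of index `1` and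
its inverse of index `3`, after eliminating `τ⁻¹` by `τ² u⁴ = -1`. The weight `1 + 2 Re s = 1 + s +
s⁻¹` makes the block unitary; replacing conjugates by inverses leaves a rational identity. -/
theorem norm_sq_block_eq {s t a b : ℂ} (hs : ‖s‖ = 1) (ht : ‖t‖ = 1) (hs1 : 1 + s ≠ 0) :
    (1 + 2 * s.re) * ‖t * (s * (1 - s) * b + (1 + s ^ 2) * a) / (1 + s)‖ ^ 2 +
      ‖t * ((1 - s ^ 3) * a + s * (1 + s ^ 2) * b) / (1 + s)‖ ^ 2 =
    (1 + 2 * s.re) * ‖a‖ ^ 2 + ‖b‖ ^ 2 := by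
  have s0 : s ≠ 0 := by rintro rfl; simp at hs
  have t0 : t ≠ 0 := by rintro rfl; simp at ht
  have hsc : (starRingEnd ℂ) s = s⁻¹ := (Complex.inv_eq_conj hs).symm
  have htc : (starRingEnd ℂ) t = t⁻¹ := (Complex.inv_eq_conj ht).symm
  have hre : (2 * (s.re : ℂ)) = s + s⁻¹ := by rw [← hsc, Complex.add_conj]; push_cast; rfl
  have hs1' : s + 1 ≠ 0 := by rwa [add_comm]
  apply Complex.ofReal_injective
  push_cast
  rw [hre]
  simp only [← Complex.mul_conj', map_mul, map_div₀, map_add, map_sub, map_pow, map_one, hsc, htc]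
  have : 1 + s⁻¹ ≠ 0 := by
    intro h; apply hs1'; field_simp at h; linear_combination h
  field_simp
  ring

theorem norm_sq_half_eq {t a b : ℂ} (ht : ‖t‖ = 1) :
    ‖((t + t⁻¹) * b + (t - t⁻¹) * a) / 2‖ ^ 2 + ‖((t + t⁻¹) * a + (t - t⁻¹) * b) / 2‖ ^ 2 =
    ‖a‖ ^ 2 + ‖b‖ ^ 2 := by
  have t0 : t ≠ 0 := by rintro rfl; simp at ht
  have htc : (starRingEnd ℂ) t = t⁻¹ := (Complex.inv_eq_conj ht).symm
  apply Complex.ofReal_injective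
  push_cast
  simp only [← Complex.mul_conj', map_mul, map_div₀, map_add, map_sub, map_inv₀, htc, map_ofNat]
  field_simp
  ring

/-! ### Modules of type `(α)` and dimension `8` -/

/-- The values of `f` at the eight points `± x / u ^ i` lie in `K`, and all their conjugates
satisfy the same bound in the invariant Hermitian form. -/
def IsBounded (K : IntermediateField ℚ ℂ) (ζ : K) (u x : ℂˣ) (f : PolySpace) : Prop :=
  ∃ p m : Fin 4 → K, (∀ i : Fin 4, ev (x / u ^ (i : ℕ)) f = p i ∧
    ev (-(x / u ^ (i : ℕ))) f = m i) ∧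
    ∀ σ : K →+* ℂ, (1 + 2 * (σ ζ ^ 2).re) * (‖σ (p 1)‖ ^ 2 + ‖σ (m 1)‖ ^ 2 + ‖σ (p 2)‖ ^ 2 +
      ‖σ (m 2)‖ ^ 2) + (‖σ (p 0)‖ ^ 2 + ‖σ (m 0)‖ ^ 2 + ‖σ (p 3)‖ ^ 2 + ‖σ (m 3)‖ ^ 2) ≤ 16

section bounded
variable {K : IntermediateField ℚ ℂ} {ζ ξ θ : K} {f : PolySpace}

/-- The bound `16` comes from here: on `1` the form equals `4 (1 + 2 Re σ(ζ)²) + 4`, and `Re ≤ 1`.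
-/
theorem isBounded_one (hu : ∀ σ : K →+* ℂ, ‖σ ζ‖ = 1) : IsBounded K ζ u x 1 := by
  refine ⟨fun _ => 1, fun _ => 1, fun i => by simp, fun σ => ?_⟩
  have := Complex.re_le_norm (σ ζ ^ 2)
  rw [norm_pow, hu σ, one_pow] at this
  simp only [map_one, norm_one]
  linarith

theorem IsBounded.unit_smul (hu : ∀ σ : K →+* ℂ, ‖σ ζ‖ = 1) (hζ : (ζ : ℂ) = u)
    (hf : IsBounded K ζ u x f) : IsBounded K ζ u x ((u : ℂ) • f) := by
  obtain ⟨p, m, h1, h2⟩ := hf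
  refine ⟨fun i => ζ * p i, fun i => ζ * m i, fun i => ?_, fun σ => ?_⟩
  · rw [map_smul, map_smul, (h1 i).1, (h1 i).2, smul_eq_mul, smul_eq_mul, ← hζ]
    exact ⟨rfl, rfl⟩
  · simp only [map_mul, norm_mul, hu σ, one_mul]
    exact h2 σ

theorem IsBounded.map_X (hu : ∀ σ : K →+* ℂ, ‖σ ζ‖ = 1) (hx : ∀ σ : K →+* ℂ, ‖σ ξ‖ = 1)
    (hζ : (ζ : ℂ) = u) (hξ : (ξ : ℂ) = x)
    (hf : IsBounded K ζ u x f) : IsBounded K ζ u x (mulX 1 f) := by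
  obtain ⟨p, m, h1, h2⟩ := hf
  refine ⟨fun i => ξ / ζ ^ (i : ℕ) * p i, fun i => -(ξ / ζ ^ (i : ℕ)) * m i, fun i => ?_,
    fun σ => ?_⟩
  · rw [ev_mulX, ev_mulX, (h1 i).1, (h1 i).2, zpow_one, zpow_one]
    push_cast
    rw [hζ, hξ]
    simp
  · simp only [map_mul, norm_mul, map_div₀, map_neg, norm_neg, norm_div, map_pow, norm_pow, hu σ,
      hx σ, one_pow, div_one, one_mul]
    exact h2 σ

theorem IsBounded.map_pi (hx2 : x ^ 2 = -u ^ 4)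
    (hf : IsBounded K ζ u x f) : IsBounded K ζ u x (piOp u f) := by
  obtain ⟨p, m, h1, h2⟩ := hf
  have e : ∀ i : ℕ, i ≤ 3 → u / (x / u ^ i) = -(x / u ^ (3 - i)) := fun i hi => by
    rw [div_eq_iff_eq_mul, neg_mul, div_mul_div_comm, ← pow_add, ← sq, hx2, neg_div, neg_neg,
      show 3 - i + i = 3 by omega, eq_div_iff_mul_eq', ← pow_succ']
  have e' : ∀ i : ℕ, i ≤ 3 → u / -(x / u ^ i) = x / u ^ (3 - i) := fun i hi => by
    rw [div_neg, e i hi, neg_neg]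
  refine ⟨fun i => m (3 - i), fun i => p (3 - i), fun i => ?_, fun σ => ?_⟩
  · have hi : ((3 - i : Fin 4) : ℕ) = 3 - (i : ℕ) := by fin_cases i <;> rfl
    rw [ev_piOp, ev_piOp, e _ (by omega), e' _ (by omega), ← hi]
    exact ⟨(h1 _).2, (h1 _).1⟩
  · have := h2 σ
    have r0 : (3 - 0 : Fin 4) = 3 := rfl
    have r1 : (3 - 1 : Fin 4) = 2 := rfl
    have r2 : (3 - 2 : Fin 4) = 1 := rfl
    have r3 : (3 - 3 : Fin 4) = 0 := rfl
    simp only [r0, r1, r2, r3]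
    linarith

/-- `T` is `τ` at index `0`, pairs `±` index `1` with `∓` index `3`, and pairs the two points of
index `2`, which are inverse to each other. Each block is unitary in every embedding, so the form is
preserved. -/
theorem IsBounded.map_T (hu : ∀ σ : K →+* ℂ, ‖σ ζ‖ = 1) (ht : ∀ σ : K →+* ℂ, ‖σ θ‖ = 1)
    (hζ : (ζ : ℂ) = u) (hθ : (θ : ℂ) = τ) (hx2 : x ^ 2 = -u ^ 4) (hτ : τ ^ 2 * x ^ 2 = 1)
    (hu4 : u ^ 4 ≠ -1) (hu2 : u ^ 2 ≠ -1)
    (hf : IsBounded K ζ u x f) : IsBounded K ζ u x (heckeOp τ f) := by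
  obtain ⟨p, m, h1, h2⟩ := hf
  have U0 : (u : ℂ) ≠ 0 := u.ne_zero
  have T0 : (τ : ℂ) ≠ 0 := τ.ne_zero
  have hs : (1 : ℂ) + (u : ℂ) ^ 2 ≠ 0 := fun h => hu2 (Units.ext (by
    push_cast; linear_combination h))
  -- From `τ² x² = 1` and `x² = -u⁴`.
  have hTi : ((τ⁻¹ : ℂˣ) : ℂ) = -((τ : ℂ) * (u : ℂ) ^ 4) := by
    have := congrArg Units.val hτ
    rw [hx2] at this
    push_cast at this
    rw [Units.val_inv_eq_inv_val]
    refine inv_eq_of_mul_eq_one_right ?_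
    linear_combination this
  have hTi' : (τ : ℂ)⁻¹ = ((τ⁻¹ : ℂˣ) : ℂ) := (Units.val_inv_eq_inv_val τ).symm
  -- the four types of points, by the value of `y ^ 2`
  have blocked : ∀ y : ℂˣ, y ^ 2 = -u ^ 4 → ev y (heckeOp τ f) = τ * ev y f := fun y hy =>
    ev_heckeOp_of_blocked (by rw [hy, ← hx2, hτ])
      (fun h => hu4 (by rw [hy] at h; rw [← h, neg_neg])) f
  have upper : ∀ y : ℂˣ, y ^ 2 = -u ^ 2 → ev y (heckeOp τ f) = τ * ((u : ℂ) ^ 2 *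
      (1 - (u : ℂ) ^ 2) * ev y⁻¹ f + (1 + ((u : ℂ) ^ 2) ^ 2) * ev y f) / (1 + (u : ℂ) ^ 2) := by
    intro y hy
    have h3 := ev_heckeOp_mul τ y f
    have hy' := congrArg Units.val hy
    push_cast at hy'
    rw [hTi, hy'] at h3
    rw [eq_div_iff hs]
    linear_combination -h3
  have lower : ∀ y : ℂˣ, u ^ 2 * y ^ 2 = -1 → ev y (heckeOp τ f) = τ * ((1 - ((u : ℂ) ^ 2) ^ 3) *
      ev y⁻¹ f + (u : ℂ) ^ 2 * (1 + ((u : ℂ) ^ 2) ^ 2) * ev y f) / (1 + (u : ℂ) ^ 2) := by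
    intro y hy
    have h3 := ev_heckeOp_mul τ y f
    have hy' := congrArg Units.val hy
    push_cast at hy'
    rw [hTi] at h3
    rw [eq_div_iff hs]
    linear_combination -(u : ℂ) ^ 2 * h3 +
      (ev y (heckeOp τ f) - τ * ev y⁻¹ f) * hy'
  have middle : ∀ y : ℂˣ, y ^ 2 = -1 → ev y (heckeOp τ f) =
      (((τ : ℂ) + (τ : ℂ)⁻¹) * ev (-y) f + ((τ : ℂ) - (τ : ℂ)⁻¹) * ev y f) / 2 := fun y hy => by
    rw [hTi', ← ev_heckeOp_of_sq_eq_neg_one hy]; ring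
  have sq0 : (x / u ^ 0) ^ 2 = -u ^ 4 := by rw [pow_zero, div_one, hx2]
  have sq1 : (x / u ^ 1) ^ 2 = -u ^ 2 := by
    rw [div_pow, hx2, div_eq_iff_eq_mul, pow_one, neg_mul, ← pow_add]
  have sq2 : (x / u ^ 2) ^ 2 = -1 := by
    rw [div_pow, hx2, div_eq_iff_eq_mul, neg_one_mul, ← pow_mul]
  have sq3 : u ^ 2 * (x / u ^ 3) ^ 2 = -1 := by
    rw [div_pow, hx2, mul_div_assoc', div_eq_iff_eq_mul, neg_one_mul, mul_neg, ← pow_add, ← pow_mul]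
  have inv1 : (x / u ^ 1)⁻¹ = -(x / u ^ 3) := by
    rw [inv_eq_iff_mul_eq_one, mul_neg, div_mul_div_comm, ← sq, hx2, neg_div, neg_neg, ← pow_add,
      div_self']
  have inv3 : (x / u ^ 3)⁻¹ = -(x / u ^ 1) := by rw [← neg_eq_iff_eq_neg.mpr inv1, inv_neg, inv_inv]
  let s : K := ζ ^ 2
  have hsK : (s : ℂ) = (u : ℂ) ^ 2 := by simp [s, hζ]
  have h10 := h1 0
  have h11 := h1 1
  have h12 := h1 2
  have h13 := h1 3
  simp only [Fin.val_zero, Fin.val_one, Fin.val_two, show ((3 : Fin 4) : ℕ) = 3 from rfl]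
    at h10 h11 h12 h13
  refine ⟨![θ * p 0, θ * (s * (1 - s) * m 3 + (1 + s ^ 2) * p 1) / (1 + s),
      ((θ + θ⁻¹) * m 2 + (θ - θ⁻¹) * p 2) / 2,
      θ * ((1 - s ^ 3) * m 1 + s * (1 + s ^ 2) * p 3) / (1 + s)],
    ![θ * m 0, θ * (s * (1 - s) * p 3 + (1 + s ^ 2) * m 1) / (1 + s),
      ((θ + θ⁻¹) * p 2 + (θ - θ⁻¹) * m 2) / 2,
      θ * ((1 - s ^ 3) * p 1 + s * (1 + s ^ 2) * m 3) / (1 + s)], fun i => ?_, fun σ => ?_⟩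
  · fin_cases i
    · change ev (x / u ^ 0) _ = ((θ * p 0 : K) : ℂ) ∧ ev (-(x / u ^ 0)) _ = ((θ * m 0 : K) : ℂ)
      push_cast
      rw [blocked _ sq0, blocked _ (by rw [neg_sq, sq0]), h10.1, h10.2, hθ]
      exact ⟨rfl, rfl⟩
    · change ev (x / u ^ 1) _ = ((θ * (s * (1 - s) * m 3 + (1 + s ^ 2) * p 1) / (1 + s) : K) : ℂ) ∧
        ev (-(x / u ^ 1)) _ = ((θ * (s * (1 - s) * p 3 + (1 + s ^ 2) * m 1) / (1 + s) : K) : ℂ)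
      push_cast
      rw [upper _ sq1, upper _ (by rw [neg_sq, sq1]), inv_neg, inv1, neg_neg, h11.1, h11.2, h13.1,
        h13.2, hθ, hsK]
      exact ⟨rfl, rfl⟩
    · change ev (x / u ^ 2) _ = (((θ + θ⁻¹) * m 2 + (θ - θ⁻¹) * p 2) / 2 : K) ∧
        ev (-(x / u ^ 2)) _ = (((θ + θ⁻¹) * p 2 + (θ - θ⁻¹) * m 2) / 2 : K)
      push_cast
      rw [middle _ sq2, middle _ (by rw [neg_sq, sq2]), neg_neg, h12.1, h12.2, hθ]
      exact ⟨rfl, rfl⟩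
    · change ev (x / u ^ 3) _ = (θ * ((1 - s ^ 3) * m 1 + s * (1 + s ^ 2) * p 3) / (1 + s) : K) ∧
        ev (-(x / u ^ 3)) _ = (θ * ((1 - s ^ 3) * p 1 + s * (1 + s ^ 2) * m 3) / (1 + s) : K)
      push_cast
      rw [lower _ sq3, lower _ (by rw [neg_sq, sq3]), inv_neg, inv3, neg_neg, h11.1, h11.2, h13.1,
        h13.2, hθ, hsK]
      exact ⟨rfl, rfl⟩
  · refine le_trans (le_of_eq ?_) (h2 σ)
    have hs' : 1 + σ ζ ^ 2 ≠ 0 := by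
      intro h
      have : σ (1 + ζ ^ 2) = 0 := by rw [map_add, map_one, map_pow, h]
      rw [map_eq_zero] at this
      refine hs ?_
      rw [← hζ]
      exact_mod_cast congrArg (Subtype.val : K → ℂ) this
    have b1 := norm_sq_block_eq (s := σ ζ ^ 2) (t := σ θ) (a := σ (p 1)) (b := σ (m 3))
      (by rw [norm_pow, hu, one_pow]) (ht σ) hs'
    have b2 := norm_sq_block_eq (s := σ ζ ^ 2) (t := σ θ) (a := σ (m 1)) (b := σ (p 3))
      (by rw [norm_pow, hu, one_pow]) (ht σ) hs'
    have b3 := norm_sq_half_eq (t := σ θ) (a := σ (p 2)) (b := σ (m 2)) (ht σ)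
    have n0 : ∀ k : K, ‖σ (θ * k)‖ = ‖σ k‖ := fun k => by rw [map_mul, norm_mul, ht σ, one_mul]
    simp only [Matrix.cons_val, n0]
    simp only [s, map_mul, map_div₀, map_add, map_sub, map_pow, map_one, map_inv₀, map_ofNat]
    linear_combination b1 + b2 + (1 + 2 * (σ ζ ^ 2).re) * b3

end bounded

end Rep
end DAHA

namespace DAHA
variable {u τ : ℂˣ} {V : Type*} [AddCommGroup V] [Module ℂ V]
namespace Rep
variable {ρ : Rep u τ V} {φ : PolySpace →ₗ[ℂ] V} {N : ℕ} {κ : ℤ} {x : ℂˣ}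

theorem norm_embedding_eq_one {K : IntermediateField ℚ ℂ} {ζ : K} {a : ℂˣ} (hζ : (ζ : ℂ) = a)
    {M : ℕ} (hM : 0 < M) (ha : a ^ M = 1) (σ : K →+* ℂ) : ‖σ ζ‖ = 1 := by
  refine Complex.norm_eq_one_of_pow_eq_one (n := M) ?_ hM.ne'
  have : ζ ^ M = 1 := Subtype.ext (by
    push_cast
    rw [hζ, ← Units.val_pow_eq_pow_val, ha, Units.val_one])
  rw [← map_pow, this, map_one]

theorem isPrimitiveRoot_embedding {K : IntermediateField ℚ ℂ} {ζ : K} {a : ℂˣ}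
    (hζ : (ζ : ℂ) = a) {M : ℕ} (ha : IsPrimitiveRoot a M) (σ : K →+* ℂ) :
    IsPrimitiveRoot (σ ζ) M := by
  have h1 : IsPrimitiveRoot (a : ℂ) M := IsPrimitiveRoot.coe_units_iff.mpr ha
  rw [← hζ] at h1
  have h2 : IsPrimitiveRoot ζ M := IsPrimitiveRoot.of_map_of_injective (f := K.val) h1
    K.val.injective
  exact h2.map_of_injective σ.injective

/-- All weights are at least `1/3`, so each squared absolute value is at most `48 < 7²`. -/
theorem IsBounded.norm_le {K : IntermediateField ℚ ℂ} {ζ : K} {f : PolySpace}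
    (hpos : ∀ σ : K →+* ℂ, 1 / 3 ≤ 1 + 2 * (σ ζ ^ 2).re)
    (hint : ∀ i : Fin 4, IsIntegral ℤ (ev (x / u ^ (i : ℕ)) f) ∧
      IsIntegral ℤ (ev (-(x / u ^ (i : ℕ))) f))
    (hf : IsBounded K ζ u x f) (i : Fin 4) :
    (ev (x / u ^ (i : ℕ)) f, ev (-(x / u ^ (i : ℕ))) f) ∈
      (Subtype.val '' {k : K | IsIntegral ℤ k ∧ ∀ σ : K →+* ℂ, ‖σ k‖ ≤ 7}) ×ˢ
      (Subtype.val '' {k : K | IsIntegral ℤ k ∧ ∀ σ : K →+* ℂ, ‖σ k‖ ≤ 7}) := by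
  obtain ⟨p, m, h1, h2⟩ := hf
  have hK : ∀ k : K, IsIntegral ℤ (k : ℂ) → IsIntegral ℤ k := fun k hk =>
    (isIntegral_algHom_iff (K.val.restrictScalars ℤ) K.val.injective).mp hk
  have key : ∀ σ : K →+* ℂ, ‖σ (p i)‖ ≤ 7 ∧ ‖σ (m i)‖ ≤ 7 := by
    intro σ
    have h3 := h2 σ
    have h4 := hpos σ
    set r := 1 + 2 * (σ ζ ^ 2).re
    have hmul : ∀ k : K, 1 / 3 * ‖σ k‖ ^ 2 ≤ r * ‖σ k‖ ^ 2 := fun k =>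
      mul_le_mul_of_nonneg_right h4 (sq_nonneg _)
    have := hmul (p 1); have := hmul (p 2); have := hmul (m 1); have := hmul (m 2)
    have hsq : ∀ k : K, 0 ≤ ‖σ k‖ ^ 2 := fun k => sq_nonneg _
    have := hsq (p 0); have := hsq (p 1); have := hsq (p 2); have := hsq (p 3)
    have := hsq (m 0); have := hsq (m 1); have := hsq (m 2); have := hsq (m 3)
    constructor <;> refine abs_le_of_sq_le_sq' ?_ (by norm_num) |>.2 <;> fin_cases i <;>
      simp only [Fin.zero_eta, Fin.mk_one, Fin.reduceFinMk] <;> linarith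
  exact ⟨⟨p i, ⟨hK _ ((h1 i).1 ▸ (hint i).1), fun σ => (key σ).1⟩, (h1 i).1.symm⟩,
    ⟨m i, ⟨hK _ ((h1 i).2 ▸ (hint i).2), fun σ => (key σ).2⟩, (h1 i).2.symm⟩⟩

/-- `A` is stable under the generators and contains `1`. Its elements take algebraic integer values
at the eight support points, bounded by `7` in every embedding of a number field, and these values
determine the image in `V`. Hence `φ '' A` is a finite invariant set. -/
theorem IsQuotMap.alpha_finite_eight (h : ρ.IsQuotMap φ) (hirr : ρ.IsIrreducible) (hN0 : 0 < N)
    (hu : IsPrimitiveRoot u (2 * N)) (hτ : τ ^ 2 = u ^ κ) (hκ : 0 < κ) (hc : κ + 4 = N)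
    (hx1 : τ ^ 2 * x ^ 2 = 1) (hs : ∀ i < 4, x / u ^ i ∈ supp φ)
    (hpos : ∀ U : ℂ, IsPrimitiveRoot U (2 * N) → 1 / 3 ≤ 1 + 2 * (U ^ 2).re) :
    Finite ρ.imageB := by
  have hker := h.alpha_ker hirr hN0 hu hτ hκ (by norm_num : 0 < 4) hc hx1 hs
  have hut : τ ^ 2 * u ^ 4 = -1 := by
    rw [hτ, ← zpow_natCast, ← zpow_add]
    push_cast
    rw [hc, zpow_natCast, pow_eq_neg_one hN0 hu]
  have hx2 : x ^ 2 = -u ^ 4 := mul_left_cancel (hx1.trans (by rw [mul_neg, hut, neg_neg]))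
  have hu4 : u ^ 4 ≠ -1 := by
    intro h4
    rw [h4, mul_neg_one, neg_inj, hτ, hu.zpow_eq_one_iff_dvd] at hut
    have := Int.le_of_dvd hκ hut
    push_cast at this; omega
  have hu2 : u ^ 2 ≠ -1 := by
    intro h2
    have : u ^ 4 = 1 := by rw [show 4 = 2 * 2 from rfl, pow_mul, h2, neg_one_sq]
    have := Nat.le_of_dvd (by norm_num) (hu.dvd_of_pow_eq_one 4 this)
    omega
  have hM : 0 < 4 * N := by omega
  have huM : u ^ (4 * N) = 1 := by
    rw [show 4 * N = 2 * N * 2 by ring, pow_mul, hu.pow_eq_one, one_pow]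
  have hτM : τ ^ (4 * N) = 1 := by
    rw [show 4 * N = 2 * (2 * N) by ring, pow_mul, hτ, ← zpow_natCast, zpow_comm, zpow_natCast,
      hu.pow_eq_one, one_zpow]
  have hxM : x ^ (4 * N) = 1 := by
    rw [show 4 * N = 2 * (2 * N) by ring, pow_mul, hx2, Even.neg_pow (by simp), ← pow_mul,
      mul_comm, pow_mul, hu.pow_eq_one, one_pow]
  let K : IntermediateField ℚ ℂ := IntermediateField.adjoin ℚ {(u : ℂ), (x : ℂ), (τ : ℂ)}
  have hint : ∀ a : ℂˣ, a ^ (4 * N) = 1 → IsIntegral ℚ (a : ℂ) := fun a ha =>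
    (isIntegral_of_pow_eq_one hM (by rw [← Units.val_pow_eq_pow_val, ha, Units.val_one])).tower_top
  have : FiniteDimensional ℚ K := IntermediateField.finiteDimensional_adjoin (by
    rintro a (rfl | rfl | rfl)
    exacts [hint _ huM, hint _ hxM, hint _ hτM])
  have : NumberField K := { }
  let ζ : K := ⟨u, IntermediateField.subset_adjoin _ _ (by simp)⟩
  let ξ : K := ⟨x, IntermediateField.subset_adjoin _ _ (by simp)⟩
  let θ : K := ⟨τ, IntermediateField.subset_adjoin _ _ (by simp)⟩
  have hζ : ∀ σ : K →+* ℂ, ‖σ ζ‖ = 1 := norm_embedding_eq_one rfl hM huM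
  have hξ : ∀ σ : K →+* ℂ, ‖σ ξ‖ = 1 := norm_embedding_eq_one rfl hM hxM
  have hθ : ∀ σ : K →+* ℂ, ‖σ θ‖ = 1 := norm_embedding_eq_one rfl hM hτM
  let A : Set PolySpace := {f | f ∈ intPoly ∧ IsBounded K ζ u x f}
  have hT : ∀ f ∈ A, heckeOp τ f ∈ A := fun f hf =>
    ⟨heckeOp_mem_intPoly hM hτM hf.1, hf.2.map_T hζ hθ rfl rfl hx2 hx1 hu4 hu2⟩
  let val : PolySpace → Fin 4 → ℂ × ℂ := fun f i =>
    (ev (x / u ^ (i : ℕ)) f, ev (-(x / u ^ (i : ℕ))) f)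
  have hval : ∀ f g, φ f = φ g ↔ val f = val g := by
    intro f g
    rw [← sub_eq_zero, ← map_sub, hker]
    simp only [map_sub, sub_eq_zero]
    constructor
    · intro hfg
      funext i
      refine Prod.ext (hfg _ ?_) (hfg _ ?_)
      · exact mem_chain.mpr ⟨i, i.2, Or.inl rfl⟩
      · exact mem_chain.mpr ⟨i, i.2, Or.inr (by rw [neg_one_mul])⟩
    · intro hfg y hy
      obtain ⟨i, hi, rfl | rfl⟩ := mem_chain.mp hy
      · exact congrArg Prod.fst (congrFun hfg ⟨i, hi⟩)
      · rw [neg_one_mul]; exact congrArg Prod.snd (congrFun hfg ⟨i, hi⟩)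
  refine finite_imageB_of_mapsTo hirr (F := φ '' A) ?_
    ⟨1, ⟨?_, isBounded_one hζ⟩, rfl⟩ (h.map_one_ne_zero hirr) ?_ ?_ ?_ ?_
  · have hfin := (NumberField.Embeddings.finite_of_norm_le K ℂ 7).image (Subtype.val : K → ℂ)
    refine Set.Finite.of_injOn (f := fun v => val (Function.surjInv h.surj v)) ?_ ?_
      (Set.Finite.pi fun _ : Fin 4 => hfin.prod hfin)
    · rintro _ ⟨f, hf, rfl⟩ i -
      have e : val (Function.surjInv h.surj (φ f)) = val f :=
        (hval _ _).mp (Function.surjInv_eq h.surj _)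
      change val (Function.surjInv h.surj (φ f)) i ∈ _
      rw [e]
      refine hf.2.norm_le (fun σ => hpos _ (isPrimitiveRoot_embedding rfl hu σ)) (fun i => ?_) i
      have hy : (x / u ^ (i : ℕ)) ^ (4 * N) = 1 := by
        rw [div_pow, hxM, ← pow_mul, mul_comm, pow_mul, huM, one_pow, div_one]
      refine ⟨ev_isIntegral hM hy hf.1, ev_isIntegral hM ?_ hf.1⟩
      rw [Even.neg_pow ⟨2 * N, by ring⟩, hy]
    · intro v _ w _ hvw
      have := (hval _ _).mpr hvw
      rwa [Function.surjInv_eq h.surj, Function.surjInv_eq h.surj] at this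
  · simpa using mono_mem_intPoly 0
  · rintro _ ⟨f, hf, rfl⟩
    exact ⟨_, ⟨mulX_mem_intPoly 1 hf.1, hf.2.map_X hζ hξ rfl rfl⟩, h.mapX f⟩
  · rintro _ ⟨f, hf, rfl⟩
    exact ⟨_, ⟨piOp_mem_intPoly hM huM (hT f hf).1, (hT f hf).2.map_pi hx2⟩, h.mapY f⟩
  · rintro _ ⟨f, hf, rfl⟩
    exact ⟨_, hT f hf, h.mapT f⟩
  · rintro _ ⟨f, hf, rfl⟩
    exact ⟨_, ⟨smul_mem_intPoly (isIntegral_of_pow_eq_one hM (by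
      rw [← Units.val_pow_eq_pow_val, huM, Units.val_one])) hf.1, hf.2.unit_smul hζ rfl⟩,
      map_smul _ _ _⟩

/-! ### Positivity of the invariant form -/

theorem one_add_two_re_eq {s : ℂ} (hs : ‖s‖ = 1) : ((1 + 2 * s.re : ℝ) : ℂ) = 1 + s + s⁻¹ := by
  rw [Complex.inv_eq_conj hs, add_assoc, Complex.add_conj]
  push_cast; rfl

theorem form_pos_six {U : ℂ} (hU : IsPrimitiveRoot U (2 * 6)) : 1 / 3 ≤ 1 + 2 * (U ^ 2).re := by
  have hs : IsPrimitiveRoot (U ^ 2) 6 := hU.pow (by norm_num) (by norm_num)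
  set s := U ^ 2
  have hn : ‖s‖ = 1 := hs.norm'_eq_one (by norm_num)
  have hz := one_add_two_re_eq hn
  have s0 : s ≠ 0 := hs.ne_zero (by norm_num)
  have h3 : s ^ 3 = -1 := by
    have := hs.pow_ne_one_of_pos_of_lt (l := 3) (by norm_num) (by norm_num)
    have h6 : s ^ 3 * s ^ 3 = 1 := by rw [← pow_add]; exact hs.pow_eq_one
    exact (mul_self_eq_one_iff.mp h6).resolve_left this
  have h2 : s ^ 2 ≠ 1 := hs.pow_ne_one_of_pos_of_lt (by norm_num) (by norm_num)
  have h1 : s + 1 ≠ 0 := fun e => h2 (by linear_combination (s - 1) * e)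
  have h4 : s ^ 2 - s + 1 = 0 := mul_left_cancel₀ h1 (by linear_combination h3)
  have : ((1 + 2 * s.re : ℝ) : ℂ) = (2 : ℝ) := by
    rw [hz]; push_cast; field_simp; linear_combination h4
  rw [Complex.ofReal_inj] at this
  rw [this]; norm_num

/-- The tenth cyclotomic equation for `s = U²` becomes `r² - 3r + 1 = 0` for `r = 1 + s + s⁻¹`, so
`3r = r² + 1 ≥ 1`. -/
theorem form_pos_ten {U : ℂ} (hU : IsPrimitiveRoot U (2 * 10)) :
    1 / 3 ≤ 1 + 2 * (U ^ 2).re := by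
  have hs : IsPrimitiveRoot (U ^ 2) 10 := hU.pow (by norm_num) (by norm_num)
  set s := U ^ 2
  have hn : ‖s‖ = 1 := hs.norm'_eq_one (by norm_num)
  have hz := one_add_two_re_eq hn
  have s0 : s ≠ 0 := hs.ne_zero (by norm_num)
  have h5 : s ^ 5 = -1 := by
    have := hs.pow_ne_one_of_pos_of_lt (l := 5) (by norm_num) (by norm_num)
    have h10 : s ^ 5 * s ^ 5 = 1 := by rw [← pow_add]; exact hs.pow_eq_one
    exact (mul_self_eq_one_iff.mp h10).resolve_left this
  have h2 : s ^ 2 ≠ 1 := hs.pow_ne_one_of_pos_of_lt (by norm_num) (by norm_num)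
  have h1 : s + 1 ≠ 0 := fun e => h2 (by linear_combination (s - 1) * e)
  have h4 : s ^ 4 - s ^ 3 + s ^ 2 - s + 1 = 0 := mul_left_cancel₀ h1 (by linear_combination h5)
  set r := 1 + 2 * s.re
  have : ((r ^ 2 - 3 * r + 1 : ℝ) : ℂ) = (0 : ℝ) := by
    push_cast; rw [hz]; field_simp; linear_combination h4
  rw [Complex.ofReal_inj] at this
  nlinarith [sq_nonneg r]

end Rep
end DAHA

namespace DAHA
variable {u τ : ℂˣ} {V : Type*} [AddCommGroup V] [Module ℂ V]
namespace Rep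
variable {N : ℕ} {κ : ℤ}

/-! ### Finiteness by the type of the module -/

theorem IsAlpha.finite_iff {ρ : Rep u τ V} (hu : IsPrimitiveRoot u (2 * N))
    (h : ρ.IsAlpha N κ) : Finite ρ.imageB ↔
      (κ = N - 1 ∧ Module.finrank ℂ V = 2) ∨ (2 < N ∧ κ = N - 2 ∧ Module.finrank ℂ V = 4) ∨
      (N = 6 ∧ κ = 2 * 1 ∧ Module.finrank ℂ V = 8) ∨
      (N = 10 ∧ κ = 2 * 3 ∧ Module.finrank ℂ V = 8) := by
  obtain ⟨hκ, hκN, hτ, hf⟩ := h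
  have hN0 : 0 < N := by omega
  obtain ⟨ρ', φ, hirr, hφ, hf, hfin⟩ : ∃ (ρ' : Rep u τ V) (φ : PolySpace →ₗ[ℂ] V),
      ρ'.IsIrreducible ∧ ρ'.IsQuotMap φ ∧ ((Even κ ∧ φ (symPoly (2 * N) 2) = 0) ∨
        (Odd κ ∧ φ (symPoly N 0) = 0)) ∧ (Finite ρ'.imageB ↔ Finite ρ.imageB) := by
    rcases hf with ⟨hp, hf⟩ | ⟨hp, hf⟩ <;> obtain ⟨ρ', φ, h1, h2, h3, h4⟩ := hf.exists_isQuotMap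
    exacts [⟨ρ', φ, h1, h2, Or.inl ⟨hp, h3⟩, h4⟩, ⟨ρ', φ, h1, h2, Or.inr ⟨hp, h3⟩, h4⟩]
  obtain ⟨c, hc⟩ : ∃ c : ℕ, κ + c = N := ⟨(N - κ).toNat, by omega⟩
  obtain ⟨x, hx1, hs⟩ := hφ.exists_chain_of_isPrimitiveRoot hirr hN0 hu hτ (by rw [hc])
    (by omega) hf
  have hdim := hφ.alpha_finrank hirr hN0 hu hτ hκ (by omega) hc hx1 hs
  rw [← hfin]
  constructor
  · intro hF
    have h1 : ¬ (2 < c ∧ ¬ (c = 4 ∧ (N = 6 ∨ N = 10))) := fun ⟨h1, h2⟩ =>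
      hφ.alpha_not_finite hN0 hu hτ hκ h1 hc hx1 hs h2 hF
    omega
  · intro h1
    obtain rfl | rfl | ⟨rfl, rfl | rfl⟩ : c = 1 ∨ c = 2 ∨ (c = 4 ∧ (N = 6 ∨ N = 10)) := by omega
    · exact hφ.alpha_finite_two hirr hN0 hu hτ hκ hc hx1 hs
    · exact hφ.alpha_finite_four hirr hN0 hu hτ hκ hc hx1 hs
    · exact hφ.alpha_finite_eight hirr hN0 hu hτ hκ hc hx1 hs fun U => form_pos_six
    · exact hφ.alpha_finite_eight hirr hN0 hu hτ hκ hc hx1 hs fun U => form_pos_ten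

theorem IsBeta.not_finite {ρ : Rep u τ V} (hu : IsPrimitiveRoot u (2 * N))
    (h : ρ.IsBeta N κ) : ¬ Finite ρ.imageB := by
  obtain ⟨hκN, hκ, hp, hτ, hf⟩ := h
  obtain ⟨ρ', φ, hirr, hφ, hf, hfin⟩ := hf.exists_isQuotMap
  rw [← hfin]
  exact hφ.beta hirr (by omega) hu hτ hκ hκN hp hf

theorem IsGamma.finite_iff {ρ : Rep u τ V} (hu : IsPrimitiveRoot u (2 * N))
    (h : ρ.IsGamma N κ) : Finite ρ.imageB ↔ Module.finrank ℂ V = 1 := by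
  obtain ⟨hκN, hκ, hp, hτ, hf⟩ := h
  obtain ⟨ρ', φ, hirr, hφ, hf, hfin⟩ := hf.exists_isQuotMap
  rw [← hfin]
  exact hφ.gamma hirr (by omega) hu hτ hκ hκN hp hf

theorem zpow_two_mul (u : ℂˣ) (κ : ℤ) : u ^ (2 * κ) = (u ^ 2) ^ κ := by
  rw [← zpow_natCast u 2, ← zpow_mul]; rfl

theorem IsAlphaBetaCheck.finite_iff {ρ : Rep (u ^ 2) τ V} (hodd : Odd N)
    (hu : IsPrimitiveRoot (u ^ 2) N) (h : ρ.IsAlphaBetaCheck N u κ) :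
    Finite ρ.imageB ↔ Module.finrank ℂ V = 1 := by
  obtain ⟨hκ, hκN, hp, hτ, hf⟩ := h
  rw [zpow_two_mul] at hτ
  obtain ⟨ρ', φ, hirr, hφ, hf, hfin⟩ := hf.exists_isQuotMap
  rw [← hfin]
  rw [abs_lt] at hκN
  rcases lt_or_gt_of_ne (abs_pos.mp hκ) with h0 | h0
  · exact ⟨fun h1 => absurd h1 (hφ.check_neg hirr hodd hu hτ h0 hκN.1 hp hf),
      finite_imageB_of_finrank_eq_one hirr (by omega) hu.pow_eq_one⟩
  · exact hφ.check_pos hirr hodd hu hτ h0 hκN.2 hp hf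

/-- `u²` has odd order `N`, so `κ` matters only modulo `N`; adding `N` makes it even and positive,
the case of `check_pos`. -/
theorem IsGammaCheck.finite_iff {ρ : Rep (u ^ 2) τ V} (hodd : Odd N)
    (hu : IsPrimitiveRoot (u ^ 2) N) (h : ρ.IsGammaCheck N u κ) :
    Finite ρ.imageB ↔ Module.finrank ℂ V = 1 := by
  obtain ⟨hκN, hκ, hp, hτ, hf⟩ := h
  rw [zpow_two_mul] at hτ
  obtain ⟨ρ', φ, hirr, hφ, hf, hfin⟩ := hf.exists_isQuotMap
  rw [← hfin]
  refine hφ.check_pos (κ := κ + N) hirr hodd hu ?_ (by omega) (by omega)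
    (hp.add_odd (by exact_mod_cast hodd)) hf
  rw [zpow_add, zpow_natCast, hu.pow_eq_one, mul_one, hτ]

/-- Here `κ` is shifted by `-N` to become even and negative. -/
theorem IsSphericalCheck.not_finite {ρ : Rep (u ^ 2) τ V} (hodd : Odd N)
    (hu : IsPrimitiveRoot (u ^ 2) N) (h : ρ.IsSphericalCheck u κ) (hκ : 0 < κ) (hκN : κ < N)
    (hp : Odd κ) : ¬ Finite ρ.imageB := by
  obtain ⟨_, hτ, hf⟩ := h
  rw [zpow_two_mul] at hτ
  obtain ⟨ρ', φ, hirr, hφ, -, hfin⟩ := hf.exists_isQuotMap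
  rw [← hfin]
  refine hφ.not_finite_of_neg_even (κ := κ - N) hirr hodd hu ?_ (by omega) (by omega)
    (hp.sub_odd (by exact_mod_cast hodd))
  rw [zpow_sub, zpow_natCast, hu.pow_eq_one, inv_one, mul_one, hτ]

theorem IsSphericalCheck.finrank_ne_two {ρ : Rep (u ^ 2) τ V} (hN : 2 < N)
    (hu : IsPrimitiveRoot (u ^ 2) N) (h : ρ.IsSphericalCheck u (N - 2)) :
    Module.finrank ℂ V ≠ 2 := by
  obtain ⟨_, hτ, hf⟩ := h
  obtain ⟨ρ', φ, -, hφ, -, -⟩ := hf.exists_isQuotMap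
  refine hφ.finrank_ne_two (hu.pow_ne_one_of_pos_of_lt (by norm_num) hN) ?_
  rw [hτ, zpow_two_mul, ← zpow_natCast (u ^ 2) 2, ← zpow_add]
  push_cast
  rw [sub_add_cancel, zpow_natCast, hu.pow_eq_one]

theorem IsAlphaBoundary.finite {ρ : Rep u τ V} (hN : 0 < N) (hu : IsPrimitiveRoot u (2 * N))
    (h : ρ.IsAlphaBoundary N) : Finite ρ.imageB := by
  obtain ⟨hτ, hf⟩ := h
  obtain ⟨ρ', φ, hirr, hφ, hf, hfin⟩ := hf.exists_isQuotMap
  rw [← hfin]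
  exact hφ.finite_alpha_boundary hirr hN (by omega) hu.pow_eq_one hτ hf

theorem IsGammaCheckBoundary.finite {ρ : Rep (u ^ 2) τ V} (hN : 0 < N)
    (hu : (u ^ 2) ^ N = 1) (h : ρ.IsGammaCheckBoundary N) : Finite ρ.imageB := by
  obtain ⟨hτ, hf⟩ := h
  obtain ⟨ρ', φ, hirr, hφ, hf, hfin⟩ := hf.exists_isQuotMap
  rw [← hfin]
  exact hφ.finite_of_mono_periodic hirr (by omega) hN hu hτ (hφ.mono_sub_one_eq_zero hirr hu hτ hf)

end Rep
end DAHA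
end

/-! ### The classification of finite images -/

theorem mainTheorem3 (N : ℕ) (hN : 1 < N) (u : ℂˣ) (hu : IsPrimitiveRoot u (2 * N))
    (V : Type*) [AddCommGroup V] [Module ℂ V] :
    -- types (α), (β), (γ)
    (∀ (κ : ℤ) (τ : ℂˣ) (ρ : DAHA.Rep u τ V), ρ.IsAlpha N κ →
      (Finite ρ.imageB ↔
        (κ = N - 1 ∧ Module.finrank ℂ V = 2) ∨
        (2 < N ∧ κ = N - 2 ∧ Module.finrank ℂ V = 4) ∨
        (N = 6 ∧ κ = 2 * 1 ∧ Module.finrank ℂ V = 8) ∨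
        (N = 10 ∧ κ = 2 * 3 ∧ Module.finrank ℂ V = 8))) ∧
    (∀ (κ : ℤ) (τ : ℂˣ) (ρ : DAHA.Rep u τ V), ρ.IsBeta N κ → ¬ Finite ρ.imageB) ∧
    (∀ (κ : ℤ) (τ : ℂˣ) (ρ : DAHA.Rep u τ V), ρ.IsGamma N κ →
      (Finite ρ.imageB ↔ Module.finrank ℂ V = 1)) ∧
    -- the checked types, for odd N
    (Odd N → ∀ (κ : ℤ) (τ : ℂˣ) (ρ : DAHA.Rep (u ^ 2) τ V),
      (ρ.IsAlphaBetaCheck N u κ ∨ ρ.IsGammaCheck N u κ →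
        (Finite ρ.imageB ↔ Module.finrank ℂ V = 1)) ∧
      (ρ.IsSphericalCheck u κ → 0 < κ → κ < N → Odd κ → ¬ Finite ρ.imageB)) ∧
    -- the substitution q ↦ q², t ↦ t² for even N > 2 and k = (N - 2) / 2
    (Even N → 2 < N → ∀ (τ : ℂˣ) (ρ : DAHA.Rep (u ^ 2) τ V),
      ρ.IsSphericalCheck u (N - 2) → Module.finrank ℂ V ≠ 2) ∧
    -- the omitted boundary cases
    (∀ (τ : ℂˣ) (ρ : DAHA.Rep u τ V), ρ.IsAlphaBoundary N → Finite ρ.imageB) ∧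
    (Odd N → ∀ (τ : ℂˣ) (ρ : DAHA.Rep (u ^ 2) τ V),
      ρ.IsGammaCheckBoundary N → Finite ρ.imageB) := by
  have hu2 : IsPrimitiveRoot (u ^ 2) N := hu.pow (by omega) rfl
  exact ⟨fun κ τ ρ h => h.finite_iff hu, fun κ τ ρ h => h.not_finite hu,
    fun κ τ ρ h => h.finite_iff hu,
    fun hodd κ τ ρ => ⟨fun h => h.elim (fun h => h.finite_iff hodd hu2)
      fun h => h.finite_iff hodd hu2, fun h hκ hκN hp => h.not_finite hodd hu2 hκ hκN hp⟩,
    fun _ hN2 τ ρ h => h.finrank_ne_two hN2 hu2,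
    fun τ ρ h => h.finite (by omega) hu,
    fun _ τ ρ h => h.finite (by omega) hu2.pow_eq_one⟩
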